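/- Let $k$ be a commutative unital ring and $G$ a group. All algebras are associative $k$-algebras, not necessarily unital; a product $MN$ of $k$-submodules means the $k$-span of the products $mn$. A multiplier $w$ of an algebra $I$ is a pair of $k$-linear maps $a\mapsto wa$, $a\mapsto aw$ of $I$ with $w(ab)=(wa)b$, $(ab)w=a(bw)$, $(aw)b=a(wb)$; these form a monoid $\mathcal M(I)$ under $(ww')a=w(w'a)$, $a(ww')=(aw)w'$. A *twisted partial action* $\Theta$ of $G$ on an algebra $A$ consists of two-sided ideals $D_g$ of $A$, $k$-algebra isomorphisms $\theta_g:D_{g^{-1}}\to D_g$, and invertible $w_{g,h}\in\mathcal M(D_gD_{gh})$ such that for all $g,h,t\in G$: $D_g^2=D_g$ and $D_gD_h=D_hD_g$; $D_1=A$ and $\theta_1=\mathrm{id}$; $\theta_g(D_{g^{-1}}D_h)=D_gD_{gh}$; $\theta_g(\theta_h(a))=w_{g,h}\theta_{gh}(a)w_{g,h}^{-1}$ for $a\in D_{h^{-1}}D_{h^{-1}g^{-1}}$; $w_{1,g}=w_{g,1}=1$; $\theta_g(aw_{h,t})w_{g,ht}=\theta_g(a)w_{g,h}w_{gh,t}$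 for $a\in D_{g^{-1}}D_hD_{ht}$. The *crossed product* $A\rtimes_\Theta G$ is $\bigoplus_{g}D_g\delta_g$ with $(a\delta_g)(b\delta_h)=\theta_g(\theta_g^{-1}(a)b)w_{g,h}\,\delta_{gh}$. Let $B=\bigoplus_{g\in G}B_g$ be a $G$-graded algebra that is *homogeneously non-degenerate*: for all $g$ and $0\ne x\in B_g$, $xB_{g^{-1}}\neq0$ and $B_{g^{-1}}x\ne0$. Let $$C_g=\begin{pmatrix}B_gB_{g^{-1}}&B_g\\B_{g^{-1}}&B_{g^{-1}}B_g\end{pmatrix}$$ be the linking algebra, and $e_{11},e_{22}\in\mathcal M(C_g)$ the multipliers given by the usual matrix units. **Theorem.** $B$ is isomorphic as a graded algebra to a crossed product by a twisted partial action of $G$ on some algebra if and only if (i) $B_gB_{g^{-1}}B_g=B_g$ for all $g\in G$; and (ii) for every $g\in G$ there are $u_g,v_g\in\mathcal M(C_g)$ with $u_gv_g=e_{11}$ and $v_gu_g=e_{22}$. Moreover, assume (i) and (ii). Then the families in (ii) can be chosen with $u_1,v_1$ acting on $C_1$ as the matrix units $e_{12},e_{21}$. For every such choice, $u_g$ induces,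 through the entries of $C_g$, maps $x\mapsto u_gx$ on $B_{g^{-1}}$ and on $B_{g^{-1}}B_g$ and maps $x\mapsto xu_g$ on $B_{g^{-1}}$ and on $B_gB_{g^{-1}}$, and $v_g$ induces maps $x\mapsto v_gx$ on $B_g$ and $x\mapsto xv_g$ on $B_g$ and on $B_{g^{-1}}B_g$. The $k$-linear maps $B_{g^{-1}}B\to B$, $xy\mapsto(u_gx)y$; $B_gB\to B$, $xy\mapsto(v_gx)y$; $BB_{g^{-1}}\to B$, $xy\mapsto x(yu_g)$; $BB_g\to B$, $xy\mapsto x(yv_g)$ are well defined, and are again written as left and right multiplication by $u_g$, $v_g$. Then $$D_g=B_gB_{g^{-1}},\qquad \theta_g(x)=u_gxv_g,\qquad w_{g,h}=u_gu_hv_{gh}$$ (all compositions being defined on $D_gD_{gh}$, on both sides) form a twisted partial action $\Theta$ of $G$ on $B_1$, and $$\varphi:B\to B_1\rtimes_\Theta G,\qquad \sum a_g\mapsto\sum a_gv_g\,\delta_g\quad(a_g\in B_g)$$ is an isomorphism of graded algebras with inverse $\sum a_g\delta_g\mapsto\sum a_gu_g$ $(a_g\in D_g)$. -/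

import Mathlib

universe uk uG uA uB

namespace PartialCrossed

open scoped DirectSum

/-! ### Multiplier algebras -/

/-- A multiplier of a (not necessarily unital) `k`-algebra `A`: a left multiplier `a ↦ w a` and a
right multiplier `a ↦ a w`, both `k`-linear, with `(a w) b = a (w b)`. -/
@[ext]
structure Multiplier (k : Type uk) (A : Type uA) [CommRing k] [NonUnitalRing A] [Module k A] where
  left : A →ₗ[k] A
  right : A →ₗ[k] A
  left_mul : ∀ a b, left (a * b) = left a * b
  right_mul : ∀ a b, right (a * b) = a * right b
  right_mul_eq : ∀ a b, right a * b = a * left b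

namespace Multiplier

variable {k : Type uk} {A : Type uA} [CommRing k] [NonUnitalRing A] [Module k A]

/-- Composition product: `(w w') a = w (w' a)` and `a (w w') = (a w) w'`. -/
instance : Monoid (Multiplier k A) where
  mul w w' :=
    { left := w.left ∘ₗ w'.left
      right := w'.right ∘ₗ w.right
      left_mul := fun a b => by simp [left_mul]
      right_mul := fun a b => by simp [right_mul]
      right_mul_eq := fun a b => by simp [right_mul_eq] }
  one :=
    { left := LinearMap.id
      right := LinearMap.id
      left_mul := fun _ _ => rfl
      right_mul := fun _ _ => rfl
      right_mul_eq := fun _ _ => rfl }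
  mul_assoc _ _ _ := rfl
  one_mul _ := rfl
  mul_one _ := rfl

end Multiplier

/-! ### Two-sided ideals and their products -/

/-- The `k`-span of the products `m * n` with `m ∈ M`, `n ∈ N`. -/
abbrev prodSpan {k : Type uk} {A : Type uA} [CommRing k] [NonUnitalRing A] [Module k A]
    [IsScalarTower k A A] [SMulCommClass k A A] (M N : Submodule k A) : Submodule k A :=
  Submodule.map₂ (LinearMap.mul k A) M N

/-- A two-sided ideal of the `k`-algebra `A`. -/
structure AlgIdeal (k : Type uk) (A : Type uA) [CommRing k] [NonUnitalRing A] [Module k A]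
    extends Submodule k A where
  mul_mem_left' : ∀ (a : A) {x : A}, x ∈ carrier → a * x ∈ carrier
  mul_mem_right' : ∀ {x : A} (a : A), x ∈ carrier → x * a ∈ carrier

namespace AlgIdeal

section Basic

variable {k : Type uk} {A : Type uA} [CommRing k] [NonUnitalRing A] [Module k A]

instance : SetLike (AlgIdeal k A) A where
  coe I := I.carrier
  coe_injective I J h := by
    cases I; cases J; congr; exact SetLike.coe_injective h

instance : NonUnitalSubringClass (AlgIdeal k A) A where
  add_mem {I} _ _ ha hb := I.toSubmodule.add_mem ha hb
  zero_mem I := I.toSubmodule.zero_mem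
  neg_mem {I} _ ha := I.toSubmodule.neg_mem ha
  mul_mem {I} a _ _ hb := I.mul_mem_left' a hb

instance : SMulMemClass (AlgIdeal k A) k A where
  smul_mem {I} r _ hx := I.toSubmodule.smul_mem r hx

theorem mul_mem_left (I : AlgIdeal k A) (a : A) {x : A} (hx : x ∈ I) : a * x ∈ I :=
  I.mul_mem_left' a hx

theorem mul_mem_right (I : AlgIdeal k A) {x : A} (a : A) (hx : x ∈ I) : x * a ∈ I :=
  I.mul_mem_right' a hx

/-- The whole algebra. -/
instance : Top (AlgIdeal k A) where
  top := { (⊤ : Submodule k A) with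
    mul_mem_left' := fun _ _ _ => trivial
    mul_mem_right' := fun _ _ => trivial }

end Basic

variable {k : Type uk} {A : Type uA} [CommRing k] [NonUnitalRing A] [Module k A]
  [IsScalarTower k A A] [SMulCommClass k A A]

/-- The product of two ideals: the `k`-span of the products. -/
instance : Mul (AlgIdeal k A) where
  mul I J :=
    { prodSpan I.toSubmodule J.toSubmodule with
      mul_mem_left' := fun a x hx => by
        have h : prodSpan I.toSubmodule J.toSubmodule ≤
            (prodSpan I.toSubmodule J.toSubmodule).comap (LinearMap.mul k A a) := by
          refine Submodule.map₂_le.2 fun m hm n hn => ?_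
          have := Submodule.apply_mem_map₂ (LinearMap.mul k A) (I.mul_mem_left a hm) hn
          simpa [mul_assoc] using this
        exact h hx
      mul_mem_right' := fun {x} a hx => by
        have h : prodSpan I.toSubmodule J.toSubmodule ≤
            (prodSpan I.toSubmodule J.toSubmodule).comap ((LinearMap.mul k A).flip a) := by
          refine Submodule.map₂_le.2 fun m hm n hn => ?_
          have := Submodule.apply_mem_map₂ (LinearMap.mul k A) hm (J.mul_mem_right a hn)
          simpa [mul_assoc] using this
        exact h hx }

theorem mul_mem_mul {I J : AlgIdeal k A} {x y : A} (hx : x ∈ I) (hy : y ∈ J) : x * y ∈ I * J :=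
  Submodule.apply_mem_map₂ (LinearMap.mul k A) hx hy

theorem mul_le {I J : AlgIdeal k A} {N : Submodule k A}
    (h : ∀ x ∈ I, ∀ y ∈ J, x * y ∈ N) : ∀ x ∈ I * J, x ∈ N := fun _ hx =>
  (Submodule.map₂_le.2 h : prodSpan I.toSubmodule J.toSubmodule ≤ N) hx

theorem mem_left_of_mem_mul {I J : AlgIdeal k A} {x : A} (hx : x ∈ I * J) : x ∈ I :=
  mul_le (N := I.toSubmodule) (fun _ hx y _ => I.mul_mem_right y hx) _ hx

theorem mem_right_of_mem_mul {I J : AlgIdeal k A} {x : A} (hx : x ∈ I * J) : x ∈ J :=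
  mul_le (N := J.toSubmodule) (fun x _ _ hy => J.mul_mem_left x hy) _ hx

theorem mul_mono {I I' J J' : AlgIdeal k A} (h : ∀ x ∈ I, x ∈ I') (h' : ∀ x ∈ J, x ∈ J') {x : A}
    (hx : x ∈ I * J) : x ∈ I' * J' :=
  mul_le (N := (I' * J').toSubmodule) (fun _ hx _ hy => mul_mem_mul (h _ hx) (h' _ hy)) _ hx

theorem mul_assoc' (I J K : AlgIdeal k A) : I * J * K = I * (J * K) := by
  refine SetLike.ext fun x => ⟨fun hx => ?_, fun hx => ?_⟩
  · refine mul_le (N := (I * (J * K)).toSubmodule) (fun y hy z hz => ?_) _ hx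
    refine mul_le (N := (I * (J * K)).toSubmodule.comap ((LinearMap.mul k A).flip z))
      (fun a ha b hb => ?_) _ hy
    have : a * (b * z) ∈ I * (J * K) := mul_mem_mul ha (mul_mem_mul hb hz)
    rw [← mul_assoc] at this
    exact this
  · refine mul_le (N := (I * J * K).toSubmodule) (fun y hy z hz => ?_) _ hx
    refine mul_le (N := (I * J * K).toSubmodule.comap (LinearMap.mul k A y))
      (fun a ha b hb => ?_) _ hz
    have : y * a * b ∈ I * J * K := mul_mem_mul (mul_mem_mul hy ha) hb
    rw [mul_assoc] at this
    exact this

instance : Semigroup (AlgIdeal k A) where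
  mul_assoc := mul_assoc'

/-- A multiplier of an ideal `I` preserves every idempotent ideal contained in `I`. -/
theorem right_mem {I J : AlgIdeal k A} (hJ : J * J = J) (hJI : ∀ x ∈ J, x ∈ I)
    (w : Multiplier k I) {a : A} (ha : a ∈ J) (haI : a ∈ I) : (w.right ⟨a, haI⟩ : A) ∈ J := by
  have key : ∀ x ∈ J * J, ∃ hx : x ∈ I, (w.right ⟨x, hx⟩ : A) ∈ J := by
    refine mul_le (N :=
      { carrier := {x | ∃ hx : x ∈ I, (w.right ⟨x, hx⟩ : A) ∈ J}
        add_mem' := ?_, zero_mem' := ?_, smul_mem' := ?_ }) (fun x hx y hy => ?_)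
    · rintro x y ⟨hx, hx'⟩ ⟨hy, hy'⟩
      refine ⟨add_mem hx hy, ?_⟩
      have h := w.right.map_add ⟨x, hx⟩ ⟨y, hy⟩
      have h' := add_mem hx' hy'
      rwa [← AddMemClass.coe_add, ← h] at h'
    · refine ⟨zero_mem I, ?_⟩
      have h := w.right.map_zero
      have h' : ((0 : I) : A) ∈ J := zero_mem J
      rwa [← h] at h'
    · rintro c x ⟨hx, hx'⟩
      refine ⟨SMulMemClass.smul_mem c hx, ?_⟩
      have h := w.right.map_smul c ⟨x, hx⟩
      have h' : ((c • w.right ⟨x, hx⟩ : I) : A) ∈ J := SMulMemClass.smul_mem c hx'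
      rwa [← h] at h'
    · refine ⟨I.mul_mem_left x (hJI y hy), ?_⟩
      have h := w.right_mul ⟨x, hJI x hx⟩ ⟨y, hJI y hy⟩
      have h' : ((⟨x, hJI x hx⟩ * w.right ⟨y, hJI y hy⟩ : I) : A) ∈ J :=
        J.mul_mem_right _ hx
      rwa [← h] at h'
  exact (key a (hJ.symm ▸ ha)).2

end AlgIdeal

/-! ### Twisted partial actions -/

/-- The ideals and isomorphisms of a twisted partial action, with the postulates that do not
involve the twist. -/
structure PartialSystem (k : Type uk) (G : Type uG) (A : Type uA) [CommRing k] [Group G]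
    [NonUnitalRing A] [Module k A] [IsScalarTower k A A] [SMulCommClass k A A] where
  D : G → AlgIdeal k A
  θ : ∀ g, D g⁻¹ ≃ₗ[k] D g
  θ_mul : ∀ g x y, θ g (x * y) = θ g x * θ g y
  D_idem : ∀ g, D g * D g = D g
  D_comm : ∀ g h, D g * D h = D h * D g
  D_one : D 1 = ⊤
  θ_one : ∀ x : D 1⁻¹, (θ 1 x : A) = x
  θ_image : ∀ g h, (fun x : D g⁻¹ => (θ g x : A)) '' {x | (x : A) ∈ D g⁻¹ * D h} =
    (D g * D (g * h) : AlgIdeal k A)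

namespace PartialSystem

variable {k : Type uk} {G : Type uG} {A : Type uA} [CommRing k] [Group G]
  [NonUnitalRing A] [Module k A] [IsScalarTower k A A] [SMulCommClass k A A]
  (P : PartialSystem k G A)

theorem θ_mem {g h : G} {x : P.D g⁻¹} (hx : (x : A) ∈ P.D g⁻¹ * P.D h) :
    (P.θ g x : A) ∈ P.D g * P.D (g * h) := by
  have : (P.θ g x : A) ∈ ((P.D g * P.D (g * h) : AlgIdeal k A) : Set A) := by
    rw [← P.θ_image]; exact ⟨x, hx, rfl⟩
  exact this

theorem D_idem₃ (g h t : G) :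
    (P.D g * P.D h * P.D t) * (P.D g * P.D h * P.D t) = P.D g * P.D h * P.D t := by
  have c : ∀ a b, Commute (P.D a) (P.D b) := P.D_comm
  have i : ∀ a, IsIdempotentElem (P.D a) := P.D_idem
  have igh : IsIdempotentElem (P.D g * P.D h) := (i g).mul_of_commute (c g h) (i h)
  exact igh.mul_of_commute ((c g t).mul_left (c h t)) (i t)

theorem mem₁₃ {g h t : G} {x : A} (hx : x ∈ P.D g * P.D h * P.D t) : x ∈ P.D g * P.D t :=
  AlgIdeal.mul_mono (fun _ => AlgIdeal.mem_left_of_mem_mul) (fun _ h => h) hx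

theorem mem₂₃ {g h t : G} {x : A} (hx : x ∈ P.D g * P.D h * P.D t) : x ∈ P.D h * P.D t :=
  AlgIdeal.mul_mono (fun _ => AlgIdeal.mem_right_of_mem_mul) (fun _ h => h) hx

theorem mem₁₂ {g h t : G} {x : A} (hx : x ∈ P.D g * P.D h * P.D t) : x ∈ P.D g * P.D h :=
  AlgIdeal.mem_left_of_mem_mul hx

theorem mem₁ {g h t : G} {x : A} (hx : x ∈ P.D g * P.D h * P.D t) : x ∈ P.D g :=
  AlgIdeal.mem_left_of_mem_mul (AlgIdeal.mem_left_of_mem_mul hx)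

theorem θ_mem₃ {g h t : G} {x : P.D g⁻¹} (hx : (x : A) ∈ P.D g⁻¹ * P.D h * P.D t) :
    (P.θ g x : A) ∈ P.D g * P.D (g * h) * P.D (g * t) := by
  have key : ∀ y ∈ (P.D g⁻¹ * P.D h * P.D t) * (P.D g⁻¹ * P.D h * P.D t),
      y ∈ ((P.D g * P.D (g * h) * P.D (g * t)).toSubmodule.comap
        ((P.D g).toSubmodule.subtype ∘ₗ (P.θ g).toLinearMap)).map
          (P.D g⁻¹).toSubmodule.subtype := by
    refine AlgIdeal.mul_le fun y hy z hz =>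
      ⟨(⟨y, P.mem₁ hy⟩ * ⟨z, P.mem₁ hz⟩ : P.D g⁻¹), ?_, rfl⟩
    change (P.θ g (⟨y, P.mem₁ hy⟩ * ⟨z, P.mem₁ hz⟩) : A) ∈ P.D g * P.D (g * h) * P.D (g * t)
    rw [P.θ_mul]
    exact AlgIdeal.mul_mem_mul (P.θ_mem (P.mem₁₂ hy))
      (AlgIdeal.mem_right_of_mem_mul (P.θ_mem (P.mem₁₃ hz)))
  rw [← P.D_idem₃] at hx
  obtain ⟨y, hy, hyx⟩ := key _ hx
  have : y = x := Subtype.ext hyx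
  subst this
  exact hy

/-- If `a ∈ D_{h⁻¹} D_{h⁻¹g⁻¹}` then `a` lies in the domain of `θ_{gh}`. -/
theorem mem_dom {g h : G} {a : A} (ha : a ∈ P.D h⁻¹ * P.D (h⁻¹ * g⁻¹)) : a ∈ P.D (g * h)⁻¹ := by
  rw [mul_inv_rev]; exact AlgIdeal.mem_right_of_mem_mul ha

/-- If `a ∈ D_{h⁻¹} D_{h⁻¹g⁻¹}` then `θ_h(a)` lies in the domain of `θ_g`. -/
theorem θ_mem_dom {g h : G} {a : A} (ha : a ∈ P.D h⁻¹ * P.D (h⁻¹ * g⁻¹)) :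
    (P.θ h ⟨a, AlgIdeal.mem_left_of_mem_mul ha⟩ : A) ∈ P.D g⁻¹ := by
  have := P.θ_mem (x := ⟨a, AlgIdeal.mem_left_of_mem_mul ha⟩) ha
  rw [mul_inv_cancel_left] at this
  exact AlgIdeal.mem_right_of_mem_mul this

/-- If `a ∈ D_{h⁻¹} D_{h⁻¹g⁻¹}` then `θ_{gh}(a) ∈ D_g D_{gh}`. -/
theorem θ_mem_twist {g h : G} {a : A} (ha : a ∈ P.D h⁻¹ * P.D (h⁻¹ * g⁻¹)) :
    (P.θ (g * h) ⟨a, P.mem_dom ha⟩ : A) ∈ P.D g * P.D (g * h) := by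
  have ha' : a ∈ P.D (g * h)⁻¹ * P.D h⁻¹ := by rwa [mul_inv_rev, P.D_comm]
  have := P.θ_mem (x := ⟨a, P.mem_dom ha⟩) ha'
  rwa [mul_inv_cancel_right, P.D_comm] at this

variable (w : ∀ g h, (Multiplier k ↥(P.D g * P.D (g * h)))ˣ) {g h t : G} {a : A}

theorem cocycle_mem₁ (ha : a ∈ P.D g⁻¹ * P.D h * P.D (h * t)) :
    ((w h t).val.right ⟨a, P.mem₂₃ ha⟩ : A) ∈ P.D g⁻¹ * P.D h * P.D (h * t) :=
  AlgIdeal.right_mem (P.D_idem₃ _ _ _) (fun _ => P.mem₂₃) _ ha _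

theorem cocycle_mem₂ (ha : a ∈ P.D g⁻¹ * P.D h * P.D (h * t)) :
    (P.θ g ⟨(w h t).val.right ⟨a, P.mem₂₃ ha⟩, P.mem₁ (P.cocycle_mem₁ w ha)⟩ : A) ∈
      P.D g * P.D (g * (h * t)) :=
  P.mem₁₃ (P.θ_mem₃ (x := ⟨_, P.mem₁ (P.cocycle_mem₁ w ha)⟩) (P.cocycle_mem₁ w ha))

theorem cocycle_mem₃ (ha : a ∈ P.D g⁻¹ * P.D h * P.D (h * t)) :
    (P.θ g ⟨a, P.mem₁ ha⟩ : A) ∈ P.D g * P.D (g * h) :=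
  P.θ_mem (P.mem₁₂ ha)

theorem cocycle_mem₄ (ha : a ∈ P.D g⁻¹ * P.D h * P.D (h * t)) :
    ((w g h).val.right ⟨P.θ g ⟨a, P.mem₁ ha⟩, P.cocycle_mem₃ ha⟩ : A) ∈
      P.D (g * h) * P.D (g * h * t) := by
  have h₁ := P.θ_mem₃ (x := ⟨a, P.mem₁ ha⟩) ha
  have h₂ := AlgIdeal.right_mem (P.D_idem₃ _ _ _) (fun _ => P.mem₁₂) (w g h).val h₁
    (P.cocycle_mem₃ ha)
  rw [mul_assoc g h t]
  exact P.mem₂₃ h₂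

end PartialSystem

/-- A twisted partial action of `G` on the `k`-algebra `A`. -/
structure TwistedPartialAction (k : Type uk) (G : Type uG) (A : Type uA) [CommRing k] [Group G]
    [NonUnitalRing A] [Module k A] [IsScalarTower k A A] [SMulCommClass k A A]
    extends PartialSystem k G A where
  w : ∀ g h, (Multiplier k ↥(D g * D (g * h)))ˣ
  /-- `θ_g(θ_h(a)) = w_{g,h} θ_{gh}(a) w_{g,h}⁻¹`. -/
  θ_θ : ∀ (g h : G) (a : A) (ha : a ∈ D h⁻¹ * D (h⁻¹ * g⁻¹)),
    (θ g ⟨θ h ⟨a, AlgIdeal.mem_left_of_mem_mul ha⟩, toPartialSystem.θ_mem_dom ha⟩ : A) =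
      ((w g h)⁻¹).val.right ((w g h).val.left
        ⟨θ (g * h) ⟨a, toPartialSystem.mem_dom ha⟩, toPartialSystem.θ_mem_twist ha⟩)
  w_one_left : ∀ g, w 1 g = 1
  w_one_right : ∀ g, w g 1 = 1
  /-- `θ_g(a w_{h,t}) w_{g,ht} = θ_g(a) w_{g,h} w_{gh,t}`. -/
  cocycle : ∀ (g h t : G) (a : A) (ha : a ∈ D g⁻¹ * D h * D (h * t)),
    ((w g (h * t)).val.right
      ⟨θ g ⟨(w h t).val.right ⟨a, toPartialSystem.mem₂₃ ha⟩,
        toPartialSystem.mem₁ (toPartialSystem.cocycle_mem₁ w ha)⟩,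
        toPartialSystem.cocycle_mem₂ w ha⟩ : A) =
    (w (g * h) t).val.right
      ⟨(w g h).val.right ⟨θ g ⟨a, toPartialSystem.mem₁ ha⟩, toPartialSystem.cocycle_mem₃ ha⟩,
        toPartialSystem.cocycle_mem₄ w ha⟩

/-! ### The crossed product -/

/-- The underlying `k`-module `⨁_g D_g δ_g` of the crossed product. -/
def CrossedProduct {k : Type uk} {G : Type uG} {A : Type uA} [CommRing k] [Group G]
    [NonUnitalRing A] [Module k A] [IsScalarTower k A A] [SMulCommClass k A A]
    (Θ : TwistedPartialAction k G A) : Type (max uG uA) :=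
  ⨁ g, Θ.D g

namespace CrossedProduct

variable {k : Type uk} {G : Type uG} {A : Type uA} [CommRing k] [Group G] [DecidableEq G]
  [NonUnitalRing A] [Module k A] [IsScalarTower k A A] [SMulCommClass k A A]
  (Θ : TwistedPartialAction k G A)

instance : AddCommGroup (CrossedProduct Θ) := inferInstanceAs (AddCommGroup (⨁ g, Θ.D g))

instance : Module k (CrossedProduct Θ) := inferInstanceAs (Module k (⨁ g, Θ.D g))

/-- The map `a ↦ a δ_g`. -/
def δ (g : G) : Θ.D g →ₗ[k] CrossedProduct Θ := DirectSum.lof k G (fun g => Θ.D g) g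

/-- The linear map on `⨁_g D_g δ_g` with given restrictions to the summands. -/
def lift {M : Type*} [AddCommMonoid M] [Module k M] (f : ∀ g, Θ.D g →ₗ[k] M) :
    CrossedProduct Θ →ₗ[k] M :=
  DirectSum.toModule k G M f

theorem lift_δ {M : Type*} [AddCommMonoid M] [Module k M] (f : ∀ g, Θ.D g →ₗ[k] M) (g : G)
    (a : Θ.D g) : lift Θ f (δ Θ g a) = f g a :=
  DirectSum.toModule_lof k (φ := f) g a

/-- For `a ∈ D_g`, `b ∈ D_h`, the element `θ_g⁻¹(a) b` of `D_{g⁻¹}`. -/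
def preArg (g h : G) (a : Θ.D g) (b : Θ.D h) : Θ.D g⁻¹ :=
  ⟨((Θ.θ g).symm a : A) * b, (Θ.D g⁻¹).mul_mem_right _ ((Θ.θ g).symm a).2⟩

/-- For `a ∈ D_g`, `b ∈ D_h`, the element `θ_g(θ_g⁻¹(a) b)` of `D_g D_{gh}`. -/
def preMul (g h : G) (a : Θ.D g) (b : Θ.D h) : ↥(Θ.D g * Θ.D (g * h)) :=
  ⟨Θ.θ g (preArg Θ g h a b), Θ.θ_mem (AlgIdeal.mul_mem_mul ((Θ.θ g).symm a).2 b.2)⟩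

/-- The coefficient `θ_g(θ_g⁻¹(a) b) w_{g,h}` of the product `(a δ_g) (b δ_h)`. -/
def coeffMul (g h : G) : Θ.D g →ₗ[k] Θ.D h →ₗ[k] Θ.D (g * h) :=
  LinearMap.mk₂ k
    (fun a b => ⟨(Θ.w g h).val.right (preMul Θ g h a b),
      AlgIdeal.mem_right_of_mem_mul ((Θ.w g h).val.right (preMul Θ g h a b)).2⟩)
    (fun a a' b => by
      have : preMul Θ g h (a + a') b = preMul Θ g h a b + preMul Θ g h a' b := by
        apply Subtype.ext
        have e : preArg Θ g h (a + a') b = preArg Θ g h a b + preArg Θ g h a' b :=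
          Subtype.ext (by simp [preArg, add_mul])
        simp [preMul, e]
      apply Subtype.ext
      simp [this])
    (fun c a b => by
      have : preMul Θ g h (c • a) b = c • preMul Θ g h a b := by
        apply Subtype.ext
        have e : preArg Θ g h (c • a) b = c • preArg Θ g h a b :=
          Subtype.ext (by simp [preArg, smul_mul_assoc])
        simp [preMul, e]
      apply Subtype.ext
      simp [this])
    (fun a b b' => by
      have : preMul Θ g h a (b + b') = preMul Θ g h a b + preMul Θ g h a b' := by
        apply Subtype.ext
        have e : preArg Θ g h a (b + b') = preArg Θ g h a b + preArg Θ g h a b' :=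
          Subtype.ext (by simp [preArg, mul_add])
        simp [preMul, e]
      apply Subtype.ext
      simp [this])
    (fun c a b => by
      have : preMul Θ g h a (c • b) = c • preMul Θ g h a b := by
        apply Subtype.ext
        have e : preArg Θ g h a (c • b) = c • preArg Θ g h a b :=
          Subtype.ext (by simp [preArg, mul_smul_comm])
        simp [preMul, e]
      apply Subtype.ext
      simp [this])

/-- The bilinear multiplication with `(a δ_g) (b δ_h) = θ_g(θ_g⁻¹(a) b) w_{g,h} δ_{gh}`. -/
def mulHom : CrossedProduct Θ →ₗ[k] CrossedProduct Θ →ₗ[k] CrossedProduct Θ :=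
  lift Θ fun g =>
    (lift Θ fun h => ((coeffMul Θ g h).compr₂ (δ Θ (g * h))).flip).flip

instance : Mul (CrossedProduct Θ) := ⟨fun x y => mulHom Θ x y⟩

theorem δ_mul_δ (g h : G) (a : Θ.D g) (b : Θ.D h) :
    δ Θ g a * δ Θ h b = δ Θ (g * h) (coeffMul Θ g h a b) := by
  have h₁ : mulHom Θ (δ Θ g a) =
      (lift Θ fun h => ((coeffMul Θ g h).compr₂ (δ Θ (g * h))).flip).flip a := lift_δ Θ _ g a
  change mulHom Θ (δ Θ g a) (δ Θ h b) = _
  rw [h₁, LinearMap.flip_apply, lift_δ]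
  rfl

end CrossedProduct

/-! ### Graded algebras -/

/-- A `G`-grading of the `k`-algebra `B`: an internal direct sum decomposition `B = ⨁_g B_g` with
`B_g B_h ⊆ B_{gh}`. -/
structure Grading (k : Type uk) (G : Type uG) (B : Type uB) [CommRing k] [Group G] [DecidableEq G]
    [NonUnitalRing B] [Module k B] where
  comp : G → Submodule k B
  mul_mem : ∀ {g h : G} {x y : B}, x ∈ comp g → y ∈ comp h → x * y ∈ comp (g * h)
  isInternal : DirectSum.IsInternal comp

namespace Grading

section Basic

variable {k : Type uk} {G : Type uG} {B : Type uB} [CommRing k] [Group G] [DecidableEq G]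
  [NonUnitalRing B] [Module k B]

/-- The subalgebra `B_1`. -/
def one (ℬ : Grading k G B) : NonUnitalSubalgebra k B :=
  { ℬ.comp 1 with mul_mem' := fun hx hy => by simpa using ℬ.mul_mem hx hy }

/-- For `0 ≠ x ∈ B_g`, both `x B_{g⁻¹} ≠ 0` and `B_{g⁻¹} x ≠ 0`. -/
def HomogeneouslyNondegenerate (ℬ : Grading k G B) : Prop :=
  ∀ (g : G), ∀ x ∈ ℬ.comp g, x ≠ 0 →
    (∃ y ∈ ℬ.comp g⁻¹, x * y ≠ 0) ∧ (∃ y ∈ ℬ.comp g⁻¹, y * x ≠ 0)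

end Basic

variable {k : Type uk} {G : Type uG} {B : Type uB} [CommRing k] [Group G] [DecidableEq G]
  [NonUnitalRing B] [Module k B] [IsScalarTower k B B] [SMulCommClass k B B]

/-- `B_g B_{g⁻¹} B_g = B_g` for all `g`. -/
def TripleProduct (ℬ : Grading k G B) : Prop :=
  ∀ g, prodSpan (prodSpan (ℬ.comp g) (ℬ.comp g⁻¹)) (ℬ.comp g) = ℬ.comp g

/-- The four blocks of the linking algebra
`C_g = (B_g B_{g⁻¹}, B_g; B_{g⁻¹}, B_{g⁻¹} B_g)`. -/
def block (ℬ : Grading k G B) (g : G) : Fin 2 → Fin 2 → Submodule k B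
  | 0, 0 => prodSpan (ℬ.comp g) (ℬ.comp g⁻¹)
  | 0, 1 => ℬ.comp g
  | 1, 0 => ℬ.comp g⁻¹
  | 1, 1 => prodSpan (ℬ.comp g⁻¹) (ℬ.comp g)

theorem prodSpan_le (ℬ : Grading k G B) (g h : G) :
    prodSpan (ℬ.comp g) (ℬ.comp h) ≤ ℬ.comp (g * h) :=
  Submodule.map₂_le.2 fun _ hm _ hn => ℬ.mul_mem hm hn

theorem block_mul (ℬ : Grading k G B) (g : G) (i l j : Fin 2) {x y : B}
    (hx : x ∈ ℬ.block g i l) (hy : y ∈ ℬ.block g l j) : x * y ∈ ℬ.block g i j := by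
  have one_left : ∀ {h : G} {a b : B}, a ∈ ℬ.comp 1 → b ∈ ℬ.comp h → a * b ∈ ℬ.comp h :=
    fun ha hb => by simpa using ℬ.mul_mem ha hb
  have one_right : ∀ {h : G} {a b : B}, a ∈ ℬ.comp h → b ∈ ℬ.comp 1 → a * b ∈ ℬ.comp h :=
    fun ha hb => by simpa using ℬ.mul_mem ha hb
  have h00 : ∀ {a : B}, a ∈ ℬ.block g 0 0 → a ∈ ℬ.comp 1 := fun ha => by
    simpa using ℬ.prodSpan_le g g⁻¹ ha
  have h11 : ∀ {a : B}, a ∈ ℬ.block g 1 1 → a ∈ ℬ.comp 1 := fun ha => by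
    simpa using ℬ.prodSpan_le g⁻¹ g ha
  have key : ∀ {s t : G} {a b : B}, a ∈ ℬ.comp 1 →
      b ∈ prodSpan (ℬ.comp s) (ℬ.comp t) → a * b ∈ prodSpan (ℬ.comp s) (ℬ.comp t) := by
    intro s t a b ha hb
    have : prodSpan (ℬ.comp s) (ℬ.comp t) ≤
        (prodSpan (ℬ.comp s) (ℬ.comp t)).comap (LinearMap.mul k B a) := by
      refine Submodule.map₂_le.2 fun m hm n hn => ?_
      have := Submodule.apply_mem_map₂ (LinearMap.mul k B) (one_left ha hm) hn
      simpa [mul_assoc] using this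
    exact this hb
  fin_cases i <;> fin_cases l <;> fin_cases j
  · exact key (h00 hx) hy
  · exact one_left (h00 hx) hy
  · exact Submodule.apply_mem_map₂ (LinearMap.mul k B) hx hy
  · exact one_right hx (h11 hy)
  · exact one_right hx (h00 hy)
  · exact Submodule.apply_mem_map₂ (LinearMap.mul k B) hx hy
  · exact one_left (h11 hx) hy
  · exact key (h11 hx) hy

/-- The linking algebra `C_g`, inside the `2 × 2` matrices over `B`. -/
def linking (ℬ : Grading k G B) (g : G) : NonUnitalSubalgebra k (Matrix (Fin 2) (Fin 2) B) where
  carrier := {X | ∀ i j, X i j ∈ ℬ.block g i j}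
  add_mem' hX hY i j := add_mem (hX i j) (hY i j)
  zero_mem' i j := zero_mem _
  smul_mem' c _ hX i j := Submodule.smul_mem _ c (hX i j)
  mul_mem' {X Y} hX hY i j := by
    rw [Matrix.mul_apply]
    exact sum_mem fun l _ => ℬ.block_mul g i l j (hX i l) (hY l j)

/-- The element of `C_g` whose `(i, j)` entry is `x`, the others being zero. -/
def single (ℬ : Grading k G B) (g : G) (i j : Fin 2) (x : ℬ.block g i j) : ℬ.linking g :=
  ⟨Matrix.of fun a b => if a = i ∧ b = j then (x : B) else 0, fun a b => by
    simp only [Matrix.of_apply]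
    split_ifs with h
    · obtain ⟨rfl, rfl⟩ := h; exact x.2
    · exact zero_mem _⟩

/-- The multipliers `e_{11}` (for `i = 0`) and `e_{22}` (for `i = 1`) of `C_g`: on the left they
keep the `i`-th row, on the right the `i`-th column. -/
def e (ℬ : Grading k G B) (g : G) (i : Fin 2) : Multiplier k (ℬ.linking g) where
  left :=
    { toFun := fun X => ⟨Matrix.of fun a b => if a = i then X.1 a b else 0, fun a b => by
        simp only [Matrix.of_apply]
        split_ifs
        · exact X.2 a b
        · exact zero_mem _⟩
      map_add' := fun X Y => by ext a b; by_cases h : a = i <;> simp [h]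
      map_smul' := fun c X => by ext a b; by_cases h : a = i <;> simp [h] }
  right :=
    { toFun := fun X => ⟨Matrix.of fun a b => if b = i then X.1 a b else 0, fun a b => by
        simp only [Matrix.of_apply]
        split_ifs
        · exact X.2 a b
        · exact zero_mem _⟩
      map_add' := fun X Y => by ext a b; by_cases h : b = i <;> simp [h]
      map_smul' := fun c X => by ext a b; by_cases h : b = i <;> simp [h] }
  left_mul X Y := by ext a b; by_cases h : a = i <;> simp [Matrix.mul_apply, h]
  right_mul X Y := by ext a b; by_cases h : b = i <;> simp [Matrix.mul_apply, h]
  right_mul_eq X Y := by ext a b; simp [Matrix.mul_apply]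

/-- The multiplier `u` of `C_g` acts as the matrix unit `e_{ij}`. -/
def ActsAsMatrixUnit (ℬ : Grading k G B) {g : G} (u : Multiplier k (ℬ.linking g))
    (i j : Fin 2) : Prop :=
  ∀ (X : ℬ.linking g) (a b : Fin 2),
    (u.left X).1 a b = (if a = i then X.1 j b else 0) ∧
    (u.right X).1 a b = (if b = j then X.1 a i else 0)

/-- Multipliers `u_g, v_g` of `C_g` with `u_g v_g = e_{11}` and `v_g u_g = e_{22}`. -/
def IsLinkingPair (ℬ : Grading k G B) (g : G) (u v : Multiplier k (ℬ.linking g)) : Prop :=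
  u * v = ℬ.e g 0 ∧ v * u = ℬ.e g 1

/-! The maps that a multiplier of `C_g` induces on `B_g` and `B_{g⁻¹}`, and their extensions. The
extension of a map is the partial linear map whose graph is spanned by the pairs prescribed on
generators. -/

/-- The partial map `B_{g⁻¹} B → B`, `x y ↦ (u x) y`. -/
noncomputable def leftExtU (ℬ : Grading k G B) {g : G} (u : Multiplier k (ℬ.linking g)) :
    B →ₗ.[k] B :=
  (Submodule.span k {p : B × B | ∃ (x : ℬ.comp g⁻¹) (y : B),
    p = ((x : B) * y, (u.left (ℬ.single g 1 0 x)).1 0 0 * y)}).toLinearPMap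

/-- The partial map `B_g B → B`, `x y ↦ (v x) y`. -/
noncomputable def leftExtV (ℬ : Grading k G B) {g : G} (v : Multiplier k (ℬ.linking g)) :
    B →ₗ.[k] B :=
  (Submodule.span k {p : B × B | ∃ (x : ℬ.comp g) (y : B),
    p = ((x : B) * y, (v.left (ℬ.single g 0 1 x)).1 1 1 * y)}).toLinearPMap

/-- The partial map `B B_{g⁻¹} → B`, `x y ↦ x (y u)`. -/
noncomputable def rightExtU (ℬ : Grading k G B) {g : G} (u : Multiplier k (ℬ.linking g)) :
    B →ₗ.[k] B :=
  (Submodule.span k {p : B × B | ∃ (x : B) (y : ℬ.comp g⁻¹),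
    p = (x * (y : B), x * (u.right (ℬ.single g 1 0 y)).1 1 1)}).toLinearPMap

/-- The partial map `B B_g → B`, `x y ↦ x (y v)`. -/
noncomputable def rightExtV (ℬ : Grading k G B) {g : G} (v : Multiplier k (ℬ.linking g)) :
    B →ₗ.[k] B :=
  (Submodule.span k {p : B × B | ∃ (x : B) (y : ℬ.comp g),
    p = (x * (y : B), x * (v.right (ℬ.single g 0 1 y)).1 0 0)}).toLinearPMap

/-- The four extensions are well defined: they take the prescribed values on generators. -/
def ExtensionsWellDefined (ℬ : Grading k G B) {g : G} (u v : Multiplier k (ℬ.linking g)) : Prop :=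
  (∀ (x : ℬ.comp g⁻¹) (y : B), ∃ h : (x : B) * y ∈ (ℬ.leftExtU u).domain,
    ℬ.leftExtU u ⟨(x : B) * y, h⟩ = (u.left (ℬ.single g 1 0 x)).1 0 0 * y) ∧
  (∀ (x : ℬ.comp g) (y : B), ∃ h : (x : B) * y ∈ (ℬ.leftExtV v).domain,
    ℬ.leftExtV v ⟨(x : B) * y, h⟩ = (v.left (ℬ.single g 0 1 x)).1 1 1 * y) ∧
  (∀ (x : B) (y : ℬ.comp g⁻¹), ∃ h : x * (y : B) ∈ (ℬ.rightExtU u).domain,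
    ℬ.rightExtU u ⟨x * (y : B), h⟩ = x * (u.right (ℬ.single g 1 0 y)).1 1 1) ∧
  (∀ (x : B) (y : ℬ.comp g), ∃ h : x * (y : B) ∈ (ℬ.rightExtV v).domain,
    ℬ.rightExtV v ⟨x * (y : B), h⟩ = x * (v.right (ℬ.single g 0 1 y)).1 0 0)

/-- The twisted partial action `Θ` on `B_1` is the one built from the multipliers `u_g, v_g`:
`D_g = B_g B_{g⁻¹}`, `θ_g(x) = u_g x v_g` and `w_{g,h} = u_g u_h v_{gh}`. -/
structure IsBuiltFrom (ℬ : Grading k G B) (u v : ∀ g, Multiplier k (ℬ.linking g))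
    (Θ : TwistedPartialAction k G ℬ.one) : Prop where
  D_eq : ∀ g (x : ℬ.one), x ∈ Θ.D g ↔ (x : B) ∈ prodSpan (ℬ.comp g) (ℬ.comp g⁻¹)
  θ_eq : ∀ g (x : Θ.D g⁻¹), ∃ hx : ((x : ℬ.one) : B) ∈ ℬ.block g 1 1,
    ((Θ.θ g x : ℬ.one) : B) = ((v g).right ((u g).left (ℬ.single g 1 1 ⟨_, hx⟩))).1 0 0
  w_left : ∀ g h (x : ↥(Θ.D g * Θ.D (g * h))),
    ∃ (h₁ : ((x : ℬ.one) : B) ∈ (ℬ.leftExtV (v (g * h))).domain)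
      (h₂ : ℬ.leftExtV (v (g * h)) ⟨_, h₁⟩ ∈ (ℬ.leftExtU (u h)).domain)
      (h₃ : ℬ.leftExtU (u h) ⟨_, h₂⟩ ∈ (ℬ.leftExtU (u g)).domain),
      (((Θ.w g h).val.left x : ℬ.one) : B) = ℬ.leftExtU (u g) ⟨_, h₃⟩
  w_right : ∀ g h (x : ↥(Θ.D g * Θ.D (g * h))),
    ∃ (h₁ : ((x : ℬ.one) : B) ∈ (ℬ.rightExtU (u g)).domain)
      (h₂ : ℬ.rightExtU (u g) ⟨_, h₁⟩ ∈ (ℬ.rightExtU (u h)).domain)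
      (h₃ : ℬ.rightExtU (u h) ⟨_, h₂⟩ ∈ (ℬ.rightExtV (v (g * h))).domain),
      (((Θ.w g h).val.right x : ℬ.one) : B) = ℬ.rightExtV (v (g * h)) ⟨_, h₃⟩

/-- An isomorphism of graded algebras from `B` onto the crossed product by `Θ`. -/
structure GradedIso (ℬ : Grading k G B) {A : Type uA} [NonUnitalRing A] [Module k A]
    [IsScalarTower k A A] [SMulCommClass k A A] (Θ : TwistedPartialAction k G A)
    extends B ≃ₗ[k] CrossedProduct Θ where
  map_mul' : ∀ x y, toFun (x * y) = toFun x * toFun y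
  map_comp : ∀ g, (ℬ.comp g).map toLinearEquiv.toLinearMap =
    LinearMap.range (CrossedProduct.δ Θ g)

end Grading

end PartialCrossed

open PartialCrossed

namespace PartialCrossed

/-! ### Calculus of products of submodules -/

local infixl:70 " ⬝ " => prodSpan

section ProdSpan

variable {k : Type uk} {B : Type uB} [CommRing k] [NonUnitalRing B] [Module k B]
  [IsScalarTower k B B] [SMulCommClass k B B] {M N P Q M' N' : Submodule k B}

theorem mul_mem_prodSpan {x y : B} (hx : x ∈ M) (hy : y ∈ N) : x * y ∈ M ⬝ N :=
  Submodule.apply_mem_map₂ (LinearMap.mul k B) hx hy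

theorem prodSpan_le_iff : M ⬝ N ≤ P ↔ ∀ x ∈ M, ∀ y ∈ N, x * y ∈ P :=
  Submodule.map₂_le

theorem prodSpan_mono (h : M ≤ M') (h' : N ≤ N') : M ⬝ N ≤ M' ⬝ N' :=
  Submodule.map₂_le_map₂ h h'

@[elab_as_elim]
theorem prodSpan_induction {C : ∀ r, r ∈ M ⬝ N → Prop} {r : B} (hr : r ∈ M ⬝ N)
    (mul : ∀ m (hm : m ∈ M) n (hn : n ∈ N), C (m * n) (mul_mem_prodSpan hm hn))
    (add : ∀ x hx y hy, C x hx → C y hy → C (x + y) (add_mem hx hy)) : C r hr := by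
  have hle : M ⬝ N ≤
      { carrier := {x | ∃ hx : x ∈ M ⬝ N, ∀ c : k, C (c • x) (Submodule.smul_mem _ c hx)}
        add_mem' := fun {x y} ⟨hx, hx'⟩ ⟨hy, hy'⟩ => ⟨add_mem hx hy, fun c => by
          simp only [smul_add]
          exact add _ _ _ _ (hx' c) (hy' c)⟩
        zero_mem' := ⟨zero_mem _, fun c => by
          simpa using mul 0 (zero_mem _) 0 (zero_mem _)⟩
        smul_mem' := fun d x ⟨hx, hx'⟩ => ⟨Submodule.smul_mem _ d hx, fun c => by
          simp only [smul_smul]; exact hx' _⟩ } :=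
    prodSpan_le_iff.2 fun x hx y hy => ⟨mul_mem_prodSpan hx hy, fun c => by
      simp only [← smul_mul_assoc]; exact mul _ (Submodule.smul_mem _ c hx) _ hy⟩
  obtain ⟨_, h⟩ := hle hr
  simpa using h 1

theorem prodSpan_assoc (M N P : Submodule k B) : M ⬝ N ⬝ P = M ⬝ (N ⬝ P) := by
  apply le_antisymm
  · refine prodSpan_le_iff.2 fun x hx z hz => ?_
    induction hx using prodSpan_induction with
    | mul m hm n hn => rw [mul_assoc]; exact mul_mem_prodSpan hm (mul_mem_prodSpan hn hz)
    | add a _ b _ ha hb => rw [add_mul]; exact add_mem ha hb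
  · refine prodSpan_le_iff.2 fun x hx z hz => ?_
    induction hz using prodSpan_induction with
    | mul m hm n hn => rw [← mul_assoc]; exact mul_mem_prodSpan (mul_mem_prodSpan hx hm) hn
    | add a _ b _ ha hb => rw [mul_add]; exact add_mem ha hb

theorem prodSpan_le_prodSpan_top : M ⬝ N ≤ M ⬝ ⊤ := prodSpan_mono le_rfl le_top

theorem prodSpan_le_top_prodSpan : M ⬝ N ≤ ⊤ ⬝ N := prodSpan_mono le_top le_rfl

/-! ### Partially defined multipliers -/

/-- The maps `l` and `r` are left and right multiplication by a partially defined multiplier: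
`l` is defined on `Q B`, `r` on `B Q`, and `l Q ⊆ P Q`, `r Q ⊆ Q P`. -/
structure PairOp (P Q : Submodule k B) (l r : B → B) : Prop where
  l_add : ∀ {x y : B}, x ∈ Q ⬝ ⊤ → y ∈ Q ⬝ ⊤ → l (x + y) = l x + l y
  l_smul : ∀ (c : k) {x : B}, x ∈ Q ⬝ ⊤ → l (c • x) = c • l x
  l_mul : ∀ {x : B} (y : B), x ∈ Q ⬝ ⊤ → l (x * y) = l x * y
  l_mem : ∀ {x : B}, x ∈ Q → l x ∈ P ⬝ Q
  r_add : ∀ {x y : B}, x ∈ ⊤ ⬝ Q → y ∈ ⊤ ⬝ Q → r (x + y) = r x + r y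
  r_smul : ∀ (c : k) {x : B}, x ∈ ⊤ ⬝ Q → r (c • x) = c • r x
  r_mul : ∀ (x : B) {y : B}, y ∈ ⊤ ⬝ Q → r (x * y) = x * r y
  r_mem : ∀ {x : B}, x ∈ Q → r x ∈ Q ⬝ P
  r_mul_eq : ∀ {x y : B}, x ∈ ⊤ ⬝ Q → y ∈ Q ⬝ ⊤ → r x * y = x * l y

namespace PairOp

variable {P Q P' Q' : Submodule k B} {l r l' r' : B → B}

/-- If `l` maps `X` into `Y` and `X M ⊆ Q B`, then `l` maps `X M` into `Y M`. -/
theorem l_mem_prodSpan (h : PairOp P Q l r) {X Y : Submodule k B} (hX : X ≤ Q ⬝ ⊤)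
    (hXY : ∀ x ∈ X, l x ∈ Y) {x : B} (hx : x ∈ X ⬝ M) : l x ∈ Y ⬝ M := by
  have hX' : X ⬝ M ≤ Q ⬝ ⊤ := (prodSpan_mono hX le_top).trans (by
    rw [prodSpan_assoc]; exact prodSpan_le_prodSpan_top)
  induction hx using prodSpan_induction with
  | mul m hm n hn => rw [h.l_mul _ (hX hm)]; exact mul_mem_prodSpan (hXY _ hm) hn
  | add a ha b hb ha' hb' => rw [h.l_add (hX' ha) (hX' hb)]; exact add_mem ha' hb'

theorem r_mem_prodSpan (h : PairOp P Q l r) {X Y : Submodule k B} (hX : X ≤ ⊤ ⬝ Q)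
    (hXY : ∀ x ∈ X, r x ∈ Y) {x : B} (hx : x ∈ M ⬝ X) : r x ∈ M ⬝ Y := by
  have hX' : M ⬝ X ≤ ⊤ ⬝ Q := (prodSpan_mono le_top hX).trans (by
    rw [← prodSpan_assoc]; exact prodSpan_le_top_prodSpan)
  induction hx using prodSpan_induction with
  | mul m hm n hn => rw [h.r_mul _ (hX hn)]; exact mul_mem_prodSpan hm (hXY _ hn)
  | add a ha b hb ha' hb' => rw [h.r_add (hX' ha) (hX' hb)]; exact add_mem ha' hb'

/-- Left and right multiplications commute on products `M N` in the domain of both. -/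
theorem comm (h : PairOp P Q l r) (h' : PairOp P' Q' l' r') (hM : M ≤ Q ⬝ ⊤) (hN : N ≤ ⊤ ⬝ Q')
    {x : B} (hx : x ∈ M ⬝ N) : l (r' x) = r' (l x) := by
  have hl : ∀ {x}, x ∈ M ⬝ N → x ∈ Q ⬝ ⊤ := fun hx => by
    have := prodSpan_mono hM le_top hx
    rw [prodSpan_assoc] at this; exact prodSpan_le_prodSpan_top this
  have hr : ∀ {x}, x ∈ M ⬝ N → x ∈ ⊤ ⬝ Q' := fun hx => by
    have := prodSpan_mono le_top hN hx
    rw [← prodSpan_assoc] at this; exact prodSpan_le_top_prodSpan this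
  have hl' : ∀ {x}, x ∈ M ⬝ N → r' x ∈ Q ⬝ ⊤ := fun {x} hx => by
    have : r' x ∈ M ⬝ ⊤ := h'.r_mem_prodSpan hN (fun _ _ => Submodule.mem_top) hx
    have := prodSpan_mono hM le_rfl this
    rw [prodSpan_assoc] at this; exact prodSpan_le_prodSpan_top this
  have hr' : ∀ {x}, x ∈ M ⬝ N → l x ∈ ⊤ ⬝ Q' := fun {x} hx => by
    have : l x ∈ ⊤ ⬝ N := h.l_mem_prodSpan hM (fun _ _ => Submodule.mem_top) hx
    have := prodSpan_mono le_rfl hN this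
    rw [← prodSpan_assoc] at this; exact prodSpan_le_top_prodSpan this
  induction hx using prodSpan_induction with
  | mul m hm n hn =>
    rw [h'.r_mul _ (hN hn), h.l_mul _ (hM hm), h.l_mul _ (hM hm), h'.r_mul _ (hN hn)]
  | add a ha b hb ha' hb' =>
    rw [h'.r_add (hr ha) (hr hb), h.l_add (hl ha) (hl hb), h.l_add (hl' ha) (hl' hb),
      h'.r_add (hr' ha) (hr' hb), ha', hb']

end PairOp

end ProdSpan

/-! ### The submodules `B_g B_{g⁻¹}` -/

namespace Grading

variable {k : Type uk} {G : Type uG} {B : Type uB} [CommRing k] [Group G] [DecidableEq G]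
  [NonUnitalRing B] [Module k B] [IsScalarTower k B B] [SMulCommClass k B B]
  {ℬ : Grading k G B}

/-- The ideal `B_g B_{g⁻¹}` of `B_1`, as a submodule of `B`. -/
abbrev dom (ℬ : Grading k G B) (g : G) : Submodule k B := ℬ.comp g ⬝ ℬ.comp g⁻¹

theorem dom_inv (g : G) : ℬ.dom g⁻¹ = ℬ.comp g⁻¹ ⬝ ℬ.comp g := by
  rw [dom, inv_inv]

theorem comp_prodSpan_comp_le {g h t : G} (e : g * h = t) : ℬ.comp g ⬝ ℬ.comp h ≤ ℬ.comp t :=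
  e ▸ ℬ.prodSpan_le g h

theorem dom_le_one (g : G) : ℬ.dom g ≤ ℬ.comp 1 := comp_prodSpan_comp_le (mul_inv_cancel g)

namespace TripleProduct

variable (H : ℬ.TripleProduct)
include H

theorem dom_comp (g : G) : ℬ.dom g ⬝ ℬ.comp g = ℬ.comp g := H g

theorem comp_dom_inv (g : G) : ℬ.comp g ⬝ ℬ.dom g⁻¹ = ℬ.comp g := by
  rw [dom_inv, ← prodSpan_assoc]; exact H g

theorem dom_dom (g : G) : ℬ.dom g ⬝ ℬ.dom g = ℬ.dom g := by
  rw [dom, ← prodSpan_assoc, H.dom_comp]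

theorem dom_comp_comm (g h : G) : ℬ.dom g ⬝ ℬ.comp h = ℬ.comp h ⬝ ℬ.dom (h⁻¹ * g) := by
  apply le_antisymm
  · rw [dom, prodSpan_assoc]
    calc ℬ.comp g ⬝ (ℬ.comp g⁻¹ ⬝ ℬ.comp h)
        ≤ ℬ.comp g ⬝ ℬ.comp (g⁻¹ * h) := prodSpan_mono le_rfl (ℬ.prodSpan_le _ _)
      _ = ℬ.comp g ⬝ ℬ.comp (g⁻¹ * h) ⬝ ℬ.dom (h⁻¹ * g) := by
        rw [prodSpan_assoc]
        have := H.comp_dom_inv (g⁻¹ * h)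
        rw [mul_inv_rev, inv_inv] at this
        rw [this]
      _ ≤ _ := prodSpan_mono (comp_prodSpan_comp_le (by group)) le_rfl
  · have e : (h⁻¹ * g)⁻¹ = g⁻¹ * h := by group
    rw [dom, e]
    calc ℬ.comp h ⬝ (ℬ.comp (h⁻¹ * g) ⬝ ℬ.comp (g⁻¹ * h))
        = ℬ.comp h ⬝ ℬ.comp (h⁻¹ * g) ⬝ ℬ.comp (g⁻¹ * h) := (prodSpan_assoc _ _ _).symm
      _ ≤ ℬ.comp g ⬝ ℬ.comp (g⁻¹ * h) :=
        prodSpan_mono (comp_prodSpan_comp_le (by group)) le_rfl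
      _ = ℬ.dom g ⬝ (ℬ.comp g ⬝ ℬ.comp (g⁻¹ * h)) := by
        rw [← prodSpan_assoc, H.dom_comp]
      _ ≤ _ := prodSpan_mono le_rfl (comp_prodSpan_comp_le (by group))

theorem comp_dom_comm (g h : G) : ℬ.comp g ⬝ ℬ.dom h = ℬ.dom (g * h) ⬝ ℬ.comp g := by
  rw [H.dom_comp_comm, inv_mul_cancel_left]

theorem dom_comm (g h : G) : ℬ.dom g ⬝ ℬ.dom h = ℬ.dom h ⬝ ℬ.dom g := by
  calc ℬ.dom g ⬝ ℬ.dom h = ℬ.dom g ⬝ ℬ.comp h ⬝ ℬ.comp h⁻¹ := (prodSpan_assoc _ _ _).symm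
    _ = ℬ.comp h ⬝ (ℬ.comp h⁻¹ ⬝ ℬ.dom g) := by
      rw [H.dom_comp_comm, prodSpan_assoc, H.comp_dom_comm]
    _ = _ := (prodSpan_assoc _ _ _).symm

theorem comp_comp_left (g h : G) : ℬ.comp g ⬝ ℬ.comp h = ℬ.dom g ⬝ ℬ.comp (g * h) := by
  apply le_antisymm
  · calc ℬ.comp g ⬝ ℬ.comp h = ℬ.dom g ⬝ (ℬ.comp g ⬝ ℬ.comp h) := by
          rw [← prodSpan_assoc, H.dom_comp]
      _ ≤ _ := prodSpan_mono le_rfl (ℬ.prodSpan_le _ _)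
  · rw [prodSpan_assoc]
    exact prodSpan_mono le_rfl (comp_prodSpan_comp_le (by group))

theorem comp_comp_right (g h : G) : ℬ.comp g ⬝ ℬ.comp h = ℬ.comp (g * h) ⬝ ℬ.dom h⁻¹ := by
  rw [H.comp_comp_left, H.dom_comp_comm]; congr 2; group

theorem comp_le_left (g : G) : ℬ.comp g ≤ ℬ.comp g ⬝ ⊤ := by
  conv_lhs => rw [← H.comp_dom_inv g]
  exact prodSpan_le_prodSpan_top

theorem comp_le_right (g : G) : ℬ.comp g ≤ ⊤ ⬝ ℬ.comp g := by
  conv_lhs => rw [← H.dom_comp g]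
  exact prodSpan_le_top_prodSpan

end TripleProduct

end Grading

namespace Grading

variable {k : Type uk} {G : Type uG} {B : Type uB} [CommRing k] [Group G] [DecidableEq G]
  [NonUnitalRing B] [Module k B] [IsScalarTower k B B] [SMulCommClass k B B]
  {ℬ : Grading k G B}

theorem dom_le_left (g : G) : ℬ.dom g ≤ ℬ.comp g ⬝ ⊤ := prodSpan_le_prodSpan_top

theorem dom_inv_le_left (g : G) : ℬ.dom g⁻¹ ≤ ℬ.comp g⁻¹ ⬝ ⊤ := prodSpan_le_prodSpan_top

theorem dom_le_right (g : G) : ℬ.dom g ≤ ⊤ ⬝ ℬ.comp g⁻¹ := prodSpan_le_top_prodSpan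

theorem dom_inv_le_right (g : G) : ℬ.dom g⁻¹ ≤ ⊤ ⬝ ℬ.comp g := by
  rw [dom_inv]; exact prodSpan_le_top_prodSpan

theorem dom_dom_le_left_fst (g h : G) : ℬ.dom g ⬝ ℬ.dom (g * h) ≤ ℬ.comp g ⬝ ⊤ := by
  rw [prodSpan_assoc]; exact prodSpan_le_prodSpan_top

theorem dom_dom_le_right (g h : G) : ℬ.dom g ⬝ ℬ.dom (g * h) ≤ ⊤ ⬝ ℬ.comp (g * h)⁻¹ := by
  rw [← prodSpan_assoc]; exact prodSpan_le_top_prodSpan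

theorem comp_dom_le_right (g h : G) : ℬ.comp g ⬝ ℬ.dom h ≤ ⊤ ⬝ ℬ.comp h⁻¹ := by
  rw [← prodSpan_assoc]; exact prodSpan_le_top_prodSpan

theorem prodSpan_le_left_of_le {M N Q : Submodule k B} (h : M ≤ Q ⬝ ⊤) : M ⬝ N ≤ Q ⬝ ⊤ :=
  (prodSpan_mono h le_top).trans (by rw [prodSpan_assoc]; exact prodSpan_le_prodSpan_top)

theorem prodSpan_le_right_of_le {M N Q : Submodule k B} (h : N ≤ ⊤ ⬝ Q) : M ⬝ N ≤ ⊤ ⬝ Q :=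
  (prodSpan_mono le_top h).trans (by rw [← prodSpan_assoc]; exact prodSpan_le_top_prodSpan)

theorem dom_prodSpan_one_le (g : G) : ℬ.dom g ⬝ ℬ.comp 1 ≤ ℬ.dom g := by
  rw [prodSpan_assoc]; exact prodSpan_mono le_rfl (comp_prodSpan_comp_le (mul_one _))

theorem one_prodSpan_dom_le (g : G) : ℬ.comp 1 ⬝ ℬ.dom g ≤ ℬ.dom g := by
  rw [← prodSpan_assoc]; exact prodSpan_mono (comp_prodSpan_comp_le (one_mul _)) le_rfl

theorem dom_dom_le_dom_left (g h : G) : ℬ.dom g ⬝ ℬ.dom h ≤ ℬ.dom g :=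
  (prodSpan_mono le_rfl (dom_le_one h)).trans (dom_prodSpan_one_le g)

theorem dom_dom_le_dom_right (g h : G) : ℬ.dom g ⬝ ℬ.dom h ≤ ℬ.dom h :=
  (prodSpan_mono (dom_le_one g) le_rfl).trans (one_prodSpan_dom_le h)

namespace TripleProduct

variable (H : ℬ.TripleProduct)
include H

theorem dom_dom_le_left (g h : G) : ℬ.dom g ⬝ ℬ.dom (g * h) ≤ ℬ.comp (g * h) ⬝ ⊤ := by
  rw [H.dom_comm, prodSpan_assoc]; exact prodSpan_le_prodSpan_top

theorem dom_dom_le_right_fst (g h : G) : ℬ.dom g ⬝ ℬ.dom (g * h) ≤ ⊤ ⬝ ℬ.comp g⁻¹ := by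
  rw [H.dom_comm, ← prodSpan_assoc]; exact prodSpan_le_top_prodSpan

theorem comp_inv_comp_inv_le (g h : G) :
    ℬ.comp h⁻¹ ⬝ ℬ.comp g⁻¹ ≤ ℬ.comp (g * h)⁻¹ ⬝ ⊤ := by
  rw [H.comp_comp_right, mul_inv_rev]; exact prodSpan_le_prodSpan_top

theorem comp_comp_le (g h : G) : ℬ.comp g ⬝ ℬ.comp h ≤ ⊤ ⬝ ℬ.comp (g * h) := by
  rw [H.comp_comp_left]; exact prodSpan_le_top_prodSpan

theorem comp_dom_le_left (g h : G) : ℬ.comp g⁻¹ ⬝ ℬ.dom (g * h) ≤ ℬ.comp h ⬝ ⊤ := by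
  rw [H.comp_dom_comm, inv_mul_cancel_left, prodSpan_assoc]
  exact prodSpan_le_prodSpan_top

theorem comp_dom_le_right_fst (g h : G) : ℬ.comp g ⬝ ℬ.dom h ≤ ⊤ ⬝ ℬ.comp g := by
  rw [H.comp_dom_comm]; exact prodSpan_le_top_prodSpan

end TripleProduct

/-! ### Families of partially defined invertible multipliers -/

/-- Families of partially defined multipliers `u_g, v_g` of `B`, given by their left and right
multiplication maps `Lu, Ru, Lv, Rv`, that are mutually inverse and trivial at `g = 1`. -/
structure UnitFamily (ℬ : Grading k G B) (Lu Ru Lv Rv : G → B → B) : Prop where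
  triple : ℬ.TripleProduct
  pu : ∀ g, PairOp (ℬ.comp g) (ℬ.comp g⁻¹) (Lu g) (Ru g)
  pv : ∀ g, PairOp (ℬ.comp g⁻¹) (ℬ.comp g) (Lv g) (Rv g)
  Lv_Lu : ∀ {g x}, x ∈ ℬ.comp g⁻¹ ⬝ ⊤ → Lv g (Lu g x) = x
  Lu_Lv : ∀ {g x}, x ∈ ℬ.comp g ⬝ ⊤ → Lu g (Lv g x) = x
  Rv_Ru : ∀ {g x}, x ∈ ⊤ ⬝ ℬ.comp g⁻¹ → Rv g (Ru g x) = x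
  Ru_Rv : ∀ {g x}, x ∈ ⊤ ⬝ ℬ.comp g → Ru g (Rv g x) = x
  Lu_one : ∀ {x}, x ∈ ℬ.comp 1 ⬝ ⊤ → Lu 1 x = x
  Ru_one : ∀ {x}, x ∈ ⊤ ⬝ ℬ.comp 1 → Ru 1 x = x

namespace UnitFamily

variable {Lu Ru Lv Rv : G → B → B} (F : ℬ.UnitFamily Lu Ru Lv Rv) {g h t : G} {x y : B}
  {M : Submodule k B}
include F

theorem Rv_one (hx : x ∈ ⊤ ⬝ ℬ.comp 1) : Rv 1 x = x := by
  have hx' : x ∈ ⊤ ⬝ ℬ.comp 1⁻¹ := by rwa [inv_one]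
  conv_lhs => rw [← F.Ru_one hx]
  exact F.Rv_Ru hx'

theorem Lu_comp (hx : x ∈ ℬ.comp g⁻¹ ⬝ M) : Lu g x ∈ ℬ.dom g ⬝ M :=
  (F.pu g).l_mem_prodSpan (F.triple.comp_le_left _) (fun _ => (F.pu g).l_mem) hx

theorem Lu_dom_inv (hx : x ∈ ℬ.dom g⁻¹) : Lu g x ∈ ℬ.comp g := by
  rw [dom_inv] at hx
  rw [← F.triple.dom_comp]; exact F.Lu_comp hx

theorem Lu_dom (hx : x ∈ ℬ.dom g⁻¹ ⬝ M) : Lu g x ∈ ℬ.comp g ⬝ M :=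
  (F.pu g).l_mem_prodSpan (dom_inv_le_left g) (fun _ => F.Lu_dom_inv) hx

theorem Lv_comp (hx : x ∈ ℬ.comp g ⬝ M) : Lv g x ∈ ℬ.dom g⁻¹ ⬝ M :=
  (F.pv g).l_mem_prodSpan (F.triple.comp_le_left _)
    (fun _ hx => by rw [dom_inv]; exact (F.pv g).l_mem hx) hx

theorem Lv_dom_of (hx : x ∈ ℬ.dom g) : Lv g x ∈ ℬ.comp g⁻¹ := by
  rw [← F.triple.dom_comp]; exact F.Lv_comp hx

theorem Lv_dom (hx : x ∈ ℬ.dom g ⬝ M) : Lv g x ∈ ℬ.comp g⁻¹ ⬝ M :=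
  (F.pv g).l_mem_prodSpan (dom_le_left g) (fun _ => F.Lv_dom_of) hx

theorem Ru_comp (hx : x ∈ M ⬝ ℬ.comp g⁻¹) : Ru g x ∈ M ⬝ ℬ.dom g⁻¹ :=
  (F.pu g).r_mem_prodSpan (F.triple.comp_le_right _)
    (fun _ hx => by rw [dom_inv]; exact (F.pu g).r_mem hx) hx

theorem Ru_dom_of (hx : x ∈ ℬ.dom g) : Ru g x ∈ ℬ.comp g := by
  rw [← F.triple.comp_dom_inv]; exact F.Ru_comp hx

theorem Ru_dom (hx : x ∈ M ⬝ ℬ.dom g) : Ru g x ∈ M ⬝ ℬ.comp g :=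
  (F.pu g).r_mem_prodSpan (dom_le_right g) (fun _ => F.Ru_dom_of) hx

theorem Rv_of (hx : x ∈ ℬ.comp g) : Rv g x ∈ ℬ.dom g := (F.pv g).r_mem hx

theorem Rv_comp (hx : x ∈ M ⬝ ℬ.comp g) : Rv g x ∈ M ⬝ ℬ.dom g :=
  (F.pv g).r_mem_prodSpan (F.triple.comp_le_right _) (fun _ => (F.pv g).r_mem) hx

theorem Rv_dom_inv (hx : x ∈ ℬ.dom g⁻¹) : Rv g x ∈ ℬ.comp g⁻¹ := by
  rw [dom_inv] at hx
  have := F.Rv_comp hx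
  rwa [← prodSpan_assoc, ← dom_inv, F.triple.dom_comp] at this

/-! #### The isomorphisms `x ↦ u_g x v_g` -/

theorem conj_comm (hx : x ∈ ℬ.dom g⁻¹) : Lu g (Rv g x) = Rv g (Lu g x) := by
  rw [← F.triple.dom_dom] at hx
  exact (F.pu g).comm (F.pv g) (dom_inv_le_left g) (dom_inv_le_right g) hx

theorem conj_inv_comm (hx : x ∈ ℬ.dom g) : Lv g (Ru g x) = Ru g (Lv g x) := by
  rw [← F.triple.dom_dom] at hx
  exact (F.pv g).comm (F.pu g) (dom_le_left g) (dom_le_right g) hx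

theorem conj_mem (hx : x ∈ ℬ.dom g⁻¹) : Rv g (Lu g x) ∈ ℬ.dom g := F.Rv_of (F.Lu_dom_inv hx)

theorem conj_inv_mem (hx : x ∈ ℬ.dom g) : Ru g (Lv g x) ∈ ℬ.dom g⁻¹ := by
  rw [dom_inv]; exact (F.pu g).r_mem (F.Lv_dom_of hx)

theorem conj_inv_conj (hx : x ∈ ℬ.dom g⁻¹) : Ru g (Lv g (Rv g (Lu g x))) = x := by
  rw [← F.conj_comm hx, F.Lv_Lu, F.Ru_Rv (dom_inv_le_right g hx)]
  exact F.triple.comp_le_left _ (F.Rv_dom_inv hx)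

theorem conj_conj_inv (hx : x ∈ ℬ.dom g) : Rv g (Lu g (Ru g (Lv g x))) = x := by
  rw [← F.conj_inv_comm hx, F.Lu_Lv, F.Rv_Ru (dom_le_right g hx)]
  exact F.triple.comp_le_left _ (F.Ru_dom_of hx)

theorem conj_mul (hx : x ∈ ℬ.dom g⁻¹) (hy : y ∈ ℬ.dom g⁻¹) :
    Rv g (Lu g (x * y)) = Rv g (Lu g x) * Rv g (Lu g y) := by
  rw [← F.conj_comm hy, (F.pv g).r_mul_eq (F.triple.comp_le_right _ (F.Lu_dom_inv hx)),
    F.Lv_Lu (F.triple.comp_le_left _ (F.Rv_dom_inv hy)), (F.pu g).l_mul _ (dom_inv_le_left g hx),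
    (F.pv g).r_mul _ (dom_inv_le_right g hy)]
  · have := F.Lu_comp (M := ⊤) (F.triple.comp_le_left _ (F.Rv_dom_inv hy))
    rw [prodSpan_assoc] at this
    exact prodSpan_le_prodSpan_top this

theorem conj_mem_prodSpan (hx : x ∈ ℬ.dom g⁻¹ ⬝ ℬ.dom h) :
    Rv g (Lu g x) ∈ ℬ.dom g ⬝ ℬ.dom (g * h) := by
  have := F.Lu_dom hx
  rw [F.triple.comp_dom_comm] at this
  rw [F.triple.dom_comm]
  exact F.Rv_comp this

theorem conj_inv_mem_prodSpan (hx : x ∈ ℬ.dom g ⬝ ℬ.dom (g * h)) :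
    Ru g (Lv g x) ∈ ℬ.dom g⁻¹ ⬝ ℬ.dom h := by
  have := F.Lv_dom hx
  rw [F.triple.comp_dom_comm, inv_mul_cancel_left] at this
  rw [F.triple.dom_comm]
  exact F.Ru_comp this

/-! #### The twist `u_g u_h v_{gh}` and its inverse -/

theorem twist_left_mem₁ (hx : x ∈ ℬ.dom g ⬝ ℬ.dom (g * h)) :
    Lv (g * h) x ∈ ℬ.comp h⁻¹ ⬝ ℬ.comp g⁻¹ := by
  rw [F.triple.dom_comm] at hx
  rw [F.triple.comp_comp_right, inv_inv, ← mul_inv_rev]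
  exact F.Lv_dom hx

theorem twist_left_mem₂ (hx : x ∈ ℬ.comp h⁻¹ ⬝ ℬ.comp g⁻¹) :
    Lu h x ∈ ℬ.comp g⁻¹ ⬝ ℬ.dom (g * h) := by
  rw [F.triple.comp_dom_comm, inv_mul_cancel_left]
  exact F.Lu_comp hx

theorem twist_left_mem₃ (hx : x ∈ ℬ.comp g⁻¹ ⬝ ℬ.dom (g * h)) :
    Lu g x ∈ ℬ.dom g ⬝ ℬ.dom (g * h) :=
  F.Lu_comp hx

theorem twist_inv_left_mem₁ (hx : x ∈ ℬ.dom g ⬝ ℬ.dom (g * h)) :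
    Lv g x ∈ ℬ.comp g⁻¹ ⬝ ℬ.dom (g * h) :=
  F.Lv_dom hx

theorem twist_inv_left_mem₂ (hx : x ∈ ℬ.comp g⁻¹ ⬝ ℬ.dom (g * h)) :
    Lv h x ∈ ℬ.comp h⁻¹ ⬝ ℬ.comp g⁻¹ := by
  rw [F.triple.comp_dom_comm, inv_mul_cancel_left] at hx
  exact F.Lv_dom hx

theorem twist_inv_left_mem₃ (hx : x ∈ ℬ.comp h⁻¹ ⬝ ℬ.comp g⁻¹) :
    Lu (g * h) x ∈ ℬ.dom g ⬝ ℬ.dom (g * h) := by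
  rw [F.triple.comp_comp_right, inv_inv, ← mul_inv_rev] at hx
  rw [F.triple.dom_comm]
  exact F.Lu_comp hx

theorem twist_right_mem₁ (hx : x ∈ ℬ.dom g ⬝ ℬ.dom (g * h)) :
    Ru g x ∈ ℬ.comp g ⬝ ℬ.dom h := by
  rw [F.triple.dom_comm] at hx
  rw [F.triple.comp_dom_comm]
  exact F.Ru_dom hx

theorem twist_right_mem₂ (hx : x ∈ ℬ.comp g ⬝ ℬ.dom h) : Ru h x ∈ ℬ.comp g ⬝ ℬ.comp h :=
  F.Ru_dom hx

theorem twist_right_mem₃ (hx : x ∈ ℬ.comp g ⬝ ℬ.comp h) :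
    Rv (g * h) x ∈ ℬ.dom g ⬝ ℬ.dom (g * h) := by
  rw [F.triple.comp_comp_left] at hx
  exact F.Rv_comp hx

theorem twist_inv_right_mem₁ (hx : x ∈ ℬ.dom g ⬝ ℬ.dom (g * h)) :
    Ru (g * h) x ∈ ℬ.comp g ⬝ ℬ.comp h := by
  rw [F.triple.comp_comp_left]
  exact F.Ru_dom hx

theorem twist_inv_right_mem₂ (hx : x ∈ ℬ.comp g ⬝ ℬ.comp h) : Rv h x ∈ ℬ.comp g ⬝ ℬ.dom h :=
  F.Rv_comp hx

theorem twist_inv_right_mem₃ (hx : x ∈ ℬ.comp g ⬝ ℬ.dom h) :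
    Rv g x ∈ ℬ.dom g ⬝ ℬ.dom (g * h) := by
  rw [F.triple.comp_dom_comm] at hx
  rw [F.triple.dom_comm]
  exact F.Rv_comp hx

theorem twist_left_mem (hx : x ∈ ℬ.dom g ⬝ ℬ.dom (g * h)) :
    Lu g (Lu h (Lv (g * h) x)) ∈ ℬ.dom g ⬝ ℬ.dom (g * h) :=
  F.twist_left_mem₃ (F.twist_left_mem₂ (F.twist_left_mem₁ hx))

theorem twist_right_mem (hx : x ∈ ℬ.dom g ⬝ ℬ.dom (g * h)) :
    Rv (g * h) (Ru h (Ru g x)) ∈ ℬ.dom g ⬝ ℬ.dom (g * h) :=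
  F.twist_right_mem₃ (F.twist_right_mem₂ (F.twist_right_mem₁ hx))

theorem twist_inv_left_mem (hx : x ∈ ℬ.dom g ⬝ ℬ.dom (g * h)) :
    Lu (g * h) (Lv h (Lv g x)) ∈ ℬ.dom g ⬝ ℬ.dom (g * h) :=
  F.twist_inv_left_mem₃ (F.twist_inv_left_mem₂ (F.twist_inv_left_mem₁ hx))

theorem twist_inv_right_mem (hx : x ∈ ℬ.dom g ⬝ ℬ.dom (g * h)) :
    Rv g (Rv h (Ru (g * h) x)) ∈ ℬ.dom g ⬝ ℬ.dom (g * h) :=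
  F.twist_inv_right_mem₃ (F.twist_inv_right_mem₂ (F.twist_inv_right_mem₁ hx))

theorem twist_left_inv (hx : x ∈ ℬ.dom g ⬝ ℬ.dom (g * h)) :
    Lu g (Lu h (Lv (g * h) (Lu (g * h) (Lv h (Lv g x))))) = x := by
  have h₁ := F.twist_inv_left_mem₁ hx
  have h₂ := F.twist_inv_left_mem₂ h₁
  rw [F.Lv_Lu (F.triple.comp_inv_comp_inv_le _ _ h₂), F.Lu_Lv (F.triple.comp_dom_le_left _ _ h₁),
    F.Lu_Lv (dom_dom_le_left_fst _ _ hx)]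

theorem twist_inv_left (hx : x ∈ ℬ.dom g ⬝ ℬ.dom (g * h)) :
    Lu (g * h) (Lv h (Lv g (Lu g (Lu h (Lv (g * h) x))))) = x := by
  have h₁ := F.twist_left_mem₁ hx
  have h₂ := F.twist_left_mem₂ h₁
  rw [F.Lv_Lu (prodSpan_le_prodSpan_top h₂), F.Lv_Lu (prodSpan_le_prodSpan_top h₁),
    F.Lu_Lv (F.triple.dom_dom_le_left _ _ hx)]

theorem twist_right_inv (hx : x ∈ ℬ.dom g ⬝ ℬ.dom (g * h)) :
    Rv (g * h) (Ru h (Ru g (Rv g (Rv h (Ru (g * h) x))))) = x := by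
  have h₁ := F.twist_inv_right_mem₁ hx
  have h₂ := F.twist_inv_right_mem₂ h₁
  rw [F.Ru_Rv (F.triple.comp_dom_le_right_fst _ _ h₂), F.Ru_Rv (prodSpan_le_top_prodSpan h₁),
    F.Rv_Ru (dom_dom_le_right _ _ hx)]

theorem twist_inv_right (hx : x ∈ ℬ.dom g ⬝ ℬ.dom (g * h)) :
    Rv g (Rv h (Ru (g * h) (Rv (g * h) (Ru h (Ru g x))))) = x := by
  have h₁ := F.twist_right_mem₁ hx
  have h₂ := F.twist_right_mem₂ h₁
  rw [F.Ru_Rv (F.triple.comp_comp_le _ _ h₂), F.Rv_Ru (comp_dom_le_right _ _ h₁),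
    F.Rv_Ru (F.triple.dom_dom_le_right_fst _ _ hx)]

theorem twist_mul_eq (hx : x ∈ ℬ.dom g ⬝ ℬ.dom (g * h)) (hy : y ∈ ℬ.dom g ⬝ ℬ.dom (g * h)) :
    Rv (g * h) (Ru h (Ru g x)) * y = x * Lu g (Lu h (Lv (g * h) y)) := by
  have h₁ := F.twist_right_mem₁ hx
  have h₂ := F.twist_right_mem₂ h₁
  have h₃ := F.twist_left_mem₁ hy
  have h₄ := F.twist_left_mem₂ h₃
  rw [(F.pv _).r_mul_eq (F.triple.comp_comp_le _ _ h₂) (F.triple.dom_dom_le_left _ _ hy),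
    (F.pu _).r_mul_eq (comp_dom_le_right _ _ h₁) (prodSpan_le_prodSpan_top h₃),
    (F.pu _).r_mul_eq (F.triple.dom_dom_le_right_fst _ _ hx) (prodSpan_le_prodSpan_top h₄)]

theorem twist_inv_mul_eq (hx : x ∈ ℬ.dom g ⬝ ℬ.dom (g * h))
    (hy : y ∈ ℬ.dom g ⬝ ℬ.dom (g * h)) :
    Rv g (Rv h (Ru (g * h) x)) * y = x * Lu (g * h) (Lv h (Lv g y)) := by
  have h₁ := F.twist_inv_right_mem₁ hx
  have h₂ := F.twist_inv_right_mem₂ h₁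
  have h₃ := F.twist_inv_left_mem₁ hy
  have h₄ := F.twist_inv_left_mem₂ h₃
  rw [(F.pv _).r_mul_eq (F.triple.comp_dom_le_right_fst _ _ h₂) (dom_dom_le_left_fst _ _ hy),
    (F.pv _).r_mul_eq (prodSpan_le_top_prodSpan h₁) (F.triple.comp_dom_le_left _ _ h₃),
    (F.pu _).r_mul_eq (dom_dom_le_right _ _ hx) (F.triple.comp_inv_comp_inv_le _ _ h₄)]

theorem twist_left_mul (hx : x ∈ ℬ.dom g ⬝ ℬ.dom (g * h)) (y : B) :
    Lu g (Lu h (Lv (g * h) (x * y))) = Lu g (Lu h (Lv (g * h) x)) * y := by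
  have h₁ := F.twist_left_mem₁ hx
  have h₂ := F.twist_left_mem₂ h₁
  rw [(F.pv _).l_mul _ (F.triple.dom_dom_le_left _ _ hx), (F.pu _).l_mul _ (prodSpan_le_prodSpan_top h₁),
    (F.pu _).l_mul _ (prodSpan_le_prodSpan_top h₂)]

theorem twist_left_add (hx : x ∈ ℬ.dom g ⬝ ℬ.dom (g * h)) (hy : y ∈ ℬ.dom g ⬝ ℬ.dom (g * h)) :
    Lu g (Lu h (Lv (g * h) (x + y))) =
      Lu g (Lu h (Lv (g * h) x)) + Lu g (Lu h (Lv (g * h) y)) := by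
  have h₁ := F.twist_left_mem₁ hx
  have h₂ := F.twist_left_mem₂ h₁
  have h₃ := F.twist_left_mem₁ hy
  have h₄ := F.twist_left_mem₂ h₃
  rw [(F.pv _).l_add (F.triple.dom_dom_le_left _ _ hx) (F.triple.dom_dom_le_left _ _ hy),
    (F.pu _).l_add (prodSpan_le_prodSpan_top h₁) (prodSpan_le_prodSpan_top h₃),
    (F.pu _).l_add (prodSpan_le_prodSpan_top h₂) (prodSpan_le_prodSpan_top h₄)]

theorem twist_left_smul (c : k) (hx : x ∈ ℬ.dom g ⬝ ℬ.dom (g * h)) :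
    Lu g (Lu h (Lv (g * h) (c • x))) = c • Lu g (Lu h (Lv (g * h) x)) := by
  have h₁ := F.twist_left_mem₁ hx
  have h₂ := F.twist_left_mem₂ h₁
  rw [(F.pv _).l_smul _ (F.triple.dom_dom_le_left _ _ hx),
    (F.pu _).l_smul _ (prodSpan_le_prodSpan_top h₁),
    (F.pu _).l_smul _ (prodSpan_le_prodSpan_top h₂)]

theorem twist_right_mul (x : B) (hy : y ∈ ℬ.dom g ⬝ ℬ.dom (g * h)) :
    Rv (g * h) (Ru h (Ru g (x * y))) = x * Rv (g * h) (Ru h (Ru g y)) := by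
  have h₁ := F.twist_right_mem₁ hy
  have h₂ := F.twist_right_mem₂ h₁
  rw [(F.pu _).r_mul _ (F.triple.dom_dom_le_right_fst _ _ hy),
    (F.pu _).r_mul _ (comp_dom_le_right _ _ h₁), (F.pv _).r_mul _ (F.triple.comp_comp_le _ _ h₂)]

theorem twist_right_add (hx : x ∈ ℬ.dom g ⬝ ℬ.dom (g * h)) (hy : y ∈ ℬ.dom g ⬝ ℬ.dom (g * h)) :
    Rv (g * h) (Ru h (Ru g (x + y))) =
      Rv (g * h) (Ru h (Ru g x)) + Rv (g * h) (Ru h (Ru g y)) := by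
  have h₁ := F.twist_right_mem₁ hx
  have h₂ := F.twist_right_mem₂ h₁
  have h₃ := F.twist_right_mem₁ hy
  have h₄ := F.twist_right_mem₂ h₃
  rw [(F.pu _).r_add (F.triple.dom_dom_le_right_fst _ _ hx) (F.triple.dom_dom_le_right_fst _ _ hy),
    (F.pu _).r_add (comp_dom_le_right _ _ h₁) (comp_dom_le_right _ _ h₃),
    (F.pv _).r_add (F.triple.comp_comp_le _ _ h₂) (F.triple.comp_comp_le _ _ h₄)]

theorem twist_right_smul (c : k) (hx : x ∈ ℬ.dom g ⬝ ℬ.dom (g * h)) :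
    Rv (g * h) (Ru h (Ru g (c • x))) = c • Rv (g * h) (Ru h (Ru g x)) := by
  have h₁ := F.twist_right_mem₁ hx
  have h₂ := F.twist_right_mem₂ h₁
  rw [(F.pu _).r_smul _ (F.triple.dom_dom_le_right_fst _ _ hx),
    (F.pu _).r_smul _ (comp_dom_le_right _ _ h₁), (F.pv _).r_smul _ (F.triple.comp_comp_le _ _ h₂)]

/-! #### The identities of a twisted partial action -/

theorem conj_conj (hx : x ∈ ℬ.dom h⁻¹ ⬝ ℬ.dom (h⁻¹ * g⁻¹)) :
    Rv g (Lu g (Rv h (Lu h x))) =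
      Rv g (Rv h (Ru (g * h) (Lu g (Lu h (Lv (g * h) (Rv (g * h) (Lu (g * h) x))))))) := by
  rw [← mul_inv_rev] at hx
  have hx₁ : x ∈ ℬ.dom (g * h)⁻¹ := dom_dom_le_dom_right _ _ hx
  have e : ℬ.comp h ⬝ ℬ.dom (g * h)⁻¹ = ℬ.dom g⁻¹ ⬝ ℬ.comp h := by
    rw [F.triple.comp_dom_comm]; congr 2; group
  have h₁ : Lu h x ∈ ℬ.dom g⁻¹ ⬝ ℬ.comp h := e ▸ F.Lu_dom hx
  have h₂ : Lu h x ∈ ℬ.dom g⁻¹ ⬝ (ℬ.comp h ⬝ ℬ.dom (g * h)⁻¹) := by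
    rw [← prodSpan_assoc, ← e, prodSpan_assoc, F.triple.dom_dom]; exact F.Lu_dom hx
  have h₃ : ℬ.comp h ⬝ ℬ.dom (g * h)⁻¹ ≤ ⊤ ⬝ ℬ.comp (g * h) :=
    prodSpan_le_right_of_le (dom_inv_le_right _)
  rw [← F.conj_comm hx₁, F.Lv_Lu (F.triple.comp_le_left _ (F.Rv_dom_inv hx₁)),
    (F.pu h).comm (F.pv (g * h)) (dom_inv_le_left h) (dom_inv_le_right _) hx,
    (F.pu g).comm (F.pv (g * h)) (dom_inv_le_left g) h₃ h₂,
    F.Ru_Rv (prodSpan_le_right_of_le h₃ (F.Lu_dom h₂)),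
    (F.pu g).comm (F.pv h) (dom_inv_le_left g) (F.triple.comp_le_right h) h₁]

theorem twist_cocycle (hx : x ∈ ℬ.dom g⁻¹ ⬝ ℬ.dom h ⬝ ℬ.dom (h * t)) :
    Rv (g * (h * t)) (Ru (h * t) (Ru g (Rv g (Lu g (Rv (h * t) (Ru t (Ru h x))))))) =
      Rv (g * h * t) (Ru t (Ru (g * h) (Rv (g * h) (Ru h (Ru g (Rv g (Lu g x))))))) := by
  rw [prodSpan_assoc] at hx
  have h₁ : Ru h x ∈ ℬ.dom g⁻¹ ⬝ (ℬ.comp h ⬝ ℬ.dom t) :=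
    (F.pu h).r_mem_prodSpan (F.triple.dom_dom_le_right_fst _ _) (fun _ => F.twist_right_mem₁) hx
  have h₂ : Ru t (Ru h x) ∈ ℬ.dom g⁻¹ ⬝ (ℬ.comp h ⬝ ℬ.comp t) :=
    (F.pu t).r_mem_prodSpan (comp_dom_le_right _ _) (fun _ => F.twist_right_mem₂) h₁
  have h₃ : Rv (h * t) (Ru t (Ru h x)) ∈ ℬ.dom g⁻¹ ⬝ (ℬ.dom h ⬝ ℬ.dom (h * t)) :=
    (F.pv _).r_mem_prodSpan (F.triple.comp_comp_le _ _) (fun _ => F.twist_right_mem₃) h₂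
  have h₄ : ∀ {y}, y ∈ ℬ.dom g⁻¹ ⬝ (ℬ.dom h ⬝ ℬ.dom (h * t)) → Lu g y ∈ ⊤ ⬝ ℬ.comp g := by
    intro y hy
    have := F.Lu_dom hy
    rw [← prodSpan_assoc, F.triple.comp_dom_comm, prodSpan_assoc, F.triple.comp_dom_comm] at this
    exact prodSpan_le_right_of_le prodSpan_le_top_prodSpan this
  have h₅ : Lu g (Ru h x) ∈ ⊤ ⬝ ℬ.comp (g * h) := by
    have := F.Lu_dom h₁
    rw [F.triple.comp_dom_comm h t, ← prodSpan_assoc, F.triple.comp_dom_comm, prodSpan_assoc]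
      at this
    exact prodSpan_le_right_of_le (F.triple.comp_comp_le _ _) this
  rw [F.Ru_Rv (h₄ h₃), F.Ru_Rv (h₄ hx),
    (F.pu g).comm (F.pv (h * t)) (dom_inv_le_left g) (F.triple.comp_comp_le _ _) h₂,
    F.Ru_Rv (prodSpan_le_right_of_le (F.triple.comp_comp_le _ _) (F.Lu_dom h₂)),
    ← (F.pu g).comm (F.pu h) (dom_inv_le_left g) (F.triple.dom_dom_le_right_fst _ _) hx,
    F.Ru_Rv h₅, ← (F.pu g).comm (F.pu t) (dom_inv_le_left g) (comp_dom_le_right _ _) h₁, mul_assoc]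

/-- The identity behind the multiplicativity of `∑ a_g ↦ ∑ a_g v_g δ_g`. -/
theorem coeff_mul (hx : x ∈ ℬ.comp g) (hy : y ∈ ℬ.comp h) :
    Rv (g * h) (Ru h (Ru g (Rv g (Lu g (Ru g (Lv g (Rv g x)) * Rv h y))))) =
      Rv (g * h) (x * y) := by
  have hx' := F.triple.comp_le_right _ hx
  have hy' := F.triple.comp_le_right _ hy
  have h₁ : Lv g x ∈ ℬ.comp g⁻¹ ⬝ ⊤ := by
    have := F.Lv_comp (F.triple.comp_le_left _ hx)
    exact prodSpan_le_left_of_le (dom_inv_le_left g) this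
  rw [← F.conj_inv_comm (F.Rv_of hx), F.Ru_Rv hx', (F.pu g).l_mul _ h₁,
    F.Lu_Lv (F.triple.comp_le_left _ hx),
    F.Ru_Rv (F.triple.comp_dom_le_right_fst _ h (mul_mem_prodSpan hx (F.Rv_of hy))),
    (F.pu h).r_mul _ (dom_le_right _ (F.Rv_of hy)), F.Ru_Rv hy']

theorem twist_one_left (hx : x ∈ ℬ.dom 1 ⬝ ℬ.dom (1 * g)) :
    Lu 1 (Lu g (Lv (1 * g) x)) = x ∧ Rv (1 * g) (Ru g (Ru 1 x)) = x := by
  rw [one_mul] at hx ⊢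
  have h₁ := dom_dom_le_dom_right _ _ hx
  have h₂ := dom_le_one _ h₁
  rw [F.Lu_Lv (dom_le_left _ h₁), F.Lu_one (F.triple.comp_le_left _ h₂),
    F.Ru_one (F.triple.comp_le_right _ h₂), F.Rv_Ru (dom_le_right _ h₁)]
  exact ⟨rfl, rfl⟩

theorem twist_one_right (hx : x ∈ ℬ.dom g ⬝ ℬ.dom (g * 1)) :
    Lu g (Lu 1 (Lv (g * 1) x)) = x ∧ Rv (g * 1) (Ru 1 (Ru g x)) = x := by
  have h₁ := dom_dom_le_dom_left _ _ hx
  have h₂ := F.twist_left_mem₁ hx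
  have h₃ := comp_dom_le_right _ _ (F.twist_right_mem₁ hx)
  rw [inv_one] at h₂ h₃
  rw [mul_one] at h₂ ⊢
  rw [F.Lu_one (prodSpan_le_prodSpan_top h₂), F.Lu_Lv (dom_le_left _ h₁), F.Ru_one h₃,
    F.Rv_Ru (dom_le_right _ h₁)]
  exact ⟨rfl, rfl⟩

end UnitFamily

end Grading

namespace CrossedProduct

variable {k : Type uk} {G : Type uG} {A : Type uA} [CommRing k] [Group G] [DecidableEq G]
  [NonUnitalRing A] [Module k A] [IsScalarTower k A A] [SMulCommClass k A A]
  {Θ : TwistedPartialAction k G A}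

theorem zero_mul' (x : CrossedProduct Θ) : 0 * x = 0 := LinearMap.map_zero₂ (mulHom Θ) x

theorem mul_zero' (x : CrossedProduct Θ) : x * 0 = 0 := map_zero (mulHom Θ x)

theorem add_mul' (x y z : CrossedProduct Θ) : (x + y) * z = x * z + y * z :=
  LinearMap.map_add₂ (mulHom Θ) x y z

theorem mul_add' (x y z : CrossedProduct Θ) : x * (y + z) = x * y + x * z :=
  map_add (mulHom Θ x) y z

end CrossedProduct

namespace Grading

section Decomposition

variable {k : Type uk} {G : Type uG} {B : Type uB} [CommRing k] [Group G] [DecidableEq G]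
  [NonUnitalRing B] [Module k B]

/-- The decomposition `⨁_g B_g ≃ B`. -/
noncomputable def decomp (ℬ : Grading k G B) : (DirectSum G fun g => ℬ.comp g) ≃ₗ[k] B :=
  LinearEquiv.ofBijective (DirectSum.coeLinearMap ℬ.comp) ℬ.isInternal

theorem decomp_lof {ℬ : Grading k G B} {g : G} (a : ℬ.comp g) :
    ℬ.decomp (DirectSum.lof k G (fun g => ℬ.comp g) g a) = a :=
  DirectSum.coeLinearMap_lof _ _ _

@[elab_as_elim]
theorem induction (ℬ : Grading k G B) {C : B → Prop} (x : B)
    (mem : ∀ g, ∀ a ∈ ℬ.comp g, C a) (zero : C 0) (add : ∀ a b, C a → C b → C (a + b)) : C x := by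
  have hx : x ∈ ⨆ g, ℬ.comp g := by
    rw [ℬ.isInternal.submodule_iSup_eq_top]; exact Submodule.mem_top
  exact Submodule.iSup_induction _ (motive := C) hx mem zero add

end Decomposition

variable {k : Type uk} {G : Type uG} {B : Type uB} [CommRing k] [Group G] [DecidableEq G]
  [NonUnitalRing B] [Module k B] [IsScalarTower k B B] [SMulCommClass k B B]
  {ℬ : Grading k G B}

/-! ### The twisted partial action and the crossed product -/

theorem mem_ideal_mul_iff {I J : AlgIdeal k ℬ.one} {M N : Submodule k B}
    (hI : ∀ x : ℬ.one, x ∈ I ↔ (x : B) ∈ M) (hJ : ∀ x : ℬ.one, x ∈ J ↔ (x : B) ∈ N)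
    (hM : M ≤ ℬ.comp 1) (hN : N ≤ ℬ.comp 1) (x : ℬ.one) : x ∈ I * J ↔ (x : B) ∈ M ⬝ N := by
  constructor
  · intro hx
    refine AlgIdeal.mul_le (N := (M ⬝ N).comap (NonUnitalSubalgebraClass.subtype ℬ.one :
      ℬ.one →ₗ[k] B)) (fun a ha b hb => ?_) x hx
    exact mul_mem_prodSpan ((hI a).1 ha) ((hJ b).1 hb)
  · obtain ⟨x, hx1⟩ := x
    intro hx
    change x ∈ M ⬝ N at hx
    induction hx using prodSpan_induction with
    | mul m hm n hn =>
      exact AlgIdeal.mul_mem_mul (x := (⟨m, hM hm⟩ : ℬ.one)) (y := ⟨n, hN hn⟩)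
        ((hI _).2 hm) ((hJ _).2 hn)
    | add a ha b hb ha' hb' =>
      have h1 : M ⬝ N ≤ ℬ.comp 1 :=
        (prodSpan_mono hM hN).trans (comp_prodSpan_comp_le (mul_one 1))
      exact add_mem (ha' (h1 ha)) (hb' (h1 hb))

/-- The ideal `D_g = B_g B_{g⁻¹}` of `B_1`. -/
def domIdeal (ℬ : Grading k G B) (g : G) : AlgIdeal k ℬ.one where
  carrier := {x | (x : B) ∈ ℬ.dom g}
  add_mem' hx hy := (ℬ.dom g).add_mem hx hy
  zero_mem' := zero_mem (ℬ.dom g)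
  smul_mem' c _ hx := Submodule.smul_mem (ℬ.dom g) c hx
  mul_mem_left' a _ hx := one_prodSpan_dom_le g (mul_mem_prodSpan a.2 hx)
  mul_mem_right' a hx := dom_prodSpan_one_le g (mul_mem_prodSpan hx a.2)

theorem mem_domIdeal {g : G} {x : ℬ.one} : x ∈ ℬ.domIdeal g ↔ (x : B) ∈ ℬ.dom g := Iff.rfl

theorem mem_domIdeal_mul {g h : G} {x : ℬ.one} :
    x ∈ ℬ.domIdeal g * ℬ.domIdeal h ↔ (x : B) ∈ ℬ.dom g ⬝ ℬ.dom h :=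
  mem_ideal_mul_iff (fun _ => Iff.rfl) (fun _ => Iff.rfl) (dom_le_one g) (dom_le_one h) x

theorem mem_domIdeal_mul_mul {g h t : G} {x : ℬ.one} :
    x ∈ ℬ.domIdeal g * ℬ.domIdeal h * ℬ.domIdeal t ↔
      (x : B) ∈ ℬ.dom g ⬝ ℬ.dom h ⬝ ℬ.dom t :=
  mem_ideal_mul_iff (fun _ => mem_domIdeal_mul) (fun _ => Iff.rfl)
    ((dom_dom_le_dom_left g h).trans (dom_le_one g)) (dom_le_one t) x

theorem TripleProduct.one_one (H : ℬ.TripleProduct) : ℬ.comp 1 ⬝ ℬ.comp 1 = ℬ.comp 1 := by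
  apply le_antisymm (comp_prodSpan_comp_le (mul_one 1))
  conv_lhs => rw [← H.dom_comp 1]
  exact prodSpan_mono (dom_le_one 1) le_rfl

namespace UnitFamily

variable {Lu Ru Lv Rv : G → B → B} (F : ℬ.UnitFamily Lu Ru Lv Rv)

/-- The map `D_{g⁻¹} → D_g`, `x ↦ u_g x v_g`. -/
def conj (g : G) : ℬ.domIdeal g⁻¹ ≃ₗ[k] ℬ.domIdeal g where
  toFun x := ⟨⟨Rv g (Lu g (x : ℬ.one)), dom_le_one g (F.conj_mem x.2)⟩, F.conj_mem x.2⟩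
  map_add' x y := by
    apply Subtype.ext; apply Subtype.ext
    change Rv g (Lu g (((x : ℬ.one) : B) + ((y : ℬ.one) : B))) = Rv g (Lu g _) + Rv g (Lu g _)
    have hx := F.triple.comp_le_right _ (F.Lu_dom_inv x.2)
    have hy := F.triple.comp_le_right _ (F.Lu_dom_inv y.2)
    rw [(F.pu g).l_add (dom_inv_le_left g x.2) (dom_inv_le_left g y.2), (F.pv g).r_add hx hy]
  map_smul' c x := by
    apply Subtype.ext; apply Subtype.ext
    change Rv g (Lu g (c • ((x : ℬ.one) : B))) = c • Rv g (Lu g _)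
    have hx := F.triple.comp_le_right _ (F.Lu_dom_inv x.2)
    rw [(F.pu g).l_smul _ (dom_inv_le_left g x.2), (F.pv g).r_smul _ hx]
  invFun x := ⟨⟨Ru g (Lv g (x : ℬ.one)), dom_le_one _ (F.conj_inv_mem x.2)⟩, F.conj_inv_mem x.2⟩
  left_inv x := Subtype.ext (Subtype.ext (F.conj_inv_conj x.2))
  right_inv x := Subtype.ext (Subtype.ext (F.conj_conj_inv x.2))

/-- The ideals `D_g` and isomorphisms `x ↦ u_g x v_g`. -/
def partialSystem : PartialSystem k G ℬ.one where
  D := ℬ.domIdeal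
  θ := F.conj
  θ_mul _ x y := Subtype.ext (Subtype.ext (F.conj_mul x.2 y.2))
  D_idem g := SetLike.ext fun x => by
    rw [mem_domIdeal_mul, F.triple.dom_dom, mem_domIdeal]
  D_comm g h := SetLike.ext fun x => by
    rw [mem_domIdeal_mul, mem_domIdeal_mul, F.triple.dom_comm]
  D_one := SetLike.ext fun x => by
    rw [mem_domIdeal, dom, inv_one, F.triple.one_one]
    exact ⟨fun _ => trivial, fun _ => x.2⟩
  θ_one x := by
    apply Subtype.ext
    have hx : ((x : ℬ.one) : B) ∈ ℬ.comp 1 := (x : ℬ.one).2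
    change Rv 1 (Lu 1 _) = _
    rw [F.Lu_one (F.triple.comp_le_left _ hx), F.Rv_one (F.triple.comp_le_right _ hx)]
  θ_image g h := by
    ext x
    constructor
    · rintro ⟨y, hy, rfl⟩
      exact mem_domIdeal_mul.2 (F.conj_mem_prodSpan (mem_domIdeal_mul.1 hy))
    · intro hx
      have hx' := mem_domIdeal_mul.1 hx
      refine ⟨(F.conj g).symm ⟨x, dom_dom_le_dom_left _ _ hx'⟩,
        mem_domIdeal_mul.2 (F.conj_inv_mem_prodSpan hx'), ?_⟩
      exact congrArg Subtype.val ((F.conj g).apply_symm_apply _)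

theorem mem_prodSpan_of_mem {g h : G} (x : ↥(ℬ.domIdeal g * ℬ.domIdeal h)) :
    ((x : ℬ.one) : B) ∈ ℬ.dom g ⬝ ℬ.dom h :=
  mem_domIdeal_mul.1 x.2

theorem dom_dom_le_one (g h : G) : ℬ.dom g ⬝ ℬ.dom h ≤ ℬ.comp 1 :=
  (dom_dom_le_dom_left g h).trans (dom_le_one g)

/-- An element of `D_g D_h`, from an element of `B`. -/
def mkMul {g h : G} (x : B) (hx : x ∈ ℬ.dom g ⬝ ℬ.dom h) : ↥(ℬ.domIdeal g * ℬ.domIdeal h) :=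
  ⟨⟨x, dom_dom_le_one g h hx⟩, mem_domIdeal_mul.2 hx⟩

/-- The multiplier `w_{g,h} = u_g u_h v_{gh}` of `D_g D_{gh}`. -/
def twistMul (g h : G) : Multiplier k ↥(ℬ.domIdeal g * ℬ.domIdeal (g * h)) where
  left :=
    { toFun := fun x => mkMul _ (F.twist_left_mem (mem_prodSpan_of_mem x))
      map_add' := fun x y => Subtype.ext (Subtype.ext
        (F.twist_left_add (mem_prodSpan_of_mem x) (mem_prodSpan_of_mem y)))
      map_smul' := fun c x => Subtype.ext (Subtype.ext
        (F.twist_left_smul c (mem_prodSpan_of_mem x))) }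
  right :=
    { toFun := fun x => mkMul _ (F.twist_right_mem (mem_prodSpan_of_mem x))
      map_add' := fun x y => Subtype.ext (Subtype.ext
        (F.twist_right_add (mem_prodSpan_of_mem x) (mem_prodSpan_of_mem y)))
      map_smul' := fun c x => Subtype.ext (Subtype.ext
        (F.twist_right_smul c (mem_prodSpan_of_mem x))) }
  left_mul x _ := Subtype.ext (Subtype.ext (F.twist_left_mul (mem_prodSpan_of_mem x) _))
  right_mul _ y := Subtype.ext (Subtype.ext (F.twist_right_mul _ (mem_prodSpan_of_mem y)))
  right_mul_eq x y := Subtype.ext (Subtype.ext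
    (F.twist_mul_eq (mem_prodSpan_of_mem x) (mem_prodSpan_of_mem y)))

/-- The inverse `u_{gh} v_h v_g` of `w_{g,h}`. -/
def twistInv (g h : G) : Multiplier k ↥(ℬ.domIdeal g * ℬ.domIdeal (g * h)) :=
  let el : ↥(ℬ.domIdeal g * ℬ.domIdeal (g * h)) ≃ₗ[k] ↥(ℬ.domIdeal g * ℬ.domIdeal (g * h)) :=
    { (F.twistMul g h).left with
      invFun := fun x => mkMul _ (F.twist_inv_left_mem (mem_prodSpan_of_mem x))
      left_inv := fun x => Subtype.ext (Subtype.ext (F.twist_inv_left (mem_prodSpan_of_mem x)))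
      right_inv := fun x => Subtype.ext (Subtype.ext
        (F.twist_left_inv (mem_prodSpan_of_mem x))) }
  let er : ↥(ℬ.domIdeal g * ℬ.domIdeal (g * h)) ≃ₗ[k] ↥(ℬ.domIdeal g * ℬ.domIdeal (g * h)) :=
    { (F.twistMul g h).right with
      invFun := fun x => mkMul _ (F.twist_inv_right_mem (mem_prodSpan_of_mem x))
      left_inv := fun x => Subtype.ext (Subtype.ext (F.twist_inv_right (mem_prodSpan_of_mem x)))
      right_inv := fun x => Subtype.ext (Subtype.ext
        (F.twist_right_inv (mem_prodSpan_of_mem x))) }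
  { left := el.symm
    right := er.symm
    left_mul := fun x y => by
      refine el.symm_apply_eq.2 ?_
      change _ = (F.twistMul g h).left (el.symm x * y)
      rw [Multiplier.left_mul]
      exact congrArg (· * y) (el.apply_symm_apply x).symm
    right_mul := fun x y => by
      refine er.symm_apply_eq.2 ?_
      change _ = (F.twistMul g h).right (x * er.symm y)
      rw [Multiplier.right_mul]
      exact congrArg (x * ·) (er.apply_symm_apply y).symm
    right_mul_eq := fun x y => Subtype.ext (Subtype.ext
      (F.twist_inv_mul_eq (mem_prodSpan_of_mem x) (mem_prodSpan_of_mem y))) }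

/-- The invertible multiplier `w_{g,h} = u_g u_h v_{gh}` of `D_g D_{gh}`. -/
def twist (g h : G) : (Multiplier k ↥(ℬ.domIdeal g * ℬ.domIdeal (g * h)))ˣ where
  val := F.twistMul g h
  inv := F.twistInv g h
  val_inv := Multiplier.ext
    (LinearMap.ext fun x => Subtype.ext (Subtype.ext (F.twist_left_inv (mem_prodSpan_of_mem x))))
    (LinearMap.ext fun x => Subtype.ext (Subtype.ext (F.twist_inv_right (mem_prodSpan_of_mem x))))
  inv_val := Multiplier.ext
    (LinearMap.ext fun x => Subtype.ext (Subtype.ext (F.twist_inv_left (mem_prodSpan_of_mem x))))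
    (LinearMap.ext fun x => Subtype.ext (Subtype.ext (F.twist_right_inv (mem_prodSpan_of_mem x))))

/-- The twisted partial action of `G` on `B_1` built from the families `u, v`. -/
def twistedPartialAction : TwistedPartialAction k G ℬ.one where
  toPartialSystem := F.partialSystem
  w := F.twist
  θ_θ _ _ _ ha := Subtype.ext (F.conj_conj (mem_domIdeal_mul.1 ha))
  w_one_left _ := Units.ext <| Multiplier.ext
    (LinearMap.ext fun x => Subtype.ext (Subtype.ext
      (F.twist_one_left (mem_prodSpan_of_mem x)).1))
    (LinearMap.ext fun x => Subtype.ext (Subtype.ext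
      (F.twist_one_left (mem_prodSpan_of_mem x)).2))
  w_one_right _ := Units.ext <| Multiplier.ext
    (LinearMap.ext fun x => Subtype.ext (Subtype.ext
      (F.twist_one_right (mem_prodSpan_of_mem x)).1))
    (LinearMap.ext fun x => Subtype.ext (Subtype.ext
      (F.twist_one_right (mem_prodSpan_of_mem x)).2))
  cocycle _ _ _ _ ha := Subtype.ext (F.twist_cocycle (mem_domIdeal_mul_mul.1 ha))

/-- The isomorphism `B_g → D_g`, `a ↦ a v_g`. -/
def compEquiv (g : G) : ℬ.comp g ≃ₗ[k] F.twistedPartialAction.D g where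
  toFun x := ⟨⟨Rv g x, dom_le_one g (F.Rv_of x.2)⟩, F.Rv_of x.2⟩
  map_add' x y := Subtype.ext (Subtype.ext ((F.pv g).r_add (F.triple.comp_le_right _ x.2)
    (F.triple.comp_le_right _ y.2)))
  map_smul' c x := Subtype.ext (Subtype.ext ((F.pv g).r_smul c (F.triple.comp_le_right _ x.2)))
  invFun x := ⟨Ru g (x : ℬ.one), F.Ru_dom_of x.2⟩
  left_inv x := Subtype.ext (F.Ru_Rv (F.triple.comp_le_right _ x.2))
  right_inv x := Subtype.ext (Subtype.ext (F.Rv_Ru (dom_le_right _ x.2)))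

/-- The isomorphism `∑ a_g ↦ ∑ a_g v_g δ_g` of `k`-modules. -/
noncomputable def linearEquiv : B ≃ₗ[k] CrossedProduct F.twistedPartialAction :=
  ℬ.decomp.symm ≪≫ₗ DFinsupp.mapRange.linearEquiv F.compEquiv

theorem linearEquiv_of_mem {g : G} (a : ℬ.comp g) :
    F.linearEquiv a = CrossedProduct.δ F.twistedPartialAction g (F.compEquiv g a) := by
  have h : ℬ.decomp.symm a = DirectSum.lof k G (fun g => ℬ.comp g) g a := by
    rw [LinearEquiv.symm_apply_eq, decomp_lof]
  change DFinsupp.mapRange.linearEquiv F.compEquiv (ℬ.decomp.symm a) = _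
  rw [h]
  exact DFinsupp.mapRange_single (f := fun g => F.compEquiv g) (hf := fun g => map_zero _)

theorem linearEquiv_symm_δ {g : G} (c : F.twistedPartialAction.D g) :
    F.linearEquiv.symm (CrossedProduct.δ F.twistedPartialAction g c) = (F.compEquiv g).symm c := by
  rw [LinearEquiv.symm_apply_eq, linearEquiv_of_mem, LinearEquiv.apply_symm_apply]

/-- The isomorphism `∑ a_g ↦ ∑ a_g v_g δ_g` of graded algebras. -/
noncomputable def gradedIso : ℬ.GradedIso F.twistedPartialAction where
  toLinearEquiv := F.linearEquiv
  map_mul' x y := by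
    change F.linearEquiv (x * y) = F.linearEquiv x * F.linearEquiv y
    induction x using ℬ.induction with
    | zero => rw [zero_mul, map_zero, CrossedProduct.zero_mul']
    | add a b ha hb => rw [add_mul, map_add, map_add, CrossedProduct.add_mul', ha, hb]
    | mem g a ha =>
      induction y using ℬ.induction with
      | zero => rw [mul_zero, map_zero, CrossedProduct.mul_zero']
      | add c d hc hd => rw [mul_add, map_add, map_add, CrossedProduct.mul_add', hc, hd]
      | mem h b hb =>
        refine (F.linearEquiv_of_mem ⟨a * b, ℬ.mul_mem ha hb⟩).trans ?_
        rw [F.linearEquiv_of_mem ⟨a, ha⟩, F.linearEquiv_of_mem ⟨b, hb⟩, CrossedProduct.δ_mul_δ]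
        congr 1
        exact Subtype.ext (Subtype.ext (F.coeff_mul ha hb).symm)
  map_comp g := by
    ext x
    constructor
    · rintro ⟨a, ha, rfl⟩
      exact ⟨_, (F.linearEquiv_of_mem ⟨a, ha⟩).symm⟩
    · rintro ⟨c, rfl⟩
      refine ⟨(F.compEquiv g).symm c, ((F.compEquiv g).symm c).2, ?_⟩
      refine (F.linearEquiv_of_mem _).trans ?_
      rw [LinearEquiv.apply_symm_apply]

end UnitFamily

end Grading

namespace Grading

variable {k : Type uk} {G : Type uG} {B : Type uB} [CommRing k] [Group G] [DecidableEq G]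
  [NonUnitalRing B] [Module k B] [IsScalarTower k B B] [SMulCommClass k B B]
  {ℬ : Grading k G B} {g : G}

/-! ### Entries of multipliers of the linking algebra -/

theorem TripleProduct.block_prodSpan (H : ℬ.TripleProduct) (g : G) (i l j : Fin 2) :
    ℬ.block g i l ⬝ ℬ.block g l j = ℬ.block g i j := by
  have h₁ := H.dom_comp g
  have h₂ := H.comp_dom_inv g
  have h₃ := H.dom_comp g⁻¹
  have h₄ := H.comp_dom_inv g⁻¹
  have h₅ := H.dom_dom g
  have h₆ := H.dom_dom g⁻¹
  rw [dom_inv] at h₂ h₃ h₆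
  rw [inv_inv] at h₄
  fin_cases i <;> fin_cases l <;> fin_cases j
  exacts [h₅, h₁, rfl, h₂, h₄, rfl, h₃, h₆]

theorem single_apply {i j : Fin 2} (x : ℬ.block g i j) (a b : Fin 2) :
    (ℬ.single g i j x).1 a b = if a = i ∧ b = j then (x : B) else 0 := rfl

theorem single_apply_self {i j : Fin 2} (x : ℬ.block g i j) :
    (ℬ.single g i j x).1 i j = x := by
  rw [single_apply, if_pos ⟨rfl, rfl⟩]

theorem single_add {i j : Fin 2} (x y : ℬ.block g i j) :
    ℬ.single g i j (x + y) = ℬ.single g i j x + ℬ.single g i j y := by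
  ext a b
  by_cases h : a = i ∧ b = j <;> simp [single_apply, h]

theorem single_smul {i j : Fin 2} (c : k) (x : ℬ.block g i j) :
    ℬ.single g i j (c • x) = c • ℬ.single g i j x := by
  ext a b
  by_cases h : a = i ∧ b = j <;> simp [single_apply, h]

theorem mul_single_apply {l m : Fin 2} (X : ℬ.linking g) (y : ℬ.block g l m) (a b : Fin 2) :
    (X * ℬ.single g l m y).1 a b = if b = m then X.1 a l * y else 0 := by
  change (X.1 * (ℬ.single g l m y).1) a b = _
  rw [Matrix.mul_apply, Finset.sum_eq_single l]
  · by_cases h : b = m <;> simp [single_apply, h]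
  · intro c _ hc
    simp [single_apply, hc]
  · simp

theorem single_mul_apply {l m : Fin 2} (x : ℬ.block g l m) (Y : ℬ.linking g) (a b : Fin 2) :
    (ℬ.single g l m x * Y).1 a b = if a = l then (x : B) * Y.1 m b else 0 := by
  change ((ℬ.single g l m x).1 * Y.1) a b = _
  rw [Matrix.mul_apply, Finset.sum_eq_single m]
  · by_cases h : a = l <;> simp [single_apply, h]
  · intro c _ hc
    simp [single_apply, hc]
  · simp

theorem single_mul_single {i l j : Fin 2} (x : ℬ.block g i l) (y : ℬ.block g l j) :
    ℬ.single g i l x * ℬ.single g l j y =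
      ℬ.single g i j ⟨(x : B) * y, ℬ.block_mul g i l j x.2 y.2⟩ := by
  ext a b
  rw [mul_single_apply]
  by_cases h : a = i <;> by_cases h' : b = j <;> simp [single_apply, h, h']

theorem e_left_single {i j : Fin 2} (x : ℬ.block g i j) :
    (ℬ.e g i).left (ℬ.single g i j x) = ℬ.single g i j x := by
  ext a b
  change (if a = i then (ℬ.single g i j x).1 a b else 0) = _
  by_cases h : a = i <;> simp [single_apply, h]

theorem e_right_single {i j : Fin 2} (x : ℬ.block g i j) :
    (ℬ.e g j).right (ℬ.single g i j x) = ℬ.single g i j x := by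
  ext a b
  change (if b = j then (ℬ.single g i j x).1 a b else 0) = _
  by_cases h : b = j <;> simp [single_apply, h]

/-- The `(i, m)` entry of `w x`, for `x` in the `(j, m)` block. -/
def leftEntry (w : Multiplier k (ℬ.linking g)) (i j m : Fin 2) (x : ℬ.block g j m) :
    ℬ.block g i m :=
  ⟨(w.left (ℬ.single g j m x)).1 i m, (w.left (ℬ.single g j m x)).2 i m⟩

/-- The `(m, j)` entry of `x w`, for `x` in the `(m, i)` block. -/
def rightEntry (w : Multiplier k (ℬ.linking g)) (i j m : Fin 2) (x : ℬ.block g m i) :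
    ℬ.block g m j :=
  ⟨(w.right (ℬ.single g m i x)).1 m j, (w.right (ℬ.single g m i x)).2 m j⟩

/-- The multipliers `w, w'` of `C_g` satisfy `w w' = e_{ii}` and `w' w = e_{jj}` with `i ≠ j`. -/
structure Links (w w' : Multiplier k (ℬ.linking g)) (i j : Fin 2) : Prop where
  ne : i ≠ j
  mul_eq : w * w' = ℬ.e g i
  mul_eq' : w' * w = ℬ.e g j

theorem IsLinkingPair.links {u v : Multiplier k (ℬ.linking g)} (h : ℬ.IsLinkingPair g u v) :
    Links u v 0 1 :=
  ⟨by decide, h.1, h.2⟩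

theorem leftEntry_add (w : Multiplier k (ℬ.linking g)) {i j m : Fin 2} (x y : ℬ.block g j m) :
    leftEntry w i j m (x + y) = leftEntry w i j m x + leftEntry w i j m y := by
  apply Subtype.ext
  simp [leftEntry, single_add]

theorem leftEntry_smul (w : Multiplier k (ℬ.linking g)) {i j m : Fin 2} (c : k)
    (x : ℬ.block g j m) : leftEntry w i j m (c • x) = c • leftEntry w i j m x := by
  apply Subtype.ext
  simp [leftEntry, single_smul]

theorem rightEntry_add (w : Multiplier k (ℬ.linking g)) {i j m : Fin 2} (x y : ℬ.block g m i) :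
    rightEntry w i j m (x + y) = rightEntry w i j m x + rightEntry w i j m y := by
  apply Subtype.ext
  simp [rightEntry, single_add]

theorem rightEntry_smul (w : Multiplier k (ℬ.linking g)) {i j m : Fin 2} (c : k)
    (x : ℬ.block g m i) : rightEntry w i j m (c • x) = c • rightEntry w i j m x := by
  apply Subtype.ext
  simp [rightEntry, single_smul]

theorem leftEntry_mul (w : Multiplier k (ℬ.linking g)) {i j l m : Fin 2} (x : ℬ.block g j l)
    (y : ℬ.block g l m) :
    (leftEntry w i j m ⟨(x : B) * y, ℬ.block_mul g j l m x.2 y.2⟩ : B) =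
      leftEntry w i j l x * y := by
  change (w.left (ℬ.single g j m _)).1 i m = _
  rw [← single_mul_single, w.left_mul, mul_single_apply, if_pos rfl]
  rfl

theorem rightEntry_mul (w : Multiplier k (ℬ.linking g)) {i j l m : Fin 2} (x : ℬ.block g m l)
    (y : ℬ.block g l i) :
    (rightEntry w i j m ⟨(x : B) * y, ℬ.block_mul g m l i x.2 y.2⟩ : B) =
      x * rightEntry w i j l y := by
  change (w.right (ℬ.single g m i _)).1 m j = _
  rw [← single_mul_single, w.right_mul, single_mul_apply, if_pos rfl]
  rfl

/-- Left multipliers preserve the columns. -/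
theorem left_single_apply_of_ne (H : ℬ.TripleProduct) (w : Multiplier k (ℬ.linking g))
    {j m a b : Fin 2} (x : ℬ.block g j m) (hb : b ≠ m) :
    (w.left (ℬ.single g j m x)).1 a b = 0 := by
  obtain ⟨x, hx⟩ := x
  have hx' := hx
  rw [← H.block_prodSpan g j m m] at hx'
  induction hx' using prodSpan_induction with
  | mul y hy z hz =>
    have := single_mul_single (ℬ := ℬ) (g := g) (⟨y, hy⟩ : ℬ.block g j m)
      (⟨z, hz⟩ : ℬ.block g m m)
    rw [← this, w.left_mul, mul_single_apply, if_neg hb]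
  | add y hy z hz hy' hz' =>
    rw [H.block_prodSpan g j m m] at hy hz
    have := single_add (⟨y, hy⟩ : ℬ.block g j m) ⟨z, hz⟩
    have h := congrArg (fun X => (w.left X).1 a b) this
    refine h.trans ?_
    simp only [map_add]
    exact (congrArg₂ (· + ·) (hy' hy) (hz' hz)).trans (add_zero 0)

/-- Right multipliers preserve the rows. -/
theorem right_single_apply_of_ne (H : ℬ.TripleProduct) (w : Multiplier k (ℬ.linking g))
    {i m a b : Fin 2} (x : ℬ.block g m i) (ha : a ≠ m) :
    (w.right (ℬ.single g m i x)).1 a b = 0 := by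
  obtain ⟨x, hx⟩ := x
  have hx' := hx
  rw [← H.block_prodSpan g m m i] at hx'
  induction hx' using prodSpan_induction with
  | mul y hy z hz =>
    have := single_mul_single (ℬ := ℬ) (g := g) (⟨y, hy⟩ : ℬ.block g m m)
      (⟨z, hz⟩ : ℬ.block g m i)
    rw [← this, w.right_mul, single_mul_apply, if_neg ha]
  | add y hy z hz hy' hz' =>
    rw [H.block_prodSpan g m m i] at hy hz
    have := single_add (⟨y, hy⟩ : ℬ.block g m i) ⟨z, hz⟩
    have h := congrArg (fun X => (w.right X).1 a b) this
    refine h.trans ?_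
    simp only [map_add]
    exact (congrArg₂ (· + ·) (hy' hy) (hz' hz)).trans (add_zero 0)

namespace Links

variable {w w' : Multiplier k (ℬ.linking g)} {i j : Fin 2} (K : Links w w' i j)
include K

theorem symm : Links w' w j i := ⟨K.ne.symm, K.mul_eq', K.mul_eq⟩

theorem mul_e : w * ℬ.e g j = ℬ.e g i * w := by
  rw [← K.mul_eq', ← K.mul_eq, mul_assoc]

theorem left_single (H : ℬ.TripleProduct) {m : Fin 2} (x : ℬ.block g j m) :
    w.left (ℬ.single g j m x) = ℬ.single g i m (leftEntry w i j m x) := by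
  have h : w.left ((ℬ.e g j).left (ℬ.single g j m x)) =
      (ℬ.e g i).left (w.left (ℬ.single g j m x)) :=
    congrArg (fun z : Multiplier k (ℬ.linking g) => z.left (ℬ.single g j m x)) K.mul_e
  rw [e_left_single] at h
  ext a b
  by_cases hb : b = m
  · subst hb
    by_cases ha : a = i
    · subst ha; rw [single_apply_self]; rfl
    · rw [single_apply, if_neg (fun h => ha h.1), h]
      exact if_neg ha
  · rw [left_single_apply_of_ne H w x hb, single_apply, if_neg (fun h => hb h.2)]

theorem right_single (H : ℬ.TripleProduct) {m : Fin 2} (x : ℬ.block g m i) :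
    w.right (ℬ.single g m i x) = ℬ.single g m j (rightEntry w i j m x) := by
  have h : (ℬ.e g j).right (w.right (ℬ.single g m i x)) =
      w.right ((ℬ.e g i).right (ℬ.single g m i x)) :=
    congrArg (fun z : Multiplier k (ℬ.linking g) => z.right (ℬ.single g m i x)) K.mul_e
  rw [e_right_single] at h
  ext a b
  by_cases ha : a = m
  · subst ha
    by_cases hb : b = j
    · subst hb; rw [single_apply_self]; rfl
    · rw [single_apply, if_neg (fun h => hb h.2), ← h]
      exact if_neg hb
  · rw [right_single_apply_of_ne H w x ha, single_apply, if_neg (fun h => ha h.1)]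

theorem rightEntry_mul_eq (H : ℬ.TripleProduct) {m n : Fin 2} (x : ℬ.block g m i)
    (y : ℬ.block g j n) : (rightEntry w i j m x : B) * y = x * leftEntry w i j n y := by
  have h := congrArg (fun X => X.1 m n) (w.right_mul_eq (ℬ.single g m i x) (ℬ.single g j n y))
  simp only [K.right_single H, K.left_single H, mul_single_apply, single_apply_self] at h
  simpa using h

theorem leftEntry_leftEntry (H : ℬ.TripleProduct) {m : Fin 2} (x : ℬ.block g j m) :
    leftEntry w' j i m (leftEntry w i j m x) = x := by
  apply Subtype.ext
  have h : w'.left (w.left (ℬ.single g j m x)) = (ℬ.e g j).left (ℬ.single g j m x) :=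
    congrArg (fun z : Multiplier k (ℬ.linking g) => z.left (ℬ.single g j m x)) K.mul_eq'
  rw [K.left_single H, e_left_single, K.symm.left_single H] at h
  have h' := congrArg (fun X => X.1 j m) h
  simpa only [single_apply_self] using h'

theorem rightEntry_rightEntry (H : ℬ.TripleProduct) {m : Fin 2} (x : ℬ.block g m i) :
    rightEntry w' j i m (rightEntry w i j m x) = x := by
  apply Subtype.ext
  have h : w'.right (w.right (ℬ.single g m i x)) = (ℬ.e g i).right (ℬ.single g m i x) :=
    congrArg (fun z : Multiplier k (ℬ.linking g) => z.right (ℬ.single g m i x)) K.mul_eq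
  rw [K.right_single H, e_right_single, K.symm.right_single H] at h
  have h' := congrArg (fun X => X.1 m i) h
  simpa only [single_apply_self] using h'

end Links

end Grading

/-! ### Extension of partially defined multipliers -/

section Extension

variable {k : Type uk} {B : Type uB} [CommRing k] [NonUnitalRing B] [Module k B]

open Classical in
/-- A partial linear map as a function, with value `0` off its domain. -/
noncomputable def totalize (f : B →ₗ.[k] B) (x : B) : B :=
  if h : x ∈ f.domain then f ⟨x, h⟩ else 0

theorem totalize_of_mem (f : B →ₗ.[k] B) {x : B} (h : x ∈ f.domain) : totalize f x = f ⟨x, h⟩ :=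
  dif_pos h

theorem totalize_add (f : B →ₗ.[k] B) {x y : B} (hx : x ∈ f.domain) (hy : y ∈ f.domain) :
    totalize f (x + y) = totalize f x + totalize f y := by
  rw [totalize_of_mem f hx, totalize_of_mem f hy, totalize_of_mem f (add_mem hx hy)]
  exact f.map_add ⟨x, hx⟩ ⟨y, hy⟩

theorem totalize_smul (f : B →ₗ.[k] B) (c : k) {x : B} (hx : x ∈ f.domain) :
    totalize f (c • x) = c • totalize f x := by
  rw [totalize_of_mem f hx, totalize_of_mem f (Submodule.smul_mem _ c hx)]
  exact f.map_smul c ⟨x, hx⟩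

theorem totalize_toLinearPMap {S : Submodule k (B × B)} (hS : ∀ p ∈ S, p.1 = 0 → p.2 = 0)
    {x y : B} (h : (x, y) ∈ S) : totalize S.toLinearPMap x = y := by
  have hx : x ∈ S.toLinearPMap.domain := ⟨(x, y), h, rfl⟩
  rw [totalize_of_mem _ hx]
  have h₁ := S.mem_graph_toLinearPMap hS ⟨x, hx⟩
  have h₂ := hS _ (S.sub_mem h₁ h) (sub_self x)
  exact sub_eq_zero.1 h₂

variable [IsScalarTower k B B] [SMulCommClass k B B] {P Q : Submodule k B}

/-- The partial map `Q B → B`, `x y ↦ f(x) y`. -/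
noncomputable def leftExt (f : Q → B) : B →ₗ.[k] B :=
  (Submodule.span k {p : B × B | ∃ (x : Q) (y : B), p = ((x : B) * y, f x * y)}).toLinearPMap

/-- The partial map `B Q → B`, `x y ↦ x r(y)`. -/
noncomputable def rightExt (r : Q → B) : B →ₗ.[k] B :=
  (Submodule.span k {p : B × B | ∃ (x : B) (y : Q), p = (x * (y : B), x * r y)}).toLinearPMap

theorem leftExt_domain (f : Q → B) : (leftExt (k := k) f).domain = Q ⬝ ⊤ := by
  change Submodule.map (LinearMap.fst k B B) (Submodule.span k _) = _
  rw [Submodule.map_span, prodSpan, Submodule.map₂_eq_span_image2]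
  congr 1
  ext z
  constructor
  · rintro ⟨_, ⟨x, y, rfl⟩, rfl⟩
    exact ⟨x, x.2, y, Submodule.mem_top, rfl⟩
  · rintro ⟨x, hx, y, _, rfl⟩
    exact ⟨_, ⟨⟨x, hx⟩, y, rfl⟩, rfl⟩

theorem rightExt_domain (r : Q → B) : (rightExt (k := k) r).domain = ⊤ ⬝ Q := by
  change Submodule.map (LinearMap.fst k B B) (Submodule.span k _) = _
  rw [Submodule.map_span, prodSpan, Submodule.map₂_eq_span_image2]
  congr 1
  ext z
  constructor
  · rintro ⟨_, ⟨x, y, rfl⟩, rfl⟩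
    exact ⟨x, Submodule.mem_top, y, y.2, rfl⟩
  · rintro ⟨x, _, y, hy, rfl⟩
    exact ⟨_, ⟨x, ⟨y, hy⟩, rfl⟩, rfl⟩

theorem leftExt_add (f : Q → B) {x y : B} (hx : x ∈ Q ⬝ ⊤) (hy : y ∈ Q ⬝ ⊤) :
    totalize (leftExt (k := k) f) (x + y) =
      totalize (leftExt (k := k) f) x + totalize (leftExt (k := k) f) y :=
  totalize_add _ (by rwa [leftExt_domain]) (by rwa [leftExt_domain])

theorem rightExt_add (r : Q → B) {x y : B} (hx : x ∈ ⊤ ⬝ Q) (hy : y ∈ ⊤ ⬝ Q) :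
    totalize (rightExt (k := k) r) (x + y) =
      totalize (rightExt (k := k) r) x + totalize (rightExt (k := k) r) y :=
  totalize_add _ (by rwa [rightExt_domain]) (by rwa [rightExt_domain])

/-- A pair of maps `f, r` on `Q` with `r(x) y = x f(y)` and enough nondegeneracy to extend them to
`Q B` and `B Q`. -/
structure Extendable (P Q : Submodule k B) (f r : Q → B) : Prop where
  f_mem : ∀ x, f x ∈ P ⬝ Q
  r_mem : ∀ x, r x ∈ Q ⬝ P
  r_mul_eq : ∀ x y : Q, r x * y = x * f y
  le_left : Q ≤ Q ⬝ ⊤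
  le_right : Q ≤ ⊤ ⬝ Q
  idem_left : P ⬝ Q ≤ P ⬝ Q ⬝ ⊤
  idem_right : Q ⬝ P ≤ ⊤ ⬝ (Q ⬝ P)
  nondeg_left : ∀ s ∈ P ⬝ Q ⬝ ⊤, (∀ z ∈ Q, z * s = 0) → s = 0
  nondeg_right : ∀ s ∈ ⊤ ⬝ (Q ⬝ P), (∀ z ∈ Q, s * z = 0) → s = 0

namespace Extendable

variable {f r : Q → B} (E : Extendable P Q f r)
include E

theorem left_graph {p : B × B}
    (hp : p ∈ Submodule.span k {p : B × B | ∃ (x : Q) (y : B), p = ((x : B) * y, f x * y)}) :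
    p.2 ∈ P ⬝ Q ⬝ ⊤ ∧ ∀ z : Q, r z * p.1 = z * p.2 := by
  induction hp using Submodule.span_induction with
  | mem p hp =>
    obtain ⟨x, y, rfl⟩ := hp
    refine ⟨mul_mem_prodSpan (E.f_mem x) Submodule.mem_top, fun z => ?_⟩
    change r z * (x * y) = z * (f x * y)
    rw [← mul_assoc, ← mul_assoc, E.r_mul_eq]
  | zero => exact ⟨zero_mem _, fun z => by simp⟩
  | add p q _ _ hp hq =>
    exact ⟨add_mem hp.1 hq.1, fun z => by simp only [Prod.fst_add, Prod.snd_add, mul_add, hp.2, hq.2]⟩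
  | smul c p _ hp =>
    exact ⟨Submodule.smul_mem _ c hp.1, fun z => by
      simp only [Prod.smul_fst, Prod.smul_snd, mul_smul_comm, hp.2]⟩

theorem right_graph {p : B × B}
    (hp : p ∈ Submodule.span k {p : B × B | ∃ (x : B) (y : Q), p = (x * (y : B), x * r y)}) :
    p.2 ∈ ⊤ ⬝ (Q ⬝ P) ∧ ∀ z : Q, p.1 * f z = p.2 * z := by
  induction hp using Submodule.span_induction with
  | mem p hp =>
    obtain ⟨x, y, rfl⟩ := hp
    refine ⟨mul_mem_prodSpan Submodule.mem_top (E.r_mem y), fun z => ?_⟩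
    change x * y * f z = x * r y * z
    rw [mul_assoc, mul_assoc, E.r_mul_eq]
  | zero => exact ⟨zero_mem _, fun z => by simp⟩
  | add p q _ _ hp hq =>
    exact ⟨add_mem hp.1 hq.1, fun z => by simp only [Prod.fst_add, Prod.snd_add, add_mul, hp.2, hq.2]⟩
  | smul c p _ hp =>
    exact ⟨Submodule.smul_mem _ c hp.1, fun z => by
      simp only [Prod.smul_fst, Prod.smul_snd, smul_mul_assoc, hp.2]⟩

theorem left_mul (x : Q) (y : B) : totalize (leftExt (k := k) f) ((x : B) * y) = f x * y := by
  refine totalize_toLinearPMap (fun p hp h0 => ?_) (Submodule.subset_span ⟨x, y, rfl⟩)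
  obtain ⟨h₁, h₂⟩ := E.left_graph hp
  exact E.nondeg_left _ h₁ fun z hz => by rw [← h₂ ⟨z, hz⟩, h0, mul_zero]

theorem right_mul (x : B) (y : Q) : totalize (rightExt (k := k) r) (x * (y : B)) = x * r y := by
  refine totalize_toLinearPMap (fun p hp h0 => ?_) (Submodule.subset_span ⟨x, y, rfl⟩)
  obtain ⟨h₁, h₂⟩ := E.right_graph hp
  exact E.nondeg_right _ h₁ fun z hz => by rw [← h₂ ⟨z, hz⟩, h0, zero_mul]

theorem left_spec {x : B} (hx : x ∈ Q ⬝ ⊤) :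
    totalize (leftExt (k := k) f) x ∈ P ⬝ Q ⬝ ⊤ ∧
      ∀ z : Q, r z * x = z * totalize (leftExt (k := k) f) x := by
  induction hx using prodSpan_induction with
  | mul m hm n hn =>
    have h := E.left_mul ⟨m, hm⟩ n
    change totalize (leftExt (k := k) f) (m * n) = _ at h
    rw [h]
    refine ⟨mul_mem_prodSpan (E.f_mem _) hn, fun z => ?_⟩
    rw [← mul_assoc, ← mul_assoc, ← E.r_mul_eq]
  | add a ha b hb ha' hb' =>
    rw [leftExt_add _ ha hb]
    exact ⟨add_mem ha'.1 hb'.1, fun z => by rw [mul_add, mul_add, ha'.2, hb'.2]⟩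

theorem right_spec {x : B} (hx : x ∈ ⊤ ⬝ Q) :
    totalize (rightExt (k := k) r) x ∈ ⊤ ⬝ (Q ⬝ P) ∧
      ∀ z : Q, x * f z = totalize (rightExt (k := k) r) x * z := by
  induction hx using prodSpan_induction with
  | mul m hm n hn =>
    have h := E.right_mul m ⟨n, hn⟩
    change totalize (rightExt (k := k) r) (m * n) = _ at h
    rw [h]
    refine ⟨mul_mem_prodSpan hm (E.r_mem _), fun z => ?_⟩
    rw [mul_assoc, mul_assoc, E.r_mul_eq]
  | add a ha b hb ha' hb' =>
    rw [rightExt_add _ ha hb]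
    exact ⟨add_mem ha'.1 hb'.1, fun z => by rw [add_mul, add_mul, ha'.2, hb'.2]⟩

theorem left_apply (x : Q) : totalize (leftExt (k := k) f) x = f x := by
  obtain ⟨h₁, h₂⟩ := E.left_spec (E.le_left x.2)
  refine sub_eq_zero.1 (E.nondeg_left _ (sub_mem h₁ (E.idem_left (E.f_mem x))) fun z hz => ?_)
  rw [mul_sub, ← h₂ ⟨z, hz⟩, E.r_mul_eq ⟨z, hz⟩, sub_self]

theorem right_apply (x : Q) : totalize (rightExt (k := k) r) x = r x := by
  obtain ⟨h₁, h₂⟩ := E.right_spec (E.le_right x.2)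
  refine sub_eq_zero.1 (E.nondeg_right _ (sub_mem h₁ (E.idem_right (E.r_mem x))) fun z hz => ?_)
  rw [sub_mul, ← h₂ ⟨z, hz⟩, E.r_mul_eq x ⟨z, hz⟩, sub_self]

/-- The extensions form a partially defined multiplier. -/
theorem pairOp :
    PairOp P Q (totalize (leftExt (k := k) f)) (totalize (rightExt (k := k) r)) where
  l_add := leftExt_add _
  l_smul c x hx := totalize_smul _ c (by rwa [leftExt_domain])
  l_mul {x} y hx := by
    induction hx using prodSpan_induction with
    | mul m hm n hn =>
      have h₁ := E.left_mul ⟨m, hm⟩ n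
      have h₂ := E.left_mul ⟨m, hm⟩ (n * y)
      simp only [← mul_assoc] at h₁ h₂
      rw [h₁, h₂]
    | add a ha b hb ha' hb' =>
      have key : ∀ {c}, c ∈ Q ⬝ ⊤ → c * y ∈ Q ⬝ ⊤ := fun hc => by
        have := mul_mem_prodSpan hc (Submodule.mem_top (x := y))
        rw [prodSpan_assoc] at this
        exact prodSpan_le_prodSpan_top this
      rw [add_mul, leftExt_add _ (key ha) (key hb), leftExt_add _ ha hb, ha', hb', add_mul]
  l_mem {x} hx := by
    have := E.left_apply ⟨x, hx⟩
    change totalize (leftExt (k := k) f) x = _ at this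
    rw [this]; exact E.f_mem _
  r_add := rightExt_add _
  r_smul c x hx := totalize_smul _ c (by rwa [rightExt_domain])
  r_mul x {y} hy := by
    induction hy using prodSpan_induction with
    | mul m hm n hn =>
      have h₁ := E.right_mul m ⟨n, hn⟩
      have h₂ := E.right_mul (x * m) ⟨n, hn⟩
      simp only [mul_assoc] at h₁ h₂
      rw [h₁, h₂]
    | add a ha b hb ha' hb' =>
      have key : ∀ {c}, c ∈ ⊤ ⬝ Q → x * c ∈ ⊤ ⬝ Q := fun hc => by
        have := mul_mem_prodSpan (Submodule.mem_top (x := x)) hc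
        rw [← prodSpan_assoc] at this
        exact prodSpan_le_top_prodSpan this
      rw [mul_add, rightExt_add _ (key ha) (key hb), rightExt_add _ ha hb, ha', hb', mul_add]
  r_mem {x} hx := by
    have := E.right_apply ⟨x, hx⟩
    change totalize (rightExt (k := k) r) x = _ at this
    rw [this]; exact E.r_mem _
  r_mul_eq {x y} hx hy := by
    induction hx using prodSpan_induction with
    | mul m hm n hn =>
      have h := E.right_mul m ⟨n, hn⟩
      change totalize (rightExt (k := k) r) (m * n) = _ at h
      rw [h, mul_assoc, mul_assoc, (E.left_spec hy).2]
    | add a ha b hb ha' hb' => rw [rightExt_add _ ha hb, add_mul, add_mul, ha', hb']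

end Extendable

end Extension

namespace Grading

/-! ### Homogeneous components and nondegeneracy -/

section Components

variable {k : Type uk} {G : Type uG} {B : Type uB} [CommRing k] [Group G] [DecidableEq G]
  [NonUnitalRing B] [Module k B]

/-- The component of degree `h`. -/
noncomputable def proj (ℬ : Grading k G B) (h : G) : B →ₗ[k] B :=
  (ℬ.comp h).subtype ∘ₗ DirectSum.component k G (fun g => ℬ.comp g) h ∘ₗ ℬ.decomp.symm

variable {ℬ : Grading k G B} {g h : G} {x : B}

theorem proj_mem (h : G) (x : B) : ℬ.proj h x ∈ ℬ.comp h := Subtype.property _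

theorem proj_of_mem (hx : x ∈ ℬ.comp g) : ℬ.proj h x = if g = h then x else 0 := by
  have e : ℬ.decomp.symm x = DirectSum.lof k G (fun g => ℬ.comp g) g ⟨x, hx⟩ := by
    rw [LinearEquiv.symm_apply_eq, decomp_lof]
  change ((DirectSum.component k G (fun g => ℬ.comp g) h (ℬ.decomp.symm x) : ℬ.comp h) : B) = _
  rw [e]
  split_ifs with hgh
  · subst hgh; rw [DirectSum.component.lof_self]
  · rw [DirectSum.component.of, dif_neg hgh]; rfl

theorem eq_zero_of_proj (hx : ∀ h, ℬ.proj h x = 0) : x = 0 := by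
  refine ℬ.decomp.symm.map_eq_zero_iff.1 (DFinsupp.ext fun h => ?_)
  exact Subtype.ext (hx h)

theorem proj_mul_left {a : B} (ha : a ∈ ℬ.comp g) (x : B) :
    ℬ.proj (g * h) (a * x) = a * ℬ.proj h x := by
  induction x using ℬ.induction with
  | zero => simp
  | add b c hb hc => rw [mul_add, map_add, map_add, hb, hc, mul_add]
  | mem t b hb =>
    rw [proj_of_mem hb, proj_of_mem (ℬ.mul_mem ha hb)]
    by_cases e : t = h <;> simp [e]

theorem proj_mul_right {a : B} (ha : a ∈ ℬ.comp g) (x : B) :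
    ℬ.proj (h * g) (x * a) = ℬ.proj h x * a := by
  induction x using ℬ.induction with
  | zero => simp
  | add b c hb hc => rw [add_mul, map_add, map_add, hb, hc, add_mul]
  | mem t b hb =>
    rw [proj_of_mem hb, proj_of_mem (ℬ.mul_mem hb ha)]
    by_cases e : t = h <;> simp [e]

namespace HomogeneouslyNondegenerate

variable (hℬ : ℬ.HomogeneouslyNondegenerate) {t : G}
include hℬ

theorem eq_zero_of_left (hx : x ∈ ℬ.comp t) (h : ∀ y ∈ ℬ.comp t⁻¹, y * x = 0) : x = 0 := by
  by_contra hne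
  obtain ⟨y, hy, hy'⟩ := (hℬ t x hx hne).2
  exact hy' (h y hy)

theorem eq_zero_of_right (hx : x ∈ ℬ.comp t) (h : ∀ y ∈ ℬ.comp t⁻¹, x * y = 0) : x = 0 := by
  by_contra hne
  obtain ⟨y, hy, hy'⟩ := (hℬ t x hx hne).1
  exact hy' (h y hy)

end HomogeneouslyNondegenerate

end Components

variable {k : Type uk} {G : Type uG} {B : Type uB} [CommRing k] [Group G] [DecidableEq G]
  [NonUnitalRing B] [Module k B] [IsScalarTower k B B] [SMulCommClass k B B]
  {ℬ : Grading k G B} {g : G}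

/-- Nondegeneracy of an ideal `I` of `B_1` on the left passes to `I B`. -/
theorem nondeg_left_extend (hℬ : ℬ.HomogeneouslyNondegenerate) {I Q : Submodule k B} {t : G}
    (hI : I ≤ ℬ.comp 1) (hI' : I ⬝ ℬ.comp 1 ≤ I) (hQ : Q ≤ ℬ.comp t)
    (hnd : ∀ x ∈ I, (∀ z ∈ Q, z * x = 0) → x = 0) {s : B} (hs : s ∈ I ⬝ ⊤)
    (h0 : ∀ z ∈ Q, z * s = 0) : s = 0 := by
  refine eq_zero_of_proj (ℬ := ℬ) fun h => ?_
  have h₁ : ℬ.proj h s ∈ I ⬝ ℬ.comp h := by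
    clear h0
    induction hs using prodSpan_induction with
    | mul m hm n hn =>
      have := proj_mul_left (h := h) (hI hm) n
      rw [one_mul] at this
      rw [this]; exact mul_mem_prodSpan hm (proj_mem h n)
    | add a _ b _ ha hb => rw [map_add]; exact add_mem ha hb
  have h₂ : ∀ z ∈ Q, z * ℬ.proj h s = 0 := fun z hz => by
    rw [← proj_mul_left (hQ hz), h0 z hz, map_zero]
  by_contra hne
  obtain ⟨y, hy, hy'⟩ := (hℬ h _ (proj_mem h s) hne).1
  refine hy' (hnd _ (hI' ?_) fun z hz => by rw [← mul_assoc, h₂ z hz, zero_mul])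
  have := mul_mem_prodSpan h₁ hy
  rw [prodSpan_assoc] at this
  exact prodSpan_mono le_rfl (dom_le_one h) this

/-- Nondegeneracy of an ideal `I` of `B_1` on the right passes to `B I`. -/
theorem nondeg_right_extend (hℬ : ℬ.HomogeneouslyNondegenerate) {I Q : Submodule k B} {t : G}
    (hI : I ≤ ℬ.comp 1) (hI' : ℬ.comp 1 ⬝ I ≤ I) (hQ : Q ≤ ℬ.comp t)
    (hnd : ∀ x ∈ I, (∀ z ∈ Q, x * z = 0) → x = 0) {s : B} (hs : s ∈ ⊤ ⬝ I)
    (h0 : ∀ z ∈ Q, s * z = 0) : s = 0 := by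
  refine eq_zero_of_proj (ℬ := ℬ) fun h => ?_
  have h₁ : ℬ.proj h s ∈ ℬ.comp h ⬝ I := by
    clear h0
    induction hs using prodSpan_induction with
    | mul m hm n hn =>
      have := proj_mul_right (h := h) (hI hn) m
      rw [mul_one] at this
      rw [this]; exact mul_mem_prodSpan (proj_mem h m) hn
    | add a _ b _ ha hb => rw [map_add]; exact add_mem ha hb
  have h₂ : ∀ z ∈ Q, ℬ.proj h s * z = 0 := fun z hz => by
    rw [← proj_mul_right (hQ hz), h0 z hz, map_zero]
  by_contra hne
  obtain ⟨y, hy, hy'⟩ := (hℬ h _ (proj_mem h s) hne).2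
  refine hy' (hnd _ (hI' ?_) fun z hz => by rw [mul_assoc, h₂ z hz, mul_zero])
  have := mul_mem_prodSpan hy h₁
  rw [← prodSpan_assoc] at this
  exact prodSpan_mono (comp_prodSpan_comp_le (inv_mul_cancel h)) le_rfl this

end Grading

namespace Grading

variable {k : Type uk} {G : Type uG} {B : Type uB} [CommRing k] [Group G] [DecidableEq G]
  [NonUnitalRing B] [Module k B] [IsScalarTower k B B] [SMulCommClass k B B]
  {ℬ : Grading k G B} {g : G}

/-! ### Extension of the multipliers of the linking algebra -/

theorem block_self_le_one (i : Fin 2) : ℬ.block g i i ≤ ℬ.comp 1 := by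
  fin_cases i
  · exact dom_le_one g
  · exact comp_prodSpan_comp_le (inv_mul_cancel g)

theorem block_self_one_le (i : Fin 2) : ℬ.block g i i ⬝ ℬ.comp 1 ≤ ℬ.block g i i := by
  fin_cases i
  · exact dom_prodSpan_one_le g
  · have := dom_prodSpan_one_le (ℬ := ℬ) g⁻¹
    rwa [dom_inv] at this

theorem one_block_self_le (i : Fin 2) : ℬ.comp 1 ⬝ ℬ.block g i i ≤ ℬ.block g i i := by
  fin_cases i
  · exact one_prodSpan_dom_le g
  · have := one_prodSpan_dom_le (ℬ := ℬ) g⁻¹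
    rwa [dom_inv] at this

/-- The off-diagonal blocks are homogeneous components of mutually inverse degrees. -/
theorem exists_block_eq_comp {i j : Fin 2} (hij : i ≠ j) :
    ∃ t, ℬ.block g j i = ℬ.comp t ∧ ℬ.block g i j = ℬ.comp t⁻¹ := by
  fin_cases i <;> fin_cases j
  · exact absurd rfl hij
  · exact ⟨g⁻¹, rfl, by rw [inv_inv]; rfl⟩
  · exact ⟨g, rfl, rfl⟩
  · exact absurd rfl hij

theorem mul_eq_zero_of_mem_prodSpan_left {M N : Submodule k B} {x y : B} (hy : y ∈ M ⬝ N)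
    (h : ∀ z ∈ N, z * x = 0) : y * x = 0 := by
  induction hy using prodSpan_induction with
  | mul a _ b hb => rw [mul_assoc, h b hb, mul_zero]
  | add a _ b _ ha hb => rw [add_mul, ha, hb, add_zero]

theorem mul_eq_zero_of_mem_prodSpan_right {M N : Submodule k B} {x y : B} (hy : y ∈ M ⬝ N)
    (h : ∀ z ∈ M, x * z = 0) : x * y = 0 := by
  induction hy using prodSpan_induction with
  | mul a ha b _ => rw [← mul_assoc, h a ha, zero_mul]
  | add a _ b _ ha hb => rw [mul_add, ha, hb, add_zero]

/-- Left multiplication by `w` on `B_h B`, where `B_h` is the `(j, i)` block of `C_g`. -/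
noncomputable def opL (w : Multiplier k (ℬ.linking g)) (i j : Fin 2) : B → B :=
  totalize (leftExt (k := k) fun x : ℬ.block g j i => (leftEntry w i j i x : B))

/-- Right multiplication by `w` on `B B_h`, where `B_h` is the `(j, i)` block of `C_g`. -/
noncomputable def opR (w : Multiplier k (ℬ.linking g)) (i j : Fin 2) : B → B :=
  totalize (rightExt (k := k) fun x : ℬ.block g j i => (rightEntry w i j j x : B))

theorem leftExtU_eq (u : Multiplier k (ℬ.linking g)) : ℬ.leftExtU u =
    leftExt fun x : ℬ.block g 1 0 => (leftEntry u 0 1 0 x : B) := rfl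

theorem rightExtU_eq (u : Multiplier k (ℬ.linking g)) : ℬ.rightExtU u =
    rightExt fun x : ℬ.block g 1 0 => (rightEntry u 0 1 1 x : B) := rfl

theorem leftExtV_eq (v : Multiplier k (ℬ.linking g)) : ℬ.leftExtV v =
    leftExt fun x : ℬ.block g 0 1 => (leftEntry v 1 0 1 x : B) := rfl

theorem rightExtV_eq (v : Multiplier k (ℬ.linking g)) : ℬ.rightExtV v =
    rightExt fun x : ℬ.block g 0 1 => (rightEntry v 1 0 0 x : B) := rfl

namespace Links

variable {w w' : Multiplier k (ℬ.linking g)} {i j : Fin 2} (K : Links w w' i j)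
  (H : ℬ.TripleProduct) (hℬ : ℬ.HomogeneouslyNondegenerate)
include K H hℬ

theorem block_nondeg_left {x : B} (hx : x ∈ ℬ.block g i i)
    (h0 : ∀ z ∈ ℬ.block g j i, z * x = 0) : x = 0 := by
  obtain ⟨t, ht, ht'⟩ := exists_block_eq_comp (ℬ := ℬ) (g := g) K.ne
  have h₁ : (leftEntry w' j i i ⟨x, hx⟩ : B) = 0 := by
    refine hℬ.eq_zero_of_left (t := t) (ht ▸ Subtype.property _) fun y hy => ?_
    rw [← ht'] at hy
    rw [← K.symm.rightEntry_mul_eq H (⟨y, hy⟩ : ℬ.block g i j) ⟨x, hx⟩]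
    refine mul_eq_zero_of_mem_prodSpan_left (M := ℬ.block g i j) ?_ h0
    rw [H.block_prodSpan]; exact Subtype.property _
  have h₂ := K.symm.leftEntry_leftEntry H ⟨x, hx⟩
  have h₃ : leftEntry w' j i i ⟨x, hx⟩ = 0 := Subtype.ext h₁
  rw [h₃] at h₂
  have h₄ := leftEntry_smul (i := i) w (0 : k) (0 : ℬ.block g j i)
  rw [zero_smul, zero_smul] at h₄
  rw [h₄] at h₂
  exact (congrArg Subtype.val h₂).symm

theorem block_nondeg_right {x : B} (hx : x ∈ ℬ.block g j j)
    (h0 : ∀ z ∈ ℬ.block g j i, x * z = 0) : x = 0 := by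
  obtain ⟨t, ht, ht'⟩ := exists_block_eq_comp (ℬ := ℬ) (g := g) K.ne
  have h₁ : (rightEntry w' j i j ⟨x, hx⟩ : B) = 0 := by
    refine hℬ.eq_zero_of_right (t := t) (ht ▸ Subtype.property _) fun y hy => ?_
    rw [← ht'] at hy
    rw [K.symm.rightEntry_mul_eq H ⟨x, hx⟩ (⟨y, hy⟩ : ℬ.block g i j)]
    refine mul_eq_zero_of_mem_prodSpan_right (N := ℬ.block g i j) ?_ h0
    rw [H.block_prodSpan]; exact Subtype.property _
  have h₂ := K.symm.rightEntry_rightEntry H ⟨x, hx⟩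
  have h₃ : rightEntry w' j i j ⟨x, hx⟩ = 0 := Subtype.ext h₁
  rw [h₃] at h₂
  have h₄ := rightEntry_smul (j := j) w (0 : k) (0 : ℬ.block g j i)
  rw [zero_smul, zero_smul] at h₄
  rw [h₄] at h₂
  exact (congrArg Subtype.val h₂).symm

theorem extendable : Extendable (ℬ.block g i j) (ℬ.block g j i)
    (fun x => (leftEntry w i j i x : B)) (fun x => (rightEntry w i j j x : B)) where
  f_mem x := by rw [H.block_prodSpan]; exact Subtype.property _
  r_mem x := by rw [H.block_prodSpan]; exact Subtype.property _
  r_mul_eq x y := K.rightEntry_mul_eq H x y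
  le_left := by
    conv_lhs => rw [← H.block_prodSpan g j i i]
    exact prodSpan_le_prodSpan_top
  le_right := by
    conv_lhs => rw [← H.block_prodSpan g j j i]
    exact prodSpan_le_top_prodSpan
  idem_left := by
    rw [H.block_prodSpan]
    conv_lhs => rw [← H.block_prodSpan g i i i]
    exact prodSpan_le_prodSpan_top
  idem_right := by
    rw [H.block_prodSpan]
    conv_lhs => rw [← H.block_prodSpan g j j j]
    exact prodSpan_le_top_prodSpan
  nondeg_left s hs h0 := by
    rw [H.block_prodSpan] at hs
    obtain ⟨t, ht, -⟩ := exists_block_eq_comp (ℬ := ℬ) (g := g) K.ne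
    exact nondeg_left_extend hℬ (block_self_le_one i) (block_self_one_le i) ht.le
      (fun x hx => K.block_nondeg_left H hℬ hx) hs h0
  nondeg_right s hs h0 := by
    rw [H.block_prodSpan] at hs
    obtain ⟨t, ht, -⟩ := exists_block_eq_comp (ℬ := ℬ) (g := g) K.ne
    exact nondeg_right_extend hℬ (block_self_le_one j) (one_block_self_le j) ht.le
      (fun x hx => K.block_nondeg_right H hℬ hx) hs h0

theorem pairOp : PairOp (ℬ.block g i j) (ℬ.block g j i) (opL w i j) (opR w i j) :=
  (K.extendable H hℬ).pairOp

theorem opL_mul (x : ℬ.block g j i) (y : B) : opL w i j (x * y) = leftEntry w i j i x * y :=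
  (K.extendable H hℬ).left_mul x y

theorem opR_mul (x : B) (y : ℬ.block g j i) : opR w i j (x * y) = x * rightEntry w i j j y :=
  (K.extendable H hℬ).right_mul x y

theorem opL_apply {m : Fin 2} (x : ℬ.block g j m) : opL w i j x = leftEntry w i j m x := by
  obtain ⟨x, hx⟩ := x
  have hx' := hx
  rw [← H.block_prodSpan g j i m] at hx'
  change opL w i j x = _
  induction hx' using prodSpan_induction with
  | mul a ha b hb =>
    exact (K.opL_mul H hℬ ⟨a, ha⟩ b).trans (leftEntry_mul w ⟨a, ha⟩ ⟨b, hb⟩).symm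
  | add a ha b hb ha' hb' =>
    have ha₁ := ha
    have hb₁ := hb
    rw [H.block_prodSpan] at ha₁ hb₁
    rw [(K.pairOp H hℬ).l_add (prodSpan_le_prodSpan_top ha) (prodSpan_le_prodSpan_top hb),
      ha' ha₁, hb' hb₁]
    exact congrArg Subtype.val (leftEntry_add (i := i) w ⟨a, ha₁⟩ ⟨b, hb₁⟩).symm

theorem opR_apply {m : Fin 2} (x : ℬ.block g m i) : opR w i j x = rightEntry w i j m x := by
  obtain ⟨x, hx⟩ := x
  have hx' := hx
  rw [← H.block_prodSpan g m j i] at hx'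
  change opR w i j x = _
  induction hx' using prodSpan_induction with
  | mul a ha b hb =>
    exact (K.opR_mul H hℬ a ⟨b, hb⟩).trans (rightEntry_mul w ⟨a, ha⟩ ⟨b, hb⟩).symm
  | add a ha b hb ha' hb' =>
    have ha₁ := ha
    have hb₁ := hb
    rw [H.block_prodSpan] at ha₁ hb₁
    rw [(K.pairOp H hℬ).r_add (prodSpan_le_top_prodSpan ha) (prodSpan_le_top_prodSpan hb),
      ha' ha₁, hb' hb₁]
    exact congrArg Subtype.val (rightEntry_add (j := j) w ⟨a, ha₁⟩ ⟨b, hb₁⟩).symm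

theorem opL_opL {x : B} (hx : x ∈ ℬ.block g j i ⬝ ⊤) : opL w' j i (opL w i j x) = x := by
  have hmem : ∀ a : ℬ.block g i i, (a : B) ∈ ℬ.block g i j ⬝ ⊤ := fun a =>
    prodSpan_le_prodSpan_top ((H.block_prodSpan g i j i).ge a.2)
  have P := K.pairOp H hℬ
  have P' := K.symm.pairOp H hℬ
  have hmem' : ∀ {a : B}, a ∈ ℬ.block g j i ⬝ ⊤ → opL w i j a ∈ ℬ.block g i j ⬝ ⊤ := fun ha => by
    have := P.l_mem_prodSpan (K.extendable H hℬ).le_left (fun _ => P.l_mem) ha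
    rw [prodSpan_assoc] at this
    exact prodSpan_le_prodSpan_top this
  induction hx using prodSpan_induction with
  | mul a ha b hb =>
    rw [K.opL_mul H hℬ ⟨a, ha⟩ b, P'.l_mul _ (hmem _), K.symm.opL_apply H hℬ,
      K.leftEntry_leftEntry H]
  | add a ha b hb ha' hb' =>
    rw [P.l_add ha hb, P'.l_add (hmem' ha) (hmem' hb), ha', hb']

theorem opR_opR {x : B} (hx : x ∈ ⊤ ⬝ ℬ.block g j i) : opR w' j i (opR w i j x) = x := by
  have hmem : ∀ a : ℬ.block g j j, (a : B) ∈ ⊤ ⬝ ℬ.block g i j := fun a =>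
    prodSpan_le_top_prodSpan ((H.block_prodSpan g j i j).ge a.2)
  have P := K.pairOp H hℬ
  have P' := K.symm.pairOp H hℬ
  have hmem' : ∀ {a : B}, a ∈ ⊤ ⬝ ℬ.block g j i → opR w i j a ∈ ⊤ ⬝ ℬ.block g i j := fun ha => by
    have := P.r_mem_prodSpan (K.extendable H hℬ).le_right (fun _ => P.r_mem) ha
    rw [← prodSpan_assoc] at this
    exact prodSpan_le_top_prodSpan this
  induction hx using prodSpan_induction with
  | mul a ha b hb =>
    rw [K.opR_mul H hℬ a ⟨b, hb⟩, P'.r_mul _ (hmem _), K.symm.opR_apply H hℬ,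
      K.rightEntry_rightEntry H]
  | add a ha b hb ha' hb' =>
    rw [P.r_add ha hb, P'.r_add (hmem' ha) (hmem' hb), ha', hb']

end Links

theorem IsLinkingPair.extensionsWellDefined {u v : Multiplier k (ℬ.linking g)}
    (h : ℬ.IsLinkingPair g u v) (H : ℬ.TripleProduct) (hℬ : ℬ.HomogeneouslyNondegenerate) :
    ℬ.ExtensionsWellDefined u v := by
  have L : ∀ {Q : Submodule k B} (f : Q → B) (x : Q) (y : B),
      (x : B) * y ∈ (leftExt (k := k) f).domain := fun f x y => by
    rw [leftExt_domain]; exact mul_mem_prodSpan x.2 Submodule.mem_top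
  have R : ∀ {Q : Submodule k B} (f : Q → B) (x : B) (y : Q),
      x * (y : B) ∈ (rightExt (k := k) f).domain := fun f x y => by
    rw [rightExt_domain]; exact mul_mem_prodSpan Submodule.mem_top y.2
  refine ⟨fun x y => ⟨L _ x y, ?_⟩, fun x y => ⟨L _ x y, ?_⟩, fun x y => ⟨R _ x y, ?_⟩,
    fun x y => ⟨R _ x y, ?_⟩⟩
  · exact (totalize_of_mem _ _).symm.trans (h.links.opL_mul H hℬ x y)
  · exact (totalize_of_mem _ _).symm.trans (h.links.symm.opL_mul H hℬ x y)
  · exact (totalize_of_mem _ _).symm.trans (h.links.opR_mul H hℬ x y)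
  · exact (totalize_of_mem _ _).symm.trans (h.links.symm.opR_mul H hℬ x y)

section Family

variable {u v : ∀ g, Multiplier k (ℬ.linking g)}

theorem unitFamily (hℬ : ℬ.HomogeneouslyNondegenerate) (H : ℬ.TripleProduct)
    (huv : ∀ g, ℬ.IsLinkingPair g (u g) (v g)) (hu : ℬ.ActsAsMatrixUnit (u 1) 0 1) :
    ℬ.UnitFamily (fun g => opL (u g) 0 1) (fun g => opR (u g) 0 1) (fun g => opL (v g) 1 0)
      (fun g => opR (v g) 1 0) where
  triple := H
  pu g := (huv g).links.pairOp H hℬ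
  pv g := (huv g).links.symm.pairOp H hℬ
  Lv_Lu hx := (huv _).links.opL_opL H hℬ hx
  Lu_Lv hx := (huv _).links.symm.opL_opL H hℬ hx
  Rv_Ru hx := (huv _).links.opR_opR H hℬ hx
  Ru_Rv hx := (huv _).links.symm.opR_opR H hℬ hx
  Lu_one {x} hx := by
    rw [← inv_one] at hx
    have P := (huv 1).links.pairOp H hℬ
    induction hx using prodSpan_induction with
    | mul a ha b hb =>
      refine ((huv 1).links.opL_mul H hℬ ⟨a, ha⟩ b).trans ?_
      have := (hu (ℬ.single 1 1 0 ⟨a, ha⟩) 0 0).1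
      rw [if_pos rfl, single_apply_self] at this
      exact congrArg (· * b) this
    | add a ha b hb ha' hb' => exact (P.l_add ha hb).trans (congrArg₂ (· + ·) ha' hb')
  Ru_one {x} hx := by
    rw [← inv_one] at hx
    have P := (huv 1).links.pairOp H hℬ
    induction hx using prodSpan_induction with
    | mul a ha b hb =>
      refine ((huv 1).links.opR_mul H hℬ a ⟨b, hb⟩).trans ?_
      have := (hu (ℬ.single 1 1 0 ⟨b, hb⟩) 1 1).2
      rw [if_pos rfl, single_apply_self] at this
      exact congrArg (a * ·) this
    | add a ha b hb ha' hb' => exact (P.r_add ha hb).trans (congrArg₂ (· + ·) ha' hb')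

theorem exists_leftExt {Q : Submodule k B} (f : Q → B) {x : B} (hx : x ∈ Q ⬝ ⊤) :
    ∃ h : x ∈ (leftExt (k := k) f).domain, leftExt f ⟨x, h⟩ = totalize (leftExt (k := k) f) x := by
  rw [← leftExt_domain f] at hx
  exact ⟨hx, (totalize_of_mem _ hx).symm⟩

theorem exists_rightExt {Q : Submodule k B} (f : Q → B) {x : B} (hx : x ∈ ⊤ ⬝ Q) :
    ∃ h : x ∈ (rightExt (k := k) f).domain,
      rightExt f ⟨x, h⟩ = totalize (rightExt (k := k) f) x := by
  rw [← rightExt_domain f] at hx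
  exact ⟨hx, (totalize_of_mem _ hx).symm⟩

theorem isBuiltFrom (hℬ : ℬ.HomogeneouslyNondegenerate) (H : ℬ.TripleProduct)
    (huv : ∀ g, ℬ.IsLinkingPair g (u g) (v g)) (hu : ℬ.ActsAsMatrixUnit (u 1) 0 1) :
    ℬ.IsBuiltFrom u v (unitFamily hℬ H huv hu).twistedPartialAction where
  D_eq g x := Iff.rfl
  θ_eq g x := by
    have hx : ((x : ℬ.one) : B) ∈ ℬ.dom g⁻¹ := x.2
    rw [dom_inv] at hx
    have hx' : ((x : ℬ.one) : B) ∈ ℬ.block g 1 1 := hx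
    refine ⟨hx', ?_⟩
    have K := (huv g).links
    rw [K.left_single H, K.symm.right_single H, single_apply_self, ← K.symm.opR_apply H hℬ,
      ← K.opL_apply H hℬ]
    rfl
  w_left g h x := by
    have F := unitFamily hℬ H huv hu
    have hx := UnitFamily.mem_prodSpan_of_mem x
    have m₁ := F.twist_left_mem₁ hx
    have m₂ := F.twist_left_mem₂ m₁
    obtain ⟨h₁, e₁⟩ := exists_leftExt
      (fun x : ℬ.block (g * h) 0 1 => (leftEntry (v (g * h)) 1 0 1 x : B))
      (H.dom_dom_le_left _ _ hx)
    obtain ⟨h₂, e₂⟩ := exists_leftExt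
      (fun x : ℬ.block h 1 0 => (leftEntry (u h) 0 1 0 x : B)) (prodSpan_le_prodSpan_top m₁)
    obtain ⟨h₃, e₃⟩ := exists_leftExt
      (fun x : ℬ.block g 1 0 => (leftEntry (u g) 0 1 0 x : B)) (prodSpan_le_prodSpan_top m₂)
    simp only [leftExtU_eq, leftExtV_eq]
    refine ⟨h₁, ?_⟩
    simp only [e₁]
    refine ⟨h₂, ?_⟩
    simp only [opL] at e₂
    simp only [e₂]
    refine ⟨h₃, ?_⟩
    exact e₃.symm
  w_right g h x := by
    have F := unitFamily hℬ H huv hu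
    have hx := UnitFamily.mem_prodSpan_of_mem x
    have m₁ := F.twist_right_mem₁ hx
    have m₂ := F.twist_right_mem₂ m₁
    obtain ⟨h₁, e₁⟩ := exists_rightExt
      (fun x : ℬ.block g 1 0 => (rightEntry (u g) 0 1 1 x : B)) (H.dom_dom_le_right_fst _ _ hx)
    obtain ⟨h₂, e₂⟩ := exists_rightExt
      (fun x : ℬ.block h 1 0 => (rightEntry (u h) 0 1 1 x : B)) (comp_dom_le_right _ _ m₁)
    obtain ⟨h₃, e₃⟩ := exists_rightExt
      (fun x : ℬ.block (g * h) 0 1 => (rightEntry (v (g * h)) 1 0 0 x : B))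
      (H.comp_comp_le _ _ m₂)
    simp only [rightExtU_eq, rightExtV_eq]
    refine ⟨h₁, ?_⟩
    simp only [e₁]
    refine ⟨h₂, ?_⟩
    simp only [opR] at e₂
    simp only [e₂]
    refine ⟨h₃, ?_⟩
    exact e₃.symm

theorem exists_gradedIso (hℬ : ℬ.HomogeneouslyNondegenerate) (H : ℬ.TripleProduct)
    (huv : ∀ g, ℬ.IsLinkingPair g (u g) (v g)) (hu : ℬ.ActsAsMatrixUnit (u 1) 0 1) :
    ∃ Θ : TwistedPartialAction k G ℬ.one, ℬ.IsBuiltFrom u v Θ ∧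
      ∃ φ : ℬ.GradedIso Θ,
        (∀ g (a : ℬ.comp g), ∃ c : Θ.D g,
          ((c : ℬ.one) : B) = ((v g).right (ℬ.single g 0 1 a)).1 0 0 ∧
          φ.toLinearEquiv a = CrossedProduct.δ Θ g c) ∧
        (∀ g (c : Θ.D g), ∃ hc : ((c : ℬ.one) : B) ∈ ℬ.block g 0 0,
          φ.toLinearEquiv.symm (CrossedProduct.δ Θ g c) =
            ((u g).right (ℬ.single g 0 0 ⟨_, hc⟩)).1 0 1) := by
  refine ⟨_, isBuiltFrom hℬ H huv hu, (unitFamily hℬ H huv hu).gradedIso, fun g a => ?_,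
    fun g c => ⟨c.2, ?_⟩⟩
  · exact ⟨_, (huv g).links.symm.opR_apply H hℬ (m := 0) a,
      (unitFamily hℬ H huv hu).linearEquiv_of_mem a⟩
  · refine ((unitFamily hℬ H huv hu).linearEquiv_symm_δ c).trans ?_
    exact (huv g).links.opR_apply H hℬ (m := 0) ⟨_, c.2⟩

end Family

/-! ### Matrix units in degree one -/

theorem TripleProduct.block_one (H : ℬ.TripleProduct) (i j : Fin 2) :
    ℬ.block 1 i j = ℬ.comp 1 := by
  have h := H.one_one
  fin_cases i <;> fin_cases j
  · exact (congrArg (fun t => ℬ.comp 1 ⬝ ℬ.comp t) inv_one).trans h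
  · rfl
  · exact congrArg ℬ.comp inv_one
  · exact (congrArg (fun t => ℬ.comp t ⬝ ℬ.comp 1) inv_one).trans h

/-- The matrix unit `e_{ij}` as a multiplier of `C_1`. -/
def TripleProduct.matrixUnit (H : ℬ.TripleProduct) (i j : Fin 2) :
    Multiplier k (ℬ.linking 1) where
  left :=
    { toFun := fun X => ⟨Matrix.of fun a b => if a = i then X.1 j b else 0, fun a b => by
        simp only [Matrix.of_apply]
        split_ifs
        · have := X.2 j b
          rw [H.block_one] at this ⊢; exact this
        · exact zero_mem _⟩
      map_add' := fun X Y => by ext a b; by_cases h : a = i <;> simp [h]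
      map_smul' := fun c X => by ext a b; by_cases h : a = i <;> simp [h] }
  right :=
    { toFun := fun X => ⟨Matrix.of fun a b => if b = j then X.1 a i else 0, fun a b => by
        simp only [Matrix.of_apply]
        split_ifs
        · have := X.2 a i
          rw [H.block_one] at this ⊢; exact this
        · exact zero_mem _⟩
      map_add' := fun X Y => by ext a b; by_cases h : b = j <;> simp [h]
      map_smul' := fun c X => by ext a b; by_cases h : b = j <;> simp [h] }
  left_mul X Y := by ext a b; by_cases h : a = i <;> simp [Matrix.mul_apply, h]
  right_mul X Y := by ext a b; by_cases h : b = j <;> simp [Matrix.mul_apply, h]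
  right_mul_eq X Y := by ext a b; simp [Matrix.mul_apply]

theorem TripleProduct.actsAsMatrixUnit (H : ℬ.TripleProduct) (i j : Fin 2) :
    ℬ.ActsAsMatrixUnit (H.matrixUnit i j) i j :=
  fun _ _ _ => ⟨rfl, rfl⟩

theorem TripleProduct.matrixUnit_mul (H : ℬ.TripleProduct) (i j : Fin 2) :
    H.matrixUnit i j * H.matrixUnit j i = ℬ.e 1 i := by
  refine Multiplier.ext (LinearMap.ext fun X => ?_) (LinearMap.ext fun X => ?_)
  · ext a b
    change (if a = i then (if j = j then X.1 i b else 0) else 0) = if a = i then X.1 a b else 0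
    rw [if_pos rfl]; split_ifs with h <;> simp [h]
  · ext a b
    change (if b = i then (if j = j then X.1 a i else 0) else 0) = if b = i then X.1 a b else 0
    rw [if_pos rfl]; split_ifs with h <;> simp [h]

theorem TripleProduct.exists_normalized (H : ℬ.TripleProduct)
    (hL : ∀ g, ∃ u v : Multiplier k (ℬ.linking g), ℬ.IsLinkingPair g u v) :
    ∃ u v : ∀ g, Multiplier k (ℬ.linking g), (∀ g, ℬ.IsLinkingPair g (u g) (v g)) ∧
      ℬ.ActsAsMatrixUnit (u 1) 0 1 ∧ ℬ.ActsAsMatrixUnit (v 1) 1 0 := by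
  choose u v huv using hL
  refine ⟨Function.update u 1 (H.matrixUnit 0 1), Function.update v 1 (H.matrixUnit 1 0),
    fun g => ?_, ?_, ?_⟩
  · by_cases hg : g = 1
    · subst hg
      simp only [Function.update_self]
      exact ⟨H.matrixUnit_mul 0 1, H.matrixUnit_mul 1 0⟩
    · simp only [Function.update_of_ne hg]
      exact huv g
  · simp only [Function.update_self]; exact H.actsAsMatrixUnit 0 1
  · simp only [Function.update_self]; exact H.actsAsMatrixUnit 1 0

end Grading

/-! ### Computations in a twisted partial action -/

namespace TwistedPartialAction

variable {k : Type uk} {G : Type uG} {A : Type uA} [CommRing k] [Group G]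
  [NonUnitalRing A] [Module k A] [IsScalarTower k A A] [SMulCommClass k A A]
  (Θ : TwistedPartialAction k G A) {g h : G}

theorem mem_one {t : G} (ht : t = 1) (a : A) : a ∈ Θ.D t := by
  subst ht; rw [Θ.D_one]; trivial

theorem mem_mul_of_mem (e : g * h = 1) {a : A} (ha : a ∈ Θ.D g) :
    a ∈ Θ.D g * Θ.D (g * h) := by
  rw [← Θ.D_idem g] at ha
  exact AlgIdeal.mul_mono (fun _ h => h) (fun _ _ => Θ.mem_one e _) ha

theorem θ_apply_one {t : G} (ht : t = 1) (x : Θ.D t⁻¹) : (Θ.θ t x : A) = x := by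
  subst ht; exact Θ.θ_one x

/-- Right multiplication by `w_{g,h}` on `D_g`, for `g h = 1`. -/
def twistRight (e : g * h = 1) : Θ.D g ≃ₗ[k] Θ.D g where
  toFun a := ⟨(Θ.w g h).val.right ⟨a, Θ.mem_mul_of_mem e a.2⟩,
    AlgIdeal.mem_left_of_mem_mul (Subtype.property _)⟩
  map_add' a b := Subtype.ext (congrArg (fun z : ↥(Θ.D g * Θ.D (g * h)) => (z : A))
    ((Θ.w g h).val.right.map_add
    ⟨a, Θ.mem_mul_of_mem e a.2⟩ ⟨b, Θ.mem_mul_of_mem e b.2⟩))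
  map_smul' c a := Subtype.ext (congrArg (fun z : ↥(Θ.D g * Θ.D (g * h)) => (z : A))
    ((Θ.w g h).val.right.map_smul c
    ⟨a, Θ.mem_mul_of_mem e a.2⟩))
  invFun a := ⟨((Θ.w g h)⁻¹).val.right ⟨a, Θ.mem_mul_of_mem e a.2⟩,
    AlgIdeal.mem_left_of_mem_mul (Subtype.property _)⟩
  left_inv a := Subtype.ext (congrArg
    (fun z : Multiplier k ↥(Θ.D g * Θ.D (g * h)) => (z.right ⟨(a : A), Θ.mem_mul_of_mem e a.2⟩).1) (Θ.w g h).mul_inv)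
  right_inv a := Subtype.ext (congrArg
    (fun z : Multiplier k ↥(Θ.D g * Θ.D (g * h)) => (z.right ⟨(a : A), Θ.mem_mul_of_mem e a.2⟩).1) (Θ.w g h).inv_mul)

theorem twistRight_mul (e : g * h = 1) (a b : Θ.D g) :
    Θ.twistRight e (a * b) = a * Θ.twistRight e b :=
  Subtype.ext (congrArg (fun z : ↥(Θ.D g * Θ.D (g * h)) => (z : A)) ((Θ.w g h).val.right_mul
    ⟨a, Θ.mem_mul_of_mem e a.2⟩ ⟨b, Θ.mem_mul_of_mem e b.2⟩))

/-- `θ_g` on `D_h`, for `g h = 1`. -/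
def θ' (e : g * h = 1) (x : Θ.D h) : Θ.D g :=
  Θ.θ g ⟨x, by rw [inv_eq_of_mul_eq_one_right e]; exact x.2⟩

theorem θ_symm_mul (e : g * h = 1) (a : Θ.D g) (b : Θ.D h) (hab) :
    Θ.θ g ⟨((Θ.θ g).symm a : A) * b, hab⟩ = a * Θ.θ' e b := by
  have hb : (b : A) ∈ Θ.D g⁻¹ := by rw [inv_eq_of_mul_eq_one_right e]; exact b.2
  refine (Θ.θ_mul g ((Θ.θ g).symm a) ⟨b, hb⟩).trans ?_
  rw [LinearEquiv.apply_symm_apply]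
  rfl

/-- `a θ_g(θ_h(b)) w_{g,h} = (a w_{g,h}) b` for `g h = 1`. -/
theorem twistRight_mul_θ (e : g * h = 1) (e' : h * g = 1) (a b : Θ.D g) :
    Θ.twistRight e (a * Θ.θ' e (Θ.θ' e' b)) = Θ.twistRight e a * b := by
  have hb : (b : A) ∈ Θ.D h⁻¹ := by rw [inv_eq_of_mul_eq_one_right e']; exact b.2
  have hb' : (b : A) ∈ Θ.D h⁻¹ * Θ.D (h⁻¹ * g⁻¹) :=
    AlgIdeal.mul_mono (fun _ h => h) (fun _ _ => Θ.mem_one (by rw [← mul_inv_rev, e, inv_one]) _)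
      ((Θ.D_idem h⁻¹).symm ▸ hb)
  have hθ := Θ.θ_θ g h b hb'
  have h₁ : (⟨Θ.θ (g * h) ⟨b, Θ.mem_dom hb'⟩, Θ.θ_mem_twist hb'⟩ : ↥(Θ.D g * Θ.D (g * h))) =
      ⟨b, Θ.mem_mul_of_mem e b.2⟩ := Subtype.ext (Θ.θ_apply_one e _)
  rw [h₁] at hθ
  rw [twistRight_mul]
  apply Subtype.ext
  change (a : A) * ((Θ.w g h).val.right ⟨(Θ.θ' e (Θ.θ' e' b) : A), _⟩ : A) =
    ((Θ.w g h).val.right ⟨a, Θ.mem_mul_of_mem e a.2⟩ : A) * b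
  have h₂ : (⟨(Θ.θ' e (Θ.θ' e' b) : A), Θ.mem_mul_of_mem e (Θ.θ' e (Θ.θ' e' b)).2⟩ :
      ↥(Θ.D g * Θ.D (g * h))) =
      ((Θ.w g h)⁻¹).val.right ((Θ.w g h).val.left ⟨b, Θ.mem_mul_of_mem e b.2⟩) := Subtype.ext hθ
  rw [h₂]
  have h₃ := congrArg (fun z : Multiplier k ↥(Θ.D g * Θ.D (g * h)) =>
    (z.right ((Θ.w g h).val.left ⟨b, Θ.mem_mul_of_mem e b.2⟩) : A)) (Θ.w g h).inv_mul
  have h₄ := congrArg (fun z : ↥(Θ.D g * Θ.D (g * h)) => (z : A)) ((Θ.w g h).val.right_mul_eq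
    ⟨a, Θ.mem_mul_of_mem e a.2⟩ ⟨b, Θ.mem_mul_of_mem e b.2⟩)
  exact (congrArg ((a : A) * ·) h₃).trans h₄.symm

/-- `θ_g(c w_{h,g}) = θ_g(c) w_{g,h}` for `g h = 1`. -/
theorem θ_twistRight (e : g * h = 1) (e' : h * g = 1) (c : Θ.D h) :
    Θ.θ' e (Θ.twistRight e' c) = Θ.twistRight e (Θ.θ' e c) := by
  have hc : (c : A) ∈ Θ.D g⁻¹ * Θ.D h * Θ.D (h * g) := by
    rw [inv_eq_of_mul_eq_one_right e, Θ.D_idem]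
    exact Θ.mem_mul_of_mem e' c.2
  have h := Θ.cocycle g h g c hc
  have r : ∀ (t : G) (ht : t = 1) (x) (hx), ((Θ.w g t).val.right ⟨x, hx⟩ : A) = x := by
    rintro t rfl x hx; rw [Θ.w_one_right]; rfl
  have l : ∀ (t : G) (ht : t = 1) (x) (hx), ((Θ.w t g).val.right ⟨x, hx⟩ : A) = x := by
    rintro t rfl x hx; rw [Θ.w_one_left]; rfl
  rw [r _ e', l _ e] at h
  exact Subtype.ext h

theorem mem_of_mul_mem {M : Type*} [AddCommGroup M] [Module k M]
    {S : Submodule k M} (f : Θ.D g →ₗ[k] M)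
    (hf : ∀ a b : Θ.D g, f (a * b) ∈ S) (c : Θ.D g) : f c ∈ S := by
  have key : ∀ x ∈ Θ.D g * Θ.D g, x ∈ (S.comap f).map (Θ.D g).toSubmodule.subtype :=
    AlgIdeal.mul_le fun x hx y hy => ⟨(⟨x, hx⟩ * ⟨y, hy⟩ : Θ.D g), hf _ _, rfl⟩
  obtain ⟨y, hy, hyc⟩ := key c (by rw [Θ.D_idem]; exact c.2)
  have : y = c := Subtype.ext hyc
  exact this ▸ hy

end TwistedPartialAction

namespace Grading

variable {k : Type uk} {G : Type uG} {B : Type uB} [CommRing k] [Group G] [DecidableEq G]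
  [NonUnitalRing B] [Module k B] {ℬ : Grading k G B}

/-! ### Necessity of the conditions -/

namespace GradedIso

variable {A : Type uA} [NonUnitalRing A] [Module k A] [IsScalarTower k A A] [SMulCommClass k A A]
  {Θ : TwistedPartialAction k G A} (φ : ℬ.GradedIso Θ) {g h : G}

/-- The element of `B` corresponding to `a δ_g`. -/
def ψ (g : G) : Θ.D g →ₗ[k] B := φ.toLinearEquiv.symm.toLinearMap ∘ₗ CrossedProduct.δ Θ g

theorem ψ_injective (g : G) : Function.Injective (φ.ψ g) :=
  φ.toLinearEquiv.symm.injective.comp (DirectSum.of_injective (β := fun g => Θ.D g) g)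

theorem range_ψ (g : G) : LinearMap.range (φ.ψ g) = ℬ.comp g := by
  rw [ψ, LinearMap.range_comp, ← φ.map_comp, ← Submodule.map_comp]
  have : φ.toLinearEquiv.symm.toLinearMap ∘ₗ φ.toLinearEquiv.toLinearMap = LinearMap.id := by
    ext x; simp
  rw [this, Submodule.map_id]

theorem ψ_mem (a : Θ.D g) : φ.ψ g a ∈ ℬ.comp g := φ.range_ψ g ▸ ⟨a, rfl⟩

theorem ψ_mul_ψ {t : G} (e : g * h = t) (a : Θ.D g) (b : Θ.D h) (c : Θ.D t)
    (hc : (c : A) = (Θ.w g h).val.right (CrossedProduct.preMul Θ g h a b)) :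
    φ.ψ g a * φ.ψ h b = φ.ψ t c := by
  subst e
  apply φ.toLinearEquiv.injective
  refine (φ.map_mul' _ _).trans ?_
  change φ.toLinearEquiv (φ.toLinearEquiv.symm (CrossedProduct.δ Θ g a)) *
    φ.toLinearEquiv (φ.toLinearEquiv.symm (CrossedProduct.δ Θ h b)) =
    φ.toLinearEquiv (φ.toLinearEquiv.symm (CrossedProduct.δ Θ (g * h) c))
  simp only [LinearEquiv.apply_symm_apply]
  rw [CrossedProduct.δ_mul_δ]
  congr 1
  exact Subtype.ext hc.symm

/-- The element of `B` corresponding to `a δ_1`. -/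
def ψ₁ : A →ₗ[k] B :=
  φ.ψ 1 ∘ₗ { toFun := fun a => ⟨a, Θ.mem_one rfl a⟩
             map_add' := fun _ _ => rfl
             map_smul' := fun _ _ => rfl }

theorem ψ₁_injective : Function.Injective φ.ψ₁ :=
  fun _ _ h => congrArg Subtype.val (φ.ψ_injective 1 h)

theorem ψ₁_mul_ψ (a : A) (b : Θ.D g) :
    φ.ψ₁ a * φ.ψ g b = φ.ψ g ⟨a * b, (Θ.D g).mul_mem_left a b.2⟩ := by
  refine φ.ψ_mul_ψ (one_mul g) _ _ _ ?_
  rw [Θ.w_one_left]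
  change a * (b : A) = Θ.θ 1 (CrossedProduct.preArg Θ 1 g ⟨a, _⟩ b)
  rw [Θ.θ_apply_one rfl]
  change a * (b : A) = ((Θ.θ 1).symm ⟨a, Θ.mem_one rfl a⟩ : A) * b
  have := Θ.θ_apply_one rfl ((Θ.θ 1).symm ⟨a, Θ.mem_one rfl a⟩)
  rw [LinearEquiv.apply_symm_apply] at this
  rw [← this]

theorem ψ₁_mul_ψ₁ (a b : A) : φ.ψ₁ a * φ.ψ₁ b = φ.ψ₁ (a * b) := φ.ψ₁_mul_ψ a _

theorem ψ_mul_ψ₁ (e : g * h = 1) (a : Θ.D g) (b : Θ.D h) :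
    φ.ψ g a * φ.ψ₁ b = φ.ψ g (a * Θ.θ' e b) := by
  refine φ.ψ_mul_ψ (mul_one g) _ _ _ ?_
  rw [Θ.w_one_right, ← Θ.θ_symm_mul e a b ((Θ.D g⁻¹).mul_mem_right _ (Subtype.property _))]
  rfl

theorem ψ_mul_ψ_inv (e : g * h = 1) (a : Θ.D g) (b : Θ.D h) :
    φ.ψ g a * φ.ψ h b = φ.ψ₁ (Θ.twistRight e (a * Θ.θ' e b) : A) := by
  refine φ.ψ_mul_ψ e _ _ _ ?_
  rw [← Θ.θ_symm_mul e a b ((Θ.D g⁻¹).mul_mem_right _ (Subtype.property _))]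
  rfl

variable [IsScalarTower k B B] [SMulCommClass k B B]

theorem mem_prodSpan_iff (e : g * h = 1) {x : B} :
    x ∈ ℬ.comp g ⬝ ℬ.comp h ↔ ∃ c : Θ.D g, φ.ψ₁ c = x := by
  constructor
  · intro hx
    have hle : ℬ.comp g ⬝ ℬ.comp h ≤ LinearMap.range (φ.ψ₁ ∘ₗ (Θ.D g).toSubmodule.subtype) := by
      refine prodSpan_le_iff.2 fun y hy z hz => ?_
      rw [← φ.range_ψ] at hy hz
      obtain ⟨a, rfl⟩ := hy
      obtain ⟨b, rfl⟩ := hz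
      rw [φ.ψ_mul_ψ_inv e]
      exact ⟨Θ.twistRight e (a * Θ.θ' e b), rfl⟩
    exact hle hx
  · rintro ⟨c, rfl⟩
    have he : g⁻¹ = h := inv_eq_of_mul_eq_one_right e
    subst he
    have key := Θ.mem_of_mul_mem (S := ℬ.comp g ⬝ ℬ.comp g⁻¹)
      (φ.ψ₁ ∘ₗ (Θ.D g).toSubmodule.subtype ∘ₗ (Θ.twistRight e).toLinearMap ∘ₗ
        (Θ.θ g).toLinearMap) (fun a b => by
          have h₁ : Θ.θ g (a * b) = Θ.θ g a * Θ.θ' e b := Θ.θ_mul g a b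
          change φ.ψ₁ (Θ.twistRight e (Θ.θ g (a * b)) : A) ∈ _
          rw [h₁, ← φ.ψ_mul_ψ_inv e]
          exact mul_mem_prodSpan (φ.ψ_mem _) (φ.ψ_mem _))
      ((Θ.θ g).symm ((Θ.twistRight e).symm c))
    simpa using key

include φ in
theorem tripleProduct : ℬ.TripleProduct := by
  intro g
  apply le_antisymm
  · refine (prodSpan_mono (ℬ.dom_le_one g) le_rfl).trans (comp_prodSpan_comp_le (one_mul g))
  · intro x hx
    rw [← φ.range_ψ] at hx
    obtain ⟨c, rfl⟩ := hx
    refine Θ.mem_of_mul_mem (φ.ψ g) (fun a b => ?_) c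
    have := φ.ψ₁_mul_ψ (a : A) b
    have h₁ : φ.ψ g (a * b) = φ.ψ₁ a * φ.ψ g b := this.symm
    rw [h₁]
    exact mul_mem_prodSpan ((φ.mem_prodSpan_iff (mul_inv_cancel g)).2 ⟨a, rfl⟩) (φ.ψ_mem b)

/-- The parametrization of `B_g` by `D_g`. -/
noncomputable def compParam (g : G) : Θ.D g ≃ₗ[k] ℬ.comp g :=
  LinearEquiv.ofBijective ((φ.ψ g).codRestrict (ℬ.comp g) φ.ψ_mem)
    ⟨fun _ _ h => φ.ψ_injective g (congrArg Subtype.val h), fun x => by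
      obtain ⟨a, ha⟩ := (φ.range_ψ g).ge x.2
      exact ⟨a, Subtype.ext ha⟩⟩

/-- The parametrization of `B_g B_h` by `D_g`, for `g h = 1`. -/
noncomputable def domParam (e : g * h = 1) : Θ.D g ≃ₗ[k] ↥(ℬ.comp g ⬝ ℬ.comp h) :=
  LinearEquiv.ofBijective
    ((φ.ψ₁ ∘ₗ (Θ.D g).toSubmodule.subtype).codRestrict (ℬ.comp g ⬝ ℬ.comp h)
      fun c => (φ.mem_prodSpan_iff e).2 ⟨c, rfl⟩)
    ⟨fun _ _ h => Subtype.ext (φ.ψ₁_injective (congrArg Subtype.val h)), fun x => by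
      obtain ⟨a, ha⟩ := (φ.mem_prodSpan_iff e).1 x.2
      exact ⟨a, Subtype.ext ha⟩⟩

end GradedIso

end Grading

namespace Grading

variable {k : Type uk} {G : Type uG} {B : Type uB} [CommRing k] [Group G] [DecidableEq G]
  [NonUnitalRing B] [Module k B] [IsScalarTower k B B] [SMulCommClass k B B]
  {ℬ : Grading k G B} {g : G}

/-! ### Multipliers of the linking algebra given by entries -/

/-- The multiplier of `C_g` concentrated in the `(i, j)` entry, given by left multiplication maps
from the `j`-th to the `i`-th row and right multiplication maps from the `i`-th to the `j`-th
column. -/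
def entryMultiplier (i j : Fin 2) (lE : ∀ m, ℬ.block g j m →ₗ[k] ℬ.block g i m)
    (rE : ∀ m, ℬ.block g m i →ₗ[k] ℬ.block g m j)
    (hl : ∀ l m (x : ℬ.block g j l) (y : ℬ.block g l m),
      (lE m ⟨(x : B) * y, ℬ.block_mul g j l m x.2 y.2⟩ : B) = lE l x * y)
    (hr : ∀ l m (x : ℬ.block g m l) (y : ℬ.block g l i),
      (rE m ⟨(x : B) * y, ℬ.block_mul g m l i x.2 y.2⟩ : B) = x * rE l y)
    (hc : ∀ m n (x : ℬ.block g m i) (y : ℬ.block g j n), (rE m x : B) * y = x * lE n y) :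
    Multiplier k (ℬ.linking g) where
  left :=
    { toFun := fun X => ⟨Matrix.of fun a b => if a = i then (lE b ⟨X.1 j b, X.2 j b⟩ : B) else 0,
        fun a b => by
          simp only [Matrix.of_apply]
          split_ifs with h
          · subst h; exact Subtype.property _
          · exact zero_mem _⟩
      map_add' := fun X Y => by
        ext a b
        have h := congrArg Subtype.val ((lE b).map_add ⟨X.1 j b, X.2 j b⟩ ⟨Y.1 j b, Y.2 j b⟩)
        change (if a = i then (lE b ⟨(X + Y).1 j b, (X + Y).2 j b⟩ : B) else 0) =
          (if a = i then (lE b ⟨X.1 j b, X.2 j b⟩ : B) else 0) +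
            (if a = i then (lE b ⟨Y.1 j b, Y.2 j b⟩ : B) else 0)
        split_ifs
        · exact h
        · exact (add_zero 0).symm
      map_smul' := fun c X => by
        ext a b
        have h := congrArg Subtype.val ((lE b).map_smul c ⟨X.1 j b, X.2 j b⟩)
        change (if a = i then (lE b ⟨(c • X).1 j b, (c • X).2 j b⟩ : B) else 0) =
          c • (if a = i then (lE b ⟨X.1 j b, X.2 j b⟩ : B) else 0)
        split_ifs
        · exact h
        · exact (smul_zero c).symm }
  right :=
    { toFun := fun X => ⟨Matrix.of fun a b => if b = j then (rE a ⟨X.1 a i, X.2 a i⟩ : B) else 0,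
        fun a b => by
          simp only [Matrix.of_apply]
          split_ifs with h
          · subst h; exact Subtype.property _
          · exact zero_mem _⟩
      map_add' := fun X Y => by
        ext a b
        have h := congrArg Subtype.val ((rE a).map_add ⟨X.1 a i, X.2 a i⟩ ⟨Y.1 a i, Y.2 a i⟩)
        change (if b = j then (rE a ⟨(X + Y).1 a i, (X + Y).2 a i⟩ : B) else 0) =
          (if b = j then (rE a ⟨X.1 a i, X.2 a i⟩ : B) else 0) +
            (if b = j then (rE a ⟨Y.1 a i, Y.2 a i⟩ : B) else 0)
        split_ifs
        · exact h
        · exact (add_zero 0).symm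
      map_smul' := fun c X => by
        ext a b
        have h := congrArg Subtype.val ((rE a).map_smul c ⟨X.1 a i, X.2 a i⟩)
        change (if b = j then (rE a ⟨(c • X).1 a i, (c • X).2 a i⟩ : B) else 0) =
          c • (if b = j then (rE a ⟨X.1 a i, X.2 a i⟩ : B) else 0)
        split_ifs
        · exact h
        · exact (smul_zero c).symm }
  left_mul X Y := by
    ext a b
    change (if a = i then (lE b ⟨(X.1 * Y.1) j b, (X * Y).2 j b⟩ : B) else 0) =
      ((Matrix.of fun a b => if a = i then (lE b ⟨X.1 j b, X.2 j b⟩ : B) else 0) * Y.1) a b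
    simp only [Matrix.mul_apply, Matrix.of_apply]
    split_ifs
    · have h : (⟨∑ l, X.1 j l * Y.1 l b, by simpa [Matrix.mul_apply] using (X * Y).2 j b⟩ :
          ℬ.block g j b) =
          ∑ l, ⟨X.1 j l * Y.1 l b, ℬ.block_mul g j l b (X.2 j l) (Y.2 l b)⟩ :=
        Subtype.ext (by simp)
      rw [h, map_sum, AddSubmonoidClass.coe_finsetSum]
      exact Finset.sum_congr rfl fun l _ => hl l b ⟨X.1 j l, X.2 j l⟩ ⟨Y.1 l b, Y.2 l b⟩
    · simp
  right_mul X Y := by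
    ext a b
    change (if b = j then (rE a ⟨(X.1 * Y.1) a i, (X * Y).2 a i⟩ : B) else 0) =
      (X.1 * (Matrix.of fun a b => if b = j then (rE a ⟨Y.1 a i, Y.2 a i⟩ : B) else 0)) a b
    simp only [Matrix.mul_apply, Matrix.of_apply]
    split_ifs
    · have h : (⟨∑ l, X.1 a l * Y.1 l i, by simpa [Matrix.mul_apply] using (X * Y).2 a i⟩ :
          ℬ.block g a i) =
          ∑ l, ⟨X.1 a l * Y.1 l i, ℬ.block_mul g a l i (X.2 a l) (Y.2 l i)⟩ :=
        Subtype.ext (by simp)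
      rw [h, map_sum, AddSubmonoidClass.coe_finsetSum]
      exact Finset.sum_congr rfl fun l _ => hr l a ⟨X.1 a l, X.2 a l⟩ ⟨Y.1 l i, Y.2 l i⟩
    · simp
  right_mul_eq X Y := by
    ext a b
    change ((Matrix.of fun a b => if b = j then (rE a ⟨X.1 a i, X.2 a i⟩ : B) else 0) * Y.1) a b =
      (X.1 * (Matrix.of fun a b => if a = i then (lE b ⟨Y.1 j b, Y.2 j b⟩ : B) else 0)) a b
    simp only [Matrix.mul_apply, Matrix.of_apply, ite_mul, mul_ite, zero_mul, mul_zero,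
      Finset.sum_ite_eq', Finset.mem_univ, if_true]
    exact hc a b ⟨X.1 a i, X.2 a i⟩ ⟨Y.1 j b, Y.2 j b⟩

/-- Compatible isomorphisms between the rows and between the columns of the linking algebra give
a pair `u, v` with `u v = e_{11}` and `v u = e_{22}`. -/
theorem exists_isLinkingPair (hℬ : ℬ.HomogeneouslyNondegenerate)
    (lE : ∀ m, ℬ.block g 1 m ≃ₗ[k] ℬ.block g 0 m) (rE : ∀ m, ℬ.block g m 0 ≃ₗ[k] ℬ.block g m 1)
    (hc : ∀ m n (x : ℬ.block g m 0) (y : ℬ.block g 1 n), (rE m x : B) * y = x * lE n y) :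
    ∃ u v : Multiplier k (ℬ.linking g), ℬ.IsLinkingPair g u v := by
  have nondegL : ∀ n (d : ℬ.block g 0 n), (∀ m (z : ℬ.block g m 0), (z : B) * d = 0) → d = 0 := by
    intro n d hd
    have h₀ : ∀ d : ℬ.block g 0 1, (∀ z : ℬ.block g 1 0, (z : B) * d = 0) → d = 0 :=
      fun d hd => Subtype.ext (hℬ.eq_zero_of_left (t := g) d.2 fun z hz => hd ⟨z, hz⟩)
    fin_cases n
    · have h₁ : (lE 0).symm d = 0 := by
        refine Subtype.ext (hℬ.eq_zero_of_left (t := g⁻¹) (Subtype.property _) fun z hz => ?_)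
        rw [inv_inv] at hz
        have := hc 0 0 ((rE 0).symm ⟨z, hz⟩) ((lE 0).symm d)
        rw [LinearEquiv.apply_symm_apply, LinearEquiv.apply_symm_apply] at this
        exact this.trans (hd 0 _)
      simpa using h₁
    · exact h₀ d fun z => hd 1 z
  have nondegR : ∀ m (d : ℬ.block g m 1), (∀ n (z : ℬ.block g 1 n), (d : B) * z = 0) → d = 0 := by
    intro m d hd
    have h₀ : ∀ d : ℬ.block g 0 1, (∀ z : ℬ.block g 1 0, (d : B) * z = 0) → d = 0 :=
      fun d hd => Subtype.ext (hℬ.eq_zero_of_right (t := g) d.2 fun z hz => hd ⟨z, hz⟩)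
    fin_cases m
    · exact h₀ d fun z => hd 0 z
    · have h₁ : (rE 1).symm d = 0 := by
        refine Subtype.ext (hℬ.eq_zero_of_right (t := g⁻¹) (Subtype.property _) fun z hz => ?_)
        rw [inv_inv] at hz
        have := hc 1 1 ((rE 1).symm d) ((lE 1).symm ⟨z, hz⟩)
        rw [LinearEquiv.apply_symm_apply, LinearEquiv.apply_symm_apply] at this
        exact this.symm.trans (hd 1 _)
      simpa using h₁
  have hl : ∀ l m (x : ℬ.block g 1 l) (y : ℬ.block g l m),
      (lE m ⟨(x : B) * y, ℬ.block_mul g 1 l m x.2 y.2⟩ : B) = lE l x * y := by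
    intro l m x y
    have := nondegL m (lE m ⟨(x : B) * y, ℬ.block_mul g 1 l m x.2 y.2⟩ -
      ⟨lE l x * y, ℬ.block_mul g 0 l m (lE l x).2 y.2⟩) fun n z => by
        change (z : B) * (_ - _) = 0
        rw [mul_sub, ← hc, sub_eq_zero, ← mul_assoc, ← mul_assoc, hc]
    exact sub_eq_zero.1 (congrArg Subtype.val this)
  have hr : ∀ l m (x : ℬ.block g m l) (y : ℬ.block g l 0),
      (rE m ⟨(x : B) * y, ℬ.block_mul g m l 0 x.2 y.2⟩ : B) = x * rE l y := by
    intro l m x y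
    have := nondegR m (rE m ⟨(x : B) * y, ℬ.block_mul g m l 0 x.2 y.2⟩ -
      ⟨x * rE l y, ℬ.block_mul g m l 1 x.2 (rE l y).2⟩) fun n z => by
        change (_ - _) * (z : B) = 0
        rw [sub_mul, hc, sub_eq_zero, mul_assoc, mul_assoc, hc]
    exact sub_eq_zero.1 (congrArg Subtype.val this)
  let u := entryMultiplier (ℬ := ℬ) (g := g) 0 1 (fun m => (lE m).toLinearMap)
    (fun m => (rE m).toLinearMap) hl hr hc
  let v := entryMultiplier (ℬ := ℬ) (g := g) 1 0 (fun m => (lE m).symm.toLinearMap)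
    (fun m => (rE m).symm.toLinearMap)
    (fun l m x y => by
      refine congrArg Subtype.val (((lE m).symm_apply_eq (y := ⟨_, ℬ.block_mul g 1 l m
        ((lE l).symm x).2 y.2⟩)).2 (Subtype.ext ?_))
      rw [hl, LinearEquiv.apply_symm_apply])
    (fun l m x y => by
      refine congrArg Subtype.val (((rE m).symm_apply_eq (y := ⟨_, ℬ.block_mul g m l 0
        x.2 ((rE l).symm y).2⟩)).2 (Subtype.ext ?_))
      rw [hr, LinearEquiv.apply_symm_apply])
    (fun m n x y => by
      have := hc m n ((rE m).symm x) ((lE n).symm y)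
      rw [LinearEquiv.apply_symm_apply, LinearEquiv.apply_symm_apply] at this
      exact this.symm)
  refine ⟨u, v, Multiplier.ext (LinearMap.ext fun X => ?_) (LinearMap.ext fun X => ?_),
    Multiplier.ext (LinearMap.ext fun X => ?_) (LinearMap.ext fun X => ?_)⟩
  · ext a b
    change (if a = 0 then (lE b ((lE b).symm ⟨X.1 0 b, X.2 0 b⟩) : B) else 0) =
      if a = 0 then X.1 a b else 0
    rw [LinearEquiv.apply_symm_apply]
    split_ifs with h <;> simp [h]
  · ext a b
    change (if b = 0 then ((rE a).symm (rE a ⟨X.1 a 0, X.2 a 0⟩) : B) else 0) =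
      if b = 0 then X.1 a b else 0
    rw [LinearEquiv.symm_apply_apply]
    split_ifs with h <;> simp [h]
  · ext a b
    change (if a = 1 then ((lE b).symm (lE b ⟨X.1 1 b, X.2 1 b⟩) : B) else 0) =
      if a = 1 then X.1 a b else 0
    rw [LinearEquiv.symm_apply_apply]
    split_ifs with h <;> simp [h]
  · ext a b
    change (if b = 1 then (rE a ((rE a).symm ⟨X.1 a 1, X.2 a 1⟩) : B) else 0) =
      if b = 1 then X.1 a b else 0
    rw [LinearEquiv.apply_symm_apply]
    split_ifs with h <;> simp [h]

namespace GradedIso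

variable {A : Type uA} [NonUnitalRing A] [Module k A] [IsScalarTower k A A] [SMulCommClass k A A]
  {Θ : TwistedPartialAction k G A} (φ : ℬ.GradedIso Θ)

/-- Left multiplication by `δ_g`, from the second to the first row of `C_g`. -/
noncomputable def rowEquiv (g : G) : ∀ m, ℬ.block g 1 m ≃ₗ[k] ℬ.block g 0 m
  | 0 => (φ.compParam g⁻¹).symm ≪≫ₗ Θ.θ g ≪≫ₗ Θ.twistRight (mul_inv_cancel g) ≪≫ₗ
      φ.domParam (mul_inv_cancel g)
  | 1 => (φ.domParam (inv_mul_cancel g)).symm ≪≫ₗ Θ.θ g ≪≫ₗ φ.compParam g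

/-- Right multiplication by `δ_g`, from the first to the second column of `C_g`. -/
noncomputable def colEquiv (g : G) : ∀ m, ℬ.block g m 0 ≃ₗ[k] ℬ.block g m 1
  | 0 => (φ.domParam (mul_inv_cancel g)).symm ≪≫ₗ φ.compParam g
  | 1 => (φ.compParam g⁻¹).symm ≪≫ₗ Θ.twistRight (inv_mul_cancel g) ≪≫ₗ
      φ.domParam (inv_mul_cancel g)

theorem rowEquiv_zero (g : G) (b : Θ.D g⁻¹) : (φ.rowEquiv g 0 (φ.compParam g⁻¹ b) : B) =
    φ.ψ₁ (Θ.twistRight (mul_inv_cancel g) (Θ.θ g b) : A) := by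
  change (φ.domParam (mul_inv_cancel g) (Θ.twistRight (mul_inv_cancel g) (Θ.θ g
    ((φ.compParam g⁻¹).symm (φ.compParam g⁻¹ b)))) : B) = _
  rw [LinearEquiv.symm_apply_apply]; rfl

theorem rowEquiv_one (g : G) (b : Θ.D g⁻¹) :
    (φ.rowEquiv g 1 (φ.domParam (inv_mul_cancel g) b) : B) = φ.ψ g (Θ.θ g b) := by
  change (φ.compParam g (Θ.θ g ((φ.domParam (inv_mul_cancel g)).symm
    (φ.domParam (inv_mul_cancel g) b))) : B) = _
  rw [LinearEquiv.symm_apply_apply]; rfl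

theorem colEquiv_zero (g : G) (a : Θ.D g) :
    (φ.colEquiv g 0 (φ.domParam (mul_inv_cancel g) a) : B) = φ.ψ g a := by
  change (φ.compParam g ((φ.domParam (mul_inv_cancel g)).symm
    (φ.domParam (mul_inv_cancel g) a)) : B) = _
  rw [LinearEquiv.symm_apply_apply]; rfl

theorem colEquiv_one (g : G) (a : Θ.D g⁻¹) : (φ.colEquiv g 1 (φ.compParam g⁻¹ a) : B) =
    φ.ψ₁ (Θ.twistRight (inv_mul_cancel g) a : A) := by
  change (φ.domParam (inv_mul_cancel g) (Θ.twistRight (inv_mul_cancel g)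
    ((φ.compParam g⁻¹).symm (φ.compParam g⁻¹ a))) : B) = _
  rw [LinearEquiv.symm_apply_apply]; rfl

theorem colEquiv_mul (g : G) (m n : Fin 2) (x : ℬ.block g m 0) (y : ℬ.block g 1 n) :
    (φ.colEquiv g m x : B) * y = x * φ.rowEquiv g n y := by
  have e := mul_inv_cancel g
  have e' := inv_mul_cancel g
  fin_cases m <;> fin_cases n
  · obtain ⟨a, rfl⟩ := (φ.domParam e).surjective x
    obtain ⟨b, rfl⟩ := (φ.compParam g⁻¹).surjective y
    refine (congrArg (· * _) (φ.colEquiv_zero g a)).trans ?_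
    refine Eq.trans ?_ (congrArg (_ * ·) (φ.rowEquiv_zero g b).symm)
    refine (φ.ψ_mul_ψ_inv e a b).trans ?_
    refine Eq.trans ?_ (φ.ψ₁_mul_ψ₁ _ _).symm
    rw [Θ.twistRight_mul]
    rfl
  · obtain ⟨a, rfl⟩ := (φ.domParam e).surjective x
    obtain ⟨b, rfl⟩ := (φ.domParam e').surjective y
    refine (congrArg (· * _) (φ.colEquiv_zero g a)).trans ?_
    refine Eq.trans ?_ (congrArg (_ * ·) (φ.rowEquiv_one g b).symm)
    refine (φ.ψ_mul_ψ₁ e a b).trans ?_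
    exact (φ.ψ₁_mul_ψ _ _).symm
  · obtain ⟨a, rfl⟩ := (φ.compParam g⁻¹).surjective x
    obtain ⟨b, rfl⟩ := (φ.compParam g⁻¹).surjective y
    refine (congrArg (· * _) (φ.colEquiv_one g a)).trans ?_
    refine Eq.trans ?_ (congrArg (_ * ·) (φ.rowEquiv_zero g b).symm)
    refine (φ.ψ₁_mul_ψ _ b).trans ?_
    refine Eq.trans ?_ (φ.ψ_mul_ψ₁ e' a _).symm
    have h₁ : Θ.θ' e' (Θ.twistRight e (Θ.θ g b)) = _ := Θ.θ_twistRight e' e (Θ.θ' e b)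
    rw [h₁, ← Θ.twistRight_mul, Θ.twistRight_mul_θ]
    rfl
  · obtain ⟨a, rfl⟩ := (φ.compParam g⁻¹).surjective x
    obtain ⟨b, rfl⟩ := (φ.domParam e').surjective y
    refine (congrArg (· * _) (φ.colEquiv_one g a)).trans ?_
    refine Eq.trans ?_ (congrArg (_ * ·) (φ.rowEquiv_one g b).symm)
    refine (φ.ψ₁_mul_ψ₁ _ _).trans ?_
    refine Eq.trans ?_ (φ.ψ_mul_ψ_inv e' a _).symm
    exact congrArg (fun c : Θ.D g⁻¹ => φ.ψ₁ c) (Θ.twistRight_mul_θ e' e a b).symm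

end GradedIso

end Grading

end PartialCrossed

open PartialCrossed

theorem theorem5p1 {k : Type uk} [CommRing k] {G : Type uG} [Group G] [DecidableEq G]
    {B : Type uB} [NonUnitalRing B] [Module k B] [IsScalarTower k B B] [SMulCommClass k B B]
    (ℬ : Grading k G B) (hℬ : ℬ.HomogeneouslyNondegenerate) :
    ((∃ (A : Type uB) (_ : NonUnitalRing A) (_ : Module k A) (_ : IsScalarTower k A A)
        (_ : SMulCommClass k A A) (Θ : TwistedPartialAction k G A), Nonempty (ℬ.GradedIso Θ)) ↔
      ℬ.TripleProduct ∧
        ∀ g, ∃ u v : Multiplier k (ℬ.linking g), ℬ.IsLinkingPair g u v) ∧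
    (ℬ.TripleProduct → (∀ g, ∃ u v : Multiplier k (ℬ.linking g), ℬ.IsLinkingPair g u v) →
      (∃ u v : ∀ g, Multiplier k (ℬ.linking g), (∀ g, ℬ.IsLinkingPair g (u g) (v g)) ∧
        ℬ.ActsAsMatrixUnit (u 1) 0 1 ∧ ℬ.ActsAsMatrixUnit (v 1) 1 0) ∧
      ∀ u v : ∀ g, Multiplier k (ℬ.linking g), (∀ g, ℬ.IsLinkingPair g (u g) (v g)) →
        ℬ.ActsAsMatrixUnit (u 1) 0 1 → ℬ.ActsAsMatrixUnit (v 1) 1 0 →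
        (∀ g, ℬ.ExtensionsWellDefined (u g) (v g)) ∧
        ∃ Θ : TwistedPartialAction k G ℬ.one, ℬ.IsBuiltFrom u v Θ ∧
          ∃ φ : ℬ.GradedIso Θ,
            (∀ g (a : ℬ.comp g), ∃ c : Θ.D g,
              ((c : ℬ.one) : B) = ((v g).right (ℬ.single g 0 1 a)).1 0 0 ∧
              φ.toLinearEquiv a = CrossedProduct.δ Θ g c) ∧
            (∀ g (c : Θ.D g), ∃ hc : ((c : ℬ.one) : B) ∈ ℬ.block g 0 0,
              φ.toLinearEquiv.symm (CrossedProduct.δ Θ g c) =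
                ((u g).right (ℬ.single g 0 0 ⟨_, hc⟩)).1 0 1)) := by
  refine ⟨⟨?_, ?_⟩, fun H hL => ⟨H.exists_normalized hL, fun u v huv hu _ =>
    ⟨fun g => (huv g).extensionsWellDefined H hℬ, Grading.exists_gradedIso hℬ H huv hu⟩⟩⟩
  · rintro ⟨A, _, _, _, _, Θ, ⟨φ⟩⟩
    exact ⟨φ.tripleProduct, fun g =>
      Grading.exists_isLinkingPair hℬ (φ.rowEquiv g) (φ.colEquiv g) (φ.colEquiv_mul g)⟩
  · rintro ⟨H, hL⟩
    obtain ⟨u, v, huv, hu, -⟩ := H.exists_normalized hL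
    obtain ⟨Θ, -, φ, -⟩ := Grading.exists_gradedIso hℬ H huv hu
    exact ⟨ℬ.one, inferInstance, inferInstance, inferInstance, inferInstance, Θ, ⟨φ⟩⟩
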